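/- Let $\sigma\in\mathbb R$ and let $\nu$ be a L\'evy measure on $\mathbb R$ (that is, $\nu(\{0\})=0$ and $\int 1\wedge x^2\,\nu(dx)<\infty$), with $\sigma\ne 0$ or $\nu\neq 0$. Let $I_\nu=\{q\in\mathbb R:\int_{|x|\ge 1}e^{qx}\,\nu(dx)<\infty\}$, assume $[0,1]\subset I_\nu$, put $a=-\frac{\sigma^2}{2}-\int(e^x-1-x\mathbf 1_{|x|\le 1})\,\nu(dx)$ and $$\psi(z)=iaz-\tfrac12\sigma^2z^2+\int_{\mathbb R}\bigl(e^{izx}-1-izx\mathbf 1_{|x|\le1}\bigr)\,\nu(dx),\qquad \varphi(q)=\psi(-iq)-(q-1)\quad(q\in I_\nu).$$ Let $\Lambda$ be a homogeneous independently scattered random measure on the upper half-plane $\mathbb H$ with L\'evy exponent $\psi$ and intensity $\lambda(dx\,dy)=y^{-2}dx\,dy$: for Borel sets of finite $\lambda$-measure, $\mathbb E(e^{iq\Lambda(B)})=e^{\psi(q)\lambda(B)}$ for $q\in\mathbb R$, and for disjoint $B_1,B_2,\dots$ the variables $\Lambda(B_i)$ are independent, with $\Lambda(\bigcup_iB_i)=\sum_i\Lambda(B_i)$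 almost surely if $\lambda(\bigcup_i B_i)<\infty$. For $t\in[0,1]$ and $\epsilon>0$ let $V(t)=\{x+iy\in\mathbb H:-y/2<x-t\le y/2\}$ and $V_\epsilon(t)=\bigl(V(t)\setminus\bigcap_{s\in[0,1]}V(s)\bigr)\cap\{y\ge\epsilon\}$. Let $\mu_\epsilon$ be the random measure $\mu_\epsilon(dx)=e^{\Lambda(V_\epsilon(x))}\,dx$ on $[0,1]$, where a c\`adl\`ag modification of $x\mapsto e^{\Lambda(V_\epsilon(x))}$ is used, and let $\mu$ be the almost sure weak limit, as $t\to\infty$, of a (weakly) right-continuous modification of $(\mu_{1/t})_{t>0}$. Suppose that there is $\zeta\in I_\nu\cap(1,\infty)$ with $\varphi(\zeta)=0$ and $\varphi'(\zeta)<\infty$ (a left derivative if $\zeta=\max I_\nu$), and let $\kappa=\zeta-1$, $I_0=[0,1/2]$, $I_1=[1/2,1]$. Then the random variable $\mu(I_0)\,\mu(I_1)^{\kappa}$ satisfies $$\mathbb E\bigl(\mu(I_0)\,\mu(I_1)^{\kappa}\bigr)<\infty,\qquad\text{whereas}\qquad \mathbb E\bigl(\mu([0,1])^{\zeta}\bigr)=\infty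 .$$ -/

import Mathlib

open Set Filter Topology MeasureTheory ProbabilityTheory
open scoped ENNReal NNReal

noncomputable section

namespace ExactCascade

/-! ## Lévy exponents -/

/-- `ν` is a Lévy measure on the line: no mass at `0` and `∫ 1 ∧ x² ν(dx) < ∞`. -/
structure IsLevyMeasure (ν : Measure ℝ) : Prop where
  zero_mass : ν {0} = 0
  lintegral_lt_top : ∫⁻ x, ENNReal.ofReal (min 1 (x ^ 2)) ∂ν < ⊤

/-- The exponent `ψ(z) = i a z - σ² z² / 2 + ∫ (e^{i z x} - 1 - i z x 1_{|x| ≤ 1}) ν(dx)`.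
For real `z` this is the characteristic Lévy exponent; the same formula gives its natural
extension to the complex `z` with `-Im z ∈ expDomain ν`. -/
def levyExponent (a σ : ℝ) (ν : Measure ℝ) (z : ℂ) : ℂ :=
  Complex.I * a * z - (σ : ℂ) ^ 2 * z ^ 2 / 2 +
    ∫ x : ℝ, (Complex.exp (Complex.I * z * x) - 1 -
      (if |x| ≤ 1 then Complex.I * z * x else 0)) ∂ν

/-- The interval `I_ν` of those real `q` with `∫_{|x| ≥ 1} e^{q x} ν(dx) < ∞`. -/
def expDomain (ν : Measure ℝ) : Set ℝ :=
  {q | ∫⁻ x in {x : ℝ | 1 ≤ |x|}, ENNReal.ofReal (Real.exp (q * x)) ∂ν < ⊤}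

/-- The normalizing drift `a = -σ²/2 - ∫ (e^x - 1 - x 1_{|x| ≤ 1}) ν(dx)`. -/
def drift (σ : ℝ) (ν : Measure ℝ) : ℝ :=
  -(σ ^ 2) / 2 - ∫ x : ℝ, (Real.exp x - 1 - (if |x| ≤ 1 then x else 0)) ∂ν

/-- The normalized exponent `ψ`, with the drift `a = drift σ ν`. -/
def normExponent (σ : ℝ) (ν : Measure ℝ) : ℂ → ℂ :=
  levyExponent (drift σ ν) σ ν

/-- `φ(q) = ψ(-iq) - (q - 1)`, considered for `q ∈ expDomain ν`, where `ψ(-iq)` is real. -/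
def phi (σ : ℝ) (ν : Measure ℝ) (q : ℝ) : ℝ :=
  (normExponent σ ν (-Complex.I * q)).re - (q - 1)

/-! ## The half-plane, its hyperbolic area and independently scattered random measures -/

/-- The open upper half-plane, the point `x + i y` being written `(x, y)`. -/
def halfPlane : Set (ℝ × ℝ) := {z | 0 < z.2}

/-- The measure `λ(dx dy) = y⁻² dx dy` on the upper half-plane. -/
def hypArea : Measure (ℝ × ℝ) :=
  (volume.restrict halfPlane).withDensity fun z => ENNReal.ofReal ((z.2 ^ 2)⁻¹)

/-- The Borel subsets of the half-plane with finite `λ`-measure. -/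
def finiteAreaSets : Set (Set (ℝ × ℝ)) :=
  {B | MeasurableSet B ∧ B ⊆ halfPlane ∧ hypArea B < ⊤}

/-- `Λ` is a homogeneous independently scattered random measure on the half-plane with Lévy
exponent `ψ` and intensity `λ`. Almost sure convergence of the series is that of its partial
sums; it is in general not absolute. -/
structure IsScatteredMeasure {Ω : Type*} [MeasurableSpace Ω] (P : Measure Ω) (ψ : ℂ → ℂ)
    (Λ : Set (ℝ × ℝ) → Ω → ℝ) : Prop where
  measurable : ∀ B ∈ finiteAreaSets, Measurable (Λ B)
  charFun_eq : ∀ B ∈ finiteAreaSets, ∀ q : ℝ,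
    ∫ ω, Complex.exp (Complex.I * q * (Λ B ω : ℂ)) ∂P =
      Complex.exp (ψ q * ((hypArea B).toReal : ℂ))
  indep : ∀ B : ℕ → Set (ℝ × ℝ), (∀ i, B i ∈ finiteAreaSets) →
    Pairwise (fun i j => Disjoint (B i) (B j)) → iIndepFun (fun i => Λ (B i)) P
  sigma_additive : ∀ B : ℕ → Set (ℝ × ℝ), (∀ i, B i ∈ finiteAreaSets) →
    Pairwise (fun i j => Disjoint (B i) (B j)) → (⋃ i, B i) ∈ finiteAreaSets →
    ∀ᵐ ω ∂P, Tendsto (fun n : ℕ => ∑ i ∈ Finset.range n, Λ (B i) ω) atTop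
      (𝓝 (Λ (⋃ i, B i) ω))

/-! ## Cones -/

/-- The cone `V(t) = {x + i y : -y/2 < x - t ≤ y/2}` in the upper half-plane. -/
def cone (t : ℝ) : Set (ℝ × ℝ) :=
  {z | 0 < z.2 ∧ -z.2 / 2 < z.1 - t ∧ z.1 - t ≤ z.2 / 2}

/-- `V(I) = ⋂_{t ∈ I} V(t)`. -/
def coneInter (I : Set ℝ) : Set (ℝ × ℝ) := ⋂ t ∈ I, cone t

/-- `V_ε^I(t) = (V(t) \ V(I)) ∩ {y ≥ ε}`. -/
def truncCone (I : Set ℝ) (ε t : ℝ) : Set (ℝ × ℝ) :=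
  (cone t \ coneInter I) ∩ {z | ε ≤ z.2}

/-! ## The cascade on `[0, 1]` -/

/-- `f` is càdlàg on `[a, b]`; values outside `[a, b]` play no role. -/
def IsCadlagOn (f : ℝ → ℝ) (a b : ℝ) : Prop :=
  (∀ t ∈ Ico a b, Tendsto f (𝓝[≥] t) (𝓝 (f t))) ∧
    ∀ t ∈ Ioc a b, ∃ l : ℝ, Tendsto f (𝓝[<] t) (𝓝 l)

/-- For every `ε > 0`, `(D ε t)_{t ∈ [0,1]}` is a càdlàg modification of the process
`Q(V_ε^{[0,1]}(t)) = exp Λ(V_ε^{[0,1]}(t))`. -/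
structure IsCadlagDensity {Ω : Type*} [MeasurableSpace Ω] (P : Measure Ω)
    (Λ : Set (ℝ × ℝ) → Ω → ℝ) (D : ℝ → ℝ → Ω → ℝ) : Prop where
  modification : ∀ ε > 0, ∀ t ∈ Icc (0 : ℝ) 1,
    ∀ᵐ ω ∂P, D ε t ω = Real.exp (Λ (truncCone (Icc 0 1) ε t) ω)
  cadlag : ∀ ε > 0, ∀ᵐ ω ∂P, IsCadlagOn (fun t => D ε t ω) 0 1

/-- The measure `μ_ε(dx) = Q(V_ε^{[0,1]}(x)) dx` on `[0, 1]`, seen as a measure on the line. -/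
def cascadeMeasure {Ω : Type*} (D : ℝ → ℝ → Ω → ℝ) (ε : ℝ) (ω : Ω) : Measure ℝ :=
  (volume.restrict (Icc (0 : ℝ) 1)).withDensity fun x => ENNReal.ofReal (D ε x ω)

/-- `(N t)_{t > 0}` is a right-continuous modification (for the weak topology of finite
measures) of the measure-valued process `(μ_{1/t})_{t > 0}`. -/
structure IsRightContinuousVersion {Ω : Type*} [MeasurableSpace Ω] (P : Measure Ω)
    (D : ℝ → ℝ → Ω → ℝ) (N : ℝ → Ω → FiniteMeasure ℝ) : Prop where
  modification : ∀ t > 0, ∀ᵐ ω ∂P, (N t ω : Measure ℝ) = cascadeMeasure D (1 / t) ω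
  right_continuous : ∀ᵐ ω ∂P, ∀ t > 0, Tendsto (fun s => N s ω) (𝓝[≥] t) (𝓝 (N t ω))

/-- The limit measure `μ`: the weak limit of `N t` as `t → ∞`. -/
def limitMeasure {Ω : Type*} (N : ℝ → Ω → FiniteMeasure ℝ) (ω : Ω) : Measure ℝ :=
  ((limUnder atTop fun t : ℝ => N t ω : FiniteMeasure ℝ) : Measure ℝ)

end ExactCascade

end

/-!
Write `Q(B) = exp Λ(B)`, and identify the point `x + i y` of the half-plane with the interval
`[x - y/2, x + y/2)`, so that `V(t)` becomes the set of the intervals which contain `t`.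

*Moments of the factors.* `E Q(B)^q = exp(Ψ(q) λ(B))` for `0 ≤ q ≤ ζ`, where `Ψ(q) = ψ(-iq)` is
`logMoment`. This is obtained from the characteristic function alone: `E exp(q X - δ X² / 2)` is an
integral of that function along a horizontal line; the contour is shifted, and `δ` tends to `0`
(`lintegral_exp_eq_of_charFun`). Since `Ψ(1) = 0` and `φ(ζ) = 0`, strict convexity gives `φ < 0` on
`(1, ζ)` (`phi_neg_of_mem_Ioo`).

*Scaling.* For an interval `J ⊆ [0, 1]` of length `1/2`, the intervals which contain `J` but not
`[0, 1]` form a set of area `log 2`, with factor `W`; the densities on `J` at scale `ε` are `W`,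
times an independent copy of the densities on `[0, 1]` at scale `2 ε`
(`IsScatteredMeasure.lintegral_block_scaling`). Hence a `q`-homogeneous functional of the cascade
has its expectation multiplied by `2^{φ(q) - 1}` when `[0, 1]` is replaced by one of its halves.

*The mixed moment.* Let `κ = ζ - 1`, and let `L`, `R` be the masses of the two halves at scale `ε`.
The symmetrized expectation `E (L R^κ + R L^κ)` is bounded uniformly in `ε`
(`IsCascadeModel.exists_lintegral_crossFun_le`): the halves are cut into quarters. For two quarters
which are not adjacent, only the intervals of length at least `1/4` are shared; these are
controlled by a maximal inequality, and what remains factorizes into a first moment and a moment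
of order `κ < ζ`. The two adjacent quarters in the middle are a copy of the two halves at scale
`2 ε`, with a factor `2^{φ(ζ) - 1} = 1/2`, so that the recursion contracts. The same recursion for
`κ < ζ - 1`, with the inequality `(L + R)^{κ + 1} ≤ L^{κ + 1} + R^{κ + 1} + C (L R^κ + R L^κ)`,
bounds the moments of every order less than `ζ`, by induction on the order
(`IsCascadeModel.exists_lintegral_block_rpow_le`).

*Passage to the limit.* The masses at scale `ε` are almost sure limits of Riemann sums with dyadic
mesh, to which the bounds above apply. The integrals of a fixed function against the measures at
scale `1 / t` form an `L^p`-bounded martingale, so the measures converge weakly almost surely, and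
the limit does not charge `1/2` because its mean is Lebesgue measure
(`IsCascadeModel.ae_tendsto_halves`). Fatou's lemma gives the finiteness of the mixed moment.

*The infinite moment.* Exact scaling holds for the limit as well, with `2^{φ(ζ) - 1} = 1/2`. If
`E μ([0, 1])^ζ` were finite, it would equal `E μ(I₀)^ζ + E μ(I₁)^ζ`, and since `x ↦ x^ζ` is strictly
superadditive one of the two halves would have mass `0` almost surely. Then
`E μ([0, 1])^p = 2^{φ(p)} E μ([0, 1])^p` for `1 < p < ζ`, with `φ(p) < 0` and a finite moment, so
that `μ = 0`, contrary to `E μ([0, 1]) = 1` (`IsCascadeModel.lintegral_rpow_eq_top`).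
-/

set_option linter.unusedSectionVars false

namespace ExactCascade

/-! ### Exponential moments from an analytic continuation of the characteristic function -/

/-- Vertical lines in a closed strip carry the same integral of `F` when `F` is holomorphic inside
the strip, continuous up to its boundary, and decays at a Gaussian rate along it. -/
lemma integral_vertical_line_eq {F : ℂ → ℂ} {q b C : ℝ} (hq : 0 < q) (hb : 0 < b)
    (hc : ContinuousOn F {w | w.re ∈ Icc 0 q})
    (hd : DifferentiableOn ℂ F {w | w.re ∈ Ioo 0 q})
    (hbd : ∀ w : ℂ, w.re ∈ Icc 0 q → ‖F w‖ ≤ C * Real.exp (-b * w.im ^ 2)) :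
    ∫ u : ℝ, F (u * Complex.I) = ∫ u : ℝ, F (q + u * Complex.I) := by
  have hint : ∀ s ∈ Icc 0 q, Integrable fun u : ℝ => F (s + u * Complex.I) := by
    intro s hs
    have hcont : Continuous fun u : ℝ => F (s + u * Complex.I) := by
      refine continuousOn_univ.1 (hc.comp (by fun_prop) fun u _ => ?_)
      simpa using hs
    refine ((integrable_exp_neg_mul_sq hb).const_mul C).mono' hcont.aestronglyMeasurable ?_
    refine ae_of_all _ fun u => ?_
    simpa using hbd (s + u * Complex.I) (by simpa using hs)
  have hrect : ∀ R : ℝ, (∫ u in (-R)..R, F (u * Complex.I)) -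
      (∫ u in (-R)..R, F (q + u * Complex.I)) = -Complex.I * (
        (∫ s in (0 : ℝ)..q, F (s + (-R : ℝ) * Complex.I)) -
        ∫ s in (0 : ℝ)..q, F (s + R * Complex.I)) := by
    intro R
    have h := Complex.integral_boundary_rect_eq_zero_of_continuousOn_of_differentiableOn F
      ⟨0, -R⟩ ⟨q, R⟩ (hc.mono ?_) (hd.mono ?_)
    · simp only [Complex.ofReal_zero, zero_add, smul_eq_mul] at h
      generalize (∫ u in (-R)..R, F (u * Complex.I)) = A1 at h ⊢
      generalize (∫ u in (-R)..R, F (q + u * Complex.I)) = A2 at h ⊢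
      generalize (∫ s in (0 : ℝ)..q, F (s + (-R : ℝ) * Complex.I)) = A3 at h ⊢
      generalize (∫ s in (0 : ℝ)..q, F (s + R * Complex.I)) = A4 at h ⊢
      linear_combination Complex.I * h + (A1 - A2) * Complex.I_sq
    · intro w hw
      simpa [Complex.mem_reProdIm, uIcc_of_le hq.le] using hw.1
    · intro w hw
      simpa [Complex.mem_reProdIm, min_eq_left hq.le, max_eq_right hq.le] using hw.1
  have h0 := intervalIntegral_tendsto_integral (hint 0 ⟨le_rfl, hq.le⟩) tendsto_neg_atTop_atBot
    tendsto_id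
  have h1 := intervalIntegral_tendsto_integral (hint q ⟨hq.le, le_rfl⟩) tendsto_neg_atTop_atBot
    tendsto_id
  have hexp : Tendsto (fun R : ℝ => C * Real.exp (-b * R ^ 2) * |q - 0|) atTop (𝓝 0) := by
    have : Tendsto (fun R : ℝ => Real.exp (-b * R ^ 2)) atTop (𝓝 0) := by
      refine Real.tendsto_exp_atBot.comp ?_
      have := (tendsto_pow_atTop (α := ℝ) two_ne_zero).const_mul_atTop hb
      simpa only [neg_mul, Function.comp_def] using tendsto_neg_atTop_atBot.comp this
    simpa using (this.const_mul C).mul_const |q - 0|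
  have hside : ∀ S : ℝ → ℝ, (∀ R, (S R) ^ 2 = R ^ 2) →
      Tendsto (fun R : ℝ => ∫ s in (0 : ℝ)..q, F (s + (S R : ℝ) * Complex.I)) atTop (𝓝 0) := by
    intro S hS
    refine squeeze_zero_norm (fun R => ?_) hexp
    refine intervalIntegral.norm_integral_le_of_norm_le_const fun s hs => ?_
    rw [uIoc_of_le hq.le] at hs
    have := hbd (s + (S R : ℝ) * Complex.I) (by simpa using ⟨hs.1.le, hs.2⟩)
    simpa [hS R] using this
  have hz : Tendsto (fun R : ℝ => (∫ u in (-R)..R, F (u * Complex.I)) -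
      (∫ u in (-R)..R, F (q + u * Complex.I))) atTop (𝓝 0) := by
    have := ((hside (fun R => -R) (by simp)).sub (hside id (by simp))).const_mul (-Complex.I)
    simp only [sub_zero, mul_zero] at this
    exact this.congr fun R => (hrect R).symm
  simp only [Complex.ofReal_zero, zero_add] at h0
  exact sub_eq_zero.1 (tendsto_nhds_unique (h0.sub h1) hz)

/-- If the characteristic function of `X` extends to a bounded continuous function `Φ` on the
strip `0 ≤ Re w ≤ q`, holomorphic inside, then `E e^{q X} = Φ q`. Only one side of the imaginary
axis is covered, so that no moment of `X` is known beforehand; the Gaussian damping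
`e^{-X² / (4 b)}` makes all the integrals converge and is removed at the end. -/
lemma lintegral_exp_eq_of_charFun_extends {Ω : Type*} [MeasurableSpace Ω] {P : Measure Ω}
    [IsProbabilityMeasure P] {X : Ω → ℝ} (hX : Measurable X) {Φ : ℂ → ℂ} {q C : ℝ} (hq : 0 < q)
    (hc : ContinuousOn Φ {w | w.re ∈ Icc 0 q})
    (hd : DifferentiableOn ℂ Φ {w | w.re ∈ Ioo 0 q})
    (hbd : ∀ w : ℂ, w.re ∈ Icc 0 q → ‖Φ w‖ ≤ C)
    (hΦ : ∀ u : ℝ, ∫ ω, Complex.exp (u * Complex.I * (X ω : ℂ)) ∂P = Φ (u * Complex.I)) :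
    ∫⁻ ω, ENNReal.ofReal (Real.exp (q * X ω)) ∂P = ENNReal.ofReal (Φ q).re := by
  -- the damped moment, as an integral over the line `Re w = q`
  have key : ∀ b : ℝ, 0 < b → ((√Real.pi : ℝ) : ℂ) *
      ∫ ω, ((Real.exp (q * X ω - X ω ^ 2 / (4 * b)) : ℝ) : ℂ) ∂P =
      ∫ v : ℝ, Φ (q + (v / √b : ℝ) * Complex.I) * (Real.exp (-1 * v ^ 2) : ℝ) := by
    intro b hb
    have hC : 0 ≤ C := (norm_nonneg _).trans (hbd 0 (by simp [hq.le]))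
    have hshift := integral_vertical_line_eq
      (F := fun w => Φ w * Complex.exp (b * (w - q) ^ 2)) (C := C * Real.exp (b * q ^ 2)) hq hb
      (hc.mul (by fun_prop)) (hd.mul (by fun_prop)) (by
        intro w hw
        rw [norm_mul, Complex.norm_exp, mul_assoc, ← Real.exp_add]
        refine mul_le_mul (hbd w hw) (Real.exp_le_exp.2 ?_) (Real.exp_pos _).le hC
        have : ((b : ℂ) * (w - q) ^ 2).re = b * ((w.re - q) ^ 2 - w.im ^ 2) := by
          simp [pow_two]
        rw [this]
        have h1 := hw.1
        have h2 := hw.2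
        have : (w.re - q) ^ 2 ≤ q ^ 2 := by nlinarith
        nlinarith)
    have hker : ∀ x : ℝ, ∫ u : ℝ, Complex.exp (u * Complex.I * x) *
        Complex.exp (b * (u * Complex.I - q) ^ 2) =
        ((√(Real.pi / b) : ℝ) : ℂ) * (Real.exp (q * x - x ^ 2 / (4 * b)) : ℝ) := by
      intro x
      have hg := fourierIntegral_gaussian (b := (b : ℂ)) (by simpa using hb)
        ((x : ℂ) - 2 * b * q)
      have hb' : (b : ℂ) ≠ 0 := by exact_mod_cast hb.ne'
      have : ∀ u : ℝ, Complex.exp (u * Complex.I * x) *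
          Complex.exp (b * (u * Complex.I - q) ^ 2) = Complex.exp (b * q ^ 2) *
          (Complex.exp (Complex.I * ((x : ℂ) - 2 * b * q) * u) * Complex.exp (-b * u ^ 2)) := by
        intro u
        rw [← Complex.exp_add, ← Complex.exp_add, ← Complex.exp_add]
        congr 1
        linear_combination (b : ℂ) * u ^ 2 * Complex.I_sq
      simp_rw [this]
      rw [integral_const_mul, hg]
      have hpi : ((Real.pi : ℂ) / b) ^ (1 / 2 : ℂ) = ((√(Real.pi / b) : ℝ) : ℂ) := by
        rw [Real.sqrt_eq_rpow, Complex.ofReal_cpow (by positivity)]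
        push_cast
        ring_nf
      rw [hpi, mul_left_comm, ← Complex.exp_add]
      push_cast
      congr 2
      field_simp
      ring
    have hfub : ∫ u : ℝ, Φ (u * Complex.I) * Complex.exp (b * (u * Complex.I - q) ^ 2) =
        ∫ ω, (∫ u : ℝ, Complex.exp (u * Complex.I * (X ω : ℂ)) *
          Complex.exp (b * (u * Complex.I - q) ^ 2)) ∂P := by
      simp_rw [← hΦ, ← integral_mul_const]
      refine integral_integral_swap ?_
      have hg : Integrable (fun p : ℝ × Ω =>
          Real.exp (b * q ^ 2) * Real.exp (-b * p.1 ^ 2)) (volume.prod P) :=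
        (((integrable_exp_neg_mul_sq hb).const_mul _).comp_fst P)
      refine hg.mono' (Measurable.aestronglyMeasurable ?_) (ae_of_all _ fun p => ?_)
      · refine Measurable.mul ?_ ?_
        · exact Complex.measurable_exp.comp (((Complex.measurable_ofReal.comp
            measurable_fst).mul_const _).mul (Complex.measurable_ofReal.comp
              (hX.comp measurable_snd)))
        · exact (Continuous.measurable (by fun_prop : Continuous fun u : ℝ =>
            Complex.exp (b * (u * Complex.I - q) ^ 2))).comp measurable_fst
      · simp only [Function.uncurry, norm_mul, Complex.norm_exp]
        rw [← Real.exp_add, ← Real.exp_add]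
        refine Real.exp_le_exp.2 (le_of_eq ?_)
        simp [pow_two]
        ring
    rw [hfub] at hshift
    simp_rw [hker] at hshift
    rw [integral_const_mul] at hshift
    have hsub : ∫ u : ℝ, Φ (q + u * Complex.I) *
        Complex.exp (b * (q + u * Complex.I - q) ^ 2) = ((√b : ℝ) : ℂ)⁻¹ *
        ∫ v : ℝ, Φ (q + (v / √b : ℝ) * Complex.I) * (Real.exp (-1 * v ^ 2) : ℝ) := by
      have := Measure.integral_comp_mul_right
        (fun v : ℝ => Φ (q + (v / √b : ℝ) * Complex.I) * (Real.exp (-1 * v ^ 2) : ℝ)) (√b)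
      rw [abs_of_pos (by positivity), Complex.real_smul] at this
      rw [← Complex.ofReal_inv, ← this]
      congr 1
      ext u
      have hsb : √b ≠ 0 := by positivity
      rw [mul_div_cancel_right₀ _ hsb]
      congr 1
      push_cast
      congr 1
      rw [mul_pow, ← Complex.ofReal_pow (√b), Real.sq_sqrt hb.le]
      linear_combination (b : ℂ) * u ^ 2 * Complex.I_sq
    rw [hsub, Real.sqrt_div' _ hb.le] at hshift
    have hsb : ((√b : ℝ) : ℂ) ≠ 0 := by
      have : √b ≠ 0 := by positivity
      exact_mod_cast this
    rw [Complex.ofReal_div, div_eq_inv_mul, mul_assoc] at hshift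
    exact mul_left_cancel₀ (inv_ne_zero hsb) hshift
  -- removal of the damping
  have hlim : Tendsto (fun n : ℕ => ∫ v : ℝ, Φ (q + (v / √((n : ℝ) + 1) : ℝ) * Complex.I) *
      (Real.exp (-1 * v ^ 2) : ℝ)) atTop
      (𝓝 (∫ v : ℝ, Φ q * (Real.exp (-1 * v ^ 2) : ℝ))) := by
    have hline : Continuous fun u : ℝ => Φ (q + u * Complex.I) := by
      refine continuousOn_univ.1 (hc.comp (by fun_prop) fun u _ => ?_)
      simpa using hq.le
    refine tendsto_integral_of_dominated_convergence (fun v => C * Real.exp (-1 * v ^ 2)) ?_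
      ((integrable_exp_neg_mul_sq one_pos).const_mul C) ?_ ?_
    · intro n
      refine Continuous.aestronglyMeasurable (Continuous.mul ?_ (by fun_prop))
      exact hline.comp (by fun_prop : Continuous fun v : ℝ => v / √((n : ℝ) + 1))
    · intro n
      refine ae_of_all _ fun v => ?_
      rw [norm_mul, Complex.norm_real, Real.norm_eq_abs, abs_of_pos (Real.exp_pos _)]
      exact mul_le_mul_of_nonneg_right (hbd _ (by simp [hq.le])) (Real.exp_pos _).le
    · refine ae_of_all _ fun v => Tendsto.mul_const _ ?_
      have h0 : Tendsto (fun n : ℕ => v / √((n : ℝ) + 1)) atTop (𝓝 0) :=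
        tendsto_const_nhds.div_atTop (Real.tendsto_sqrt_atTop.comp
          (tendsto_atTop_add_const_right _ _ tendsto_natCast_atTop_atTop))
      have := (hline.tendsto 0).comp h0
      simpa only [Function.comp_def, Complex.ofReal_zero, zero_mul, add_zero] using this
  have hgauss : ∫ v : ℝ, Φ q * ((Real.exp (-1 * v ^ 2) : ℝ) : ℂ) =
      ((√Real.pi : ℝ) : ℂ) * Φ q := by
    rw [integral_const_mul, integral_complex_ofReal, integral_gaussian, div_one, mul_comm]
  rw [hgauss] at hlim
  have hpi : ((√Real.pi : ℝ) : ℂ) ≠ 0 := by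
    have : √Real.pi ≠ 0 := (Real.sqrt_pos.2 Real.pi_pos).ne'
    exact_mod_cast this
  have hlim2 : Tendsto (fun n : ℕ =>
      ∫ ω, Real.exp (q * X ω - X ω ^ 2 / (4 * ((n : ℝ) + 1))) ∂P) atTop (𝓝 (Φ q).re) := by
    have h1 : Tendsto (fun n : ℕ =>
        ∫ ω, ((Real.exp (q * X ω - X ω ^ 2 / (4 * ((n : ℝ) + 1))) : ℝ) : ℂ) ∂P) atTop
        (𝓝 (Φ q)) := by
      have h2 := hlim.const_mul (((√Real.pi : ℝ) : ℂ)⁻¹)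
      rw [inv_mul_cancel_left₀ hpi] at h2
      refine h2.congr fun n => ?_
      rw [← key _ (by positivity), inv_mul_cancel_left₀ hpi]
    have h2 := (Complex.continuous_re.tendsto _).comp h1
    refine h2.congr fun n => ?_
    simp only [Function.comp, integral_complex_ofReal, Complex.ofReal_re]
  have hmono := lintegral_tendsto_of_tendsto_of_monotone (μ := P)
    (f := fun (n : ℕ) ω => ENNReal.ofReal (Real.exp (q * X ω - X ω ^ 2 / (4 * ((n : ℝ) + 1)))))
    (F := fun ω => ENNReal.ofReal (Real.exp (q * X ω)))
    (fun n => by fun_prop)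
    (ae_of_all _ fun ω n m hnm => by
      refine ENNReal.ofReal_le_ofReal (Real.exp_le_exp.2 (sub_le_sub_left ?_ _))
      have : (n : ℝ) ≤ m := by exact_mod_cast hnm
      gcongr)
    (ae_of_all _ fun ω => by
      refine (ENNReal.continuous_ofReal.tendsto _).comp
        ((Real.continuous_exp.tendsto _).comp ?_)
      have : Tendsto (fun n : ℕ => X ω ^ 2 / (4 * ((n : ℝ) + 1))) atTop (𝓝 0) :=
        tendsto_const_nhds.div_atTop (Tendsto.const_mul_atTop (by norm_num)
          (tendsto_atTop_add_const_right _ _ tendsto_natCast_atTop_atTop))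
      simpa using this.const_sub (q * X ω))
  refine tendsto_nhds_unique hmono (((ENNReal.continuous_ofReal.tendsto _).comp hlim2).congr ?_)
  intro n
  refine ofReal_integral_eq_lintegral_ofReal ?_ (ae_of_all _ fun ω => (Real.exp_pos _).le)
  refine Integrable.of_bound (C := Real.exp (q ^ 2 * ((n : ℝ) + 1))) (by fun_prop) ?_
  refine ae_of_all _ fun ω => ?_
  rw [Real.norm_eq_abs, abs_of_pos (Real.exp_pos _)]
  refine Real.exp_le_exp.2 ?_
  have hn : (0 : ℝ) < (n : ℝ) + 1 := by positivity
  rw [sub_le_iff_le_add, ← sub_nonneg]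
  have : q ^ 2 * ((n : ℝ) + 1) + X ω ^ 2 / (4 * ((n : ℝ) + 1)) - q * X ω =
      (X ω - 2 * q * ((n : ℝ) + 1)) ^ 2 / (4 * ((n : ℝ) + 1)) := by
    field_simp
    ring
  rw [this]
  positivity

/-! ### The Lévy exponent on a strip -/

/-- The compensated kernel `e^{w x} - 1 - w x 1_{|x| ≤ 1}` of the Lévy–Khintchine formula. -/
noncomputable def levyKernel (w : ℂ) (x : ℝ) : ℂ :=
  Complex.exp (w * x) - 1 - if |x| ≤ 1 then w * x else 0

/-- A `ν`-integrable function which dominates the compensated kernels with `0 ≤ Re w ≤ ζ`. -/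
noncomputable def levyDominator (ζ : ℝ) (x : ℝ) : ℝ :=
  if |x| ≤ 1 then x ^ 2 else 3 + Real.exp (ζ * x)

/-- The Laplace exponent `Θ w = ψ (-i w)`, as a function of the complex moment `w`. -/
noncomputable def laplaceExponent (σ : ℝ) (ν : Measure ℝ) (w : ℂ) : ℂ :=
  drift σ ν * w + (σ : ℂ) ^ 2 * w ^ 2 / 2 + ∫ x : ℝ, levyKernel w x ∂ν

lemma normExponent_eq_laplaceExponent (σ : ℝ) (ν : Measure ℝ) (z : ℂ) :
    normExponent σ ν z = laplaceExponent σ ν (Complex.I * z) := by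
  simp only [normExponent, levyExponent, laplaceExponent, levyKernel]
  congr 1
  linear_combination (-(σ : ℂ) ^ 2 * z ^ 2 / 2) * Complex.I_sq

lemma measurableSet_abs_le_one : MeasurableSet {x : ℝ | |x| ≤ 1} :=
  (isClosed_le continuous_abs continuous_const).measurableSet

lemma measurable_levyKernel (w : ℂ) : Measurable (levyKernel w) := by
  refine Measurable.sub (by fun_prop) (Measurable.ite measurableSet_abs_le_one ?_ measurable_const)
  fun_prop

lemma measurable_levyDominator (ζ : ℝ) : Measurable (levyDominator ζ) :=
  Measurable.ite measurableSet_abs_le_one (by fun_prop) (by fun_prop)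

lemma levyDominator_nonneg (ζ x : ℝ) : 0 ≤ levyDominator ζ x := by
  unfold levyDominator
  split_ifs <;> positivity

lemma integrable_levyDominator {ν : Measure ℝ} (hν : IsLevyMeasure ν) {ζ : ℝ}
    (h0 : 0 ∈ expDomain ν) (hζ : ζ ∈ expDomain ν) : Integrable (levyDominator ζ) ν := by
  refine ⟨(measurable_levyDominator ζ).aestronglyMeasurable, ?_⟩
  rw [hasFiniteIntegral_iff_ofReal (ae_of_all _ (levyDominator_nonneg ζ))]
  have hS : MeasurableSet {x : ℝ | 1 ≤ |x|} :=
    (isClosed_le continuous_const continuous_abs).measurableSet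
  have hbd : ∀ x, ENNReal.ofReal (levyDominator ζ x) ≤ ENNReal.ofReal (min 1 (x ^ 2)) +
      {x : ℝ | 1 ≤ |x|}.indicator (fun x => 3 * ENNReal.ofReal (Real.exp (0 * x)) +
        ENNReal.ofReal (Real.exp (ζ * x))) x := by
    intro x
    unfold levyDominator
    split_ifs with h
    · have : x ^ 2 ≤ 1 := (sq_le_one_iff_abs_le_one x).2 h
      rw [min_eq_right this]
      exact le_self_add
    · have hx : x ∈ {x : ℝ | 1 ≤ |x|} := (not_le.1 h).le
      rw [indicator_of_mem hx]
      refine le_trans (le_of_eq ?_) le_add_self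
      rw [ENNReal.ofReal_add (by norm_num) (Real.exp_pos _).le]
      simp
  refine (lintegral_mono hbd).trans_lt ?_
  rw [lintegral_add_left (by fun_prop), lintegral_indicator hS, lintegral_add_left (by fun_prop),
    lintegral_const_mul _ (by fun_prop)]
  have h1 : ∫⁻ x in {x : ℝ | 1 ≤ |x|}, ENNReal.ofReal (Real.exp (0 * x)) ∂ν < ⊤ := h0
  have h2 : ∫⁻ x in {x : ℝ | 1 ≤ |x|}, ENNReal.ofReal (Real.exp (ζ * x)) ∂ν < ⊤ := hζ
  exact ENNReal.add_lt_top.2 ⟨hν.lintegral_lt_top, ENNReal.add_lt_top.2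
    ⟨ENNReal.mul_lt_top (by simp) h1, h2⟩⟩

lemma exp_mul_le_one_add {s ζ : ℝ} (hs : s ∈ Icc 0 ζ) (x : ℝ) :
    Real.exp (s * x) ≤ 1 + Real.exp (ζ * x) := by
  rcases le_total 0 x with hx | hx
  · have : Real.exp (s * x) ≤ Real.exp (ζ * x) :=
      Real.exp_le_exp.2 (mul_le_mul_of_nonneg_right hs.2 hx)
    linarith
  · have : Real.exp (s * x) ≤ 1 := Real.exp_le_one_iff.2 (mul_nonpos_of_nonneg_of_nonpos hs.1 hx)
    have := Real.exp_pos (ζ * x)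
    linarith

lemma norm_levyKernel_le {ζ : ℝ} {w : ℂ} (hw : w.re ∈ Icc 0 ζ) (x : ℝ) :
    ‖levyKernel w x‖ ≤ (1 + ‖w‖ ^ 2 * Real.exp ‖w‖) * levyDominator ζ x := by
  unfold levyKernel levyDominator
  split_ifs with h
  · have h2 := Complex.norm_exp_sub_sum_le_norm_mul_exp (w * x) 2
    simp only [Finset.sum_range_succ, Finset.sum_range_zero, zero_add, pow_zero, pow_one,
      Nat.factorial_zero, Nat.factorial_one, Nat.cast_one, div_one, norm_mul, Complex.norm_real,
      Real.norm_eq_abs] at h2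
    rw [sub_sub]
    refine h2.trans ?_
    have h3 : Real.exp (‖w‖ * |x|) ≤ Real.exp ‖w‖ :=
      Real.exp_le_exp.2 (mul_le_of_le_one_right (norm_nonneg _) h)
    rw [mul_pow, sq_abs]
    have : ‖w‖ ^ 2 * x ^ 2 * Real.exp (‖w‖ * |x|) ≤ ‖w‖ ^ 2 * x ^ 2 * Real.exp ‖w‖ :=
      mul_le_mul_of_nonneg_left h3 (by positivity)
    nlinarith [sq_nonneg x]
  · rw [sub_zero]
    have h1 : ‖Complex.exp (w * x) - 1‖ ≤ Real.exp (w.re * x) + 1 := by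
      refine (norm_sub_le _ _).trans ?_
      rw [Complex.norm_exp]
      simp
    have h2 := exp_mul_le_one_add hw x
    have h3 : 0 ≤ ‖w‖ ^ 2 * Real.exp ‖w‖ := by positivity
    have h4 := Real.exp_pos (ζ * x)
    nlinarith

lemma integrable_levyKernel {ν : Measure ℝ} (hν : IsLevyMeasure ν) {ζ : ℝ}
    (h0 : 0 ∈ expDomain ν) (hζ : ζ ∈ expDomain ν) {w : ℂ} (hw : w.re ∈ Icc 0 ζ) :
    Integrable (levyKernel w) ν :=
  ((integrable_levyDominator hν h0 hζ).const_mul _).mono'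
    (measurable_levyKernel w).aestronglyMeasurable (ae_of_all _ (norm_levyKernel_le hw))

lemma continuous_levyKernel (x : ℝ) : Continuous fun w => levyKernel w x := by
  unfold levyKernel
  split_ifs <;> fun_prop

lemma continuousOn_laplaceExponent {ν : Measure ℝ} (hν : IsLevyMeasure ν) (σ : ℝ) {ζ : ℝ}
    (h0 : 0 ∈ expDomain ν) (hζ : ζ ∈ expDomain ν) :
    ContinuousOn (laplaceExponent σ ν) {w | w.re ∈ Icc 0 ζ} := by
  unfold laplaceExponent
  refine ContinuousOn.add (by fun_prop) fun w₀ hw₀ => ?_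
  have hev : ∀ᶠ w in 𝓝[{w : ℂ | w.re ∈ Icc 0 ζ}] w₀, w.re ∈ Icc 0 ζ ∧ ‖w‖ ≤ ‖w₀‖ + 1 := by
    refine eventually_nhdsWithin_iff.2 ?_
    filter_upwards [continuous_norm.continuousAt.eventually (Iio_mem_nhds (lt_add_one ‖w₀‖))]
      with w h1 h2 using ⟨h2, (mem_Iio.1 h1).le⟩
  refine continuousWithinAt_of_dominated
    (bound := fun x => (1 + (‖w₀‖ + 1) ^ 2 * Real.exp (‖w₀‖ + 1)) * levyDominator ζ x)
    (Eventually.of_forall fun w => (measurable_levyKernel w).aestronglyMeasurable) ?_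
    ((integrable_levyDominator hν h0 hζ).const_mul _)
    (ae_of_all _ fun x => (continuous_levyKernel x).continuousWithinAt)
  filter_upwards [hev] with w hw
  refine ae_of_all _ fun x => (norm_levyKernel_le hw.1 x).trans ?_
  refine mul_le_mul_of_nonneg_right ?_ (levyDominator_nonneg ζ x)
  have := hw.2
  gcongr

/-- Derivative in `w` of the compensated kernel. -/
noncomputable def levyKernelDeriv (w : ℂ) (x : ℝ) : ℂ :=
  x * (Complex.exp (w * x) - if |x| ≤ 1 then 1 else 0)

lemma hasDerivAt_levyKernel (x : ℝ) (w : ℂ) :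
    HasDerivAt (fun w => levyKernel w x) (levyKernelDeriv w x) w := by
  unfold levyKernel levyKernelDeriv
  have h1 : HasDerivAt (fun w : ℂ => Complex.exp (w * x)) (Complex.exp (w * x) * (1 * x)) w :=
    ((hasDerivAt_id w).mul_const (x : ℂ)).cexp
  split_ifs with h
  · exact ((h1.sub_const 1).sub ((hasDerivAt_id w).mul_const (x : ℂ))).congr_deriv (by ring)
  · exact ((h1.sub_const 1).sub_const 0).congr_deriv (by ring)

/-- Away from the boundary of the strip the derivatives of the kernels are dominated: the factor
`x` costs an exponential of rate `η`, the distance to the boundary. -/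
lemma norm_levyKernelDeriv_le {ζ η : ℝ} (hη : 0 < η) {w : ℂ} (hw : w.re ∈ Icc η (ζ - η)) (x : ℝ) :
    ‖levyKernelDeriv w x‖ ≤ (1 / η + ‖w‖ * Real.exp ‖w‖) * levyDominator ζ x := by
  unfold levyKernelDeriv levyDominator
  rw [norm_mul, Complex.norm_real, Real.norm_eq_abs]
  split_ifs with h
  · have h2 := Complex.norm_exp_sub_sum_le_norm_mul_exp (w * x) 1
    simp only [Finset.sum_range_succ, Finset.sum_range_zero, zero_add, pow_zero, pow_one,
      Nat.factorial_zero, Nat.cast_one, div_one, norm_mul, Complex.norm_real,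
      Real.norm_eq_abs] at h2
    have h3 : Real.exp (‖w‖ * |x|) ≤ Real.exp ‖w‖ :=
      Real.exp_le_exp.2 (mul_le_of_le_one_right (norm_nonneg _) h)
    calc |x| * ‖Complex.exp (w * x) - 1‖ ≤ |x| * (‖w‖ * |x| * Real.exp ‖w‖) := by
          gcongr
          exact h2.trans (by gcongr)
      _ = ‖w‖ * Real.exp ‖w‖ * x ^ 2 := by rw [← sq_abs x]; ring
      _ ≤ _ := by
          refine mul_le_mul_of_nonneg_right ?_ (sq_nonneg x)
          have : 0 < 1 / η := by positivity
          linarith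
  · rw [sub_zero, Complex.norm_exp]
    have hre : (w * x).re = w.re * x := by simp
    rw [hre]
    have h1 : |x| * η ≤ Real.exp (η * |x|) := by
      have := Real.add_one_le_exp (η * |x|)
      linarith
    have h2 : Real.exp (η * |x|) * Real.exp (w.re * x) ≤ 1 + Real.exp (ζ * x) := by
      rw [← Real.exp_add]
      rcases le_total 0 x with hx | hx
      · rw [abs_of_nonneg hx, ← add_mul]
        exact exp_mul_le_one_add ⟨by linarith [hw.1], by linarith [hw.2]⟩ x
      · rw [abs_of_nonpos hx]
        have : Real.exp (η * -x + w.re * x) ≤ 1 :=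
          Real.exp_le_one_iff.2 (by nlinarith [hw.1])
        linarith [Real.exp_pos (ζ * x)]
    have h3 : |x| * Real.exp (w.re * x) ≤ 1 / η * (1 + Real.exp (ζ * x)) := by
      rw [one_div, ← div_eq_inv_mul, le_div_iff₀ hη]
      calc |x| * Real.exp (w.re * x) * η = |x| * η * Real.exp (w.re * x) := by ring
        _ ≤ Real.exp (η * |x|) * Real.exp (w.re * x) := by gcongr
        _ ≤ _ := h2
    have h4 : 0 < 1 / η := by positivity
    have h5 : 0 ≤ ‖w‖ * Real.exp ‖w‖ := by positivity
    have h6 := Real.exp_pos (ζ * x)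
    nlinarith [mul_nonneg h5 (by linarith : 0 ≤ 3 + Real.exp (ζ * x))]

lemma differentiableOn_laplaceExponent {ν : Measure ℝ} (hν : IsLevyMeasure ν) (σ : ℝ) {ζ : ℝ}
    (h0 : 0 ∈ expDomain ν) (hζ : ζ ∈ expDomain ν) :
    DifferentiableOn ℂ (laplaceExponent σ ν) {w | w.re ∈ Ioo 0 ζ} := by
  unfold laplaceExponent
  refine DifferentiableOn.add (by fun_prop) fun w₀ hw₀ => DifferentiableAt.differentiableWithinAt ?_
  obtain ⟨η, hη, hη1, hη2⟩ : ∃ η > 0, η < w₀.re ∧ w₀.re < ζ - η := by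
    refine ⟨min w₀.re (ζ - w₀.re) / 2, ?_, ?_, ?_⟩
    · have := lt_min hw₀.1 (sub_pos.2 hw₀.2)
      positivity
    · have := min_le_left w₀.re (ζ - w₀.re)
      linarith [hw₀.1]
    · have := min_le_right w₀.re (ζ - w₀.re)
      linarith [hw₀.2]
  have hs : {w : ℂ | w.re ∈ Icc η (ζ - η) ∧ ‖w‖ ≤ ‖w₀‖ + 1} ∈ 𝓝 w₀ := by
    filter_upwards [continuous_norm.continuousAt.eventually (Iio_mem_nhds (lt_add_one ‖w₀‖)),
      Complex.continuous_re.continuousAt.eventually (Ioo_mem_nhds hη1 hη2)]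
      with w h1 h2 using ⟨⟨h2.1.le, h2.2.le⟩, (mem_Iio.1 h1).le⟩
  refine (hasDerivAt_integral_of_dominated_loc_of_deriv_le
    (bound := fun x => (1 / η + (‖w₀‖ + 1) * Real.exp (‖w₀‖ + 1)) * levyDominator ζ x)
    (F' := levyKernelDeriv) hs
    (Eventually.of_forall fun w => (measurable_levyKernel w).aestronglyMeasurable)
    (integrable_levyKernel hν h0 hζ ⟨hw₀.1.le, hw₀.2.le⟩) ?_ ?_
    ((integrable_levyDominator hν h0 hζ).const_mul _)
    (ae_of_all _ fun x w _ => hasDerivAt_levyKernel x w)).2.differentiableAt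
  · refine Measurable.aestronglyMeasurable (Measurable.mul (by fun_prop) (Measurable.sub
      (by fun_prop) (Measurable.ite measurableSet_abs_le_one measurable_const measurable_const)))
  · refine ae_of_all _ fun x w hw => (norm_levyKernelDeriv_le hη hw.1 x).trans ?_
    refine mul_le_mul_of_nonneg_right ?_ (levyDominator_nonneg ζ x)
    have := hw.2
    gcongr

/-- The log-moment function `Ψ q = ψ (-i q)`, for which `E e^{q Λ(B)} = e^{Ψ q λ(B)}`. -/
noncomputable def logMoment (σ : ℝ) (ν : Measure ℝ) (q : ℝ) : ℝ :=
  drift σ ν * q + σ ^ 2 * q ^ 2 / 2 +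
    ∫ x : ℝ, (Real.exp (q * x) - 1 - if |x| ≤ 1 then q * x else 0) ∂ν

lemma levyKernel_ofReal (q x : ℝ) :
    levyKernel q x = ((Real.exp (q * x) - 1 - if |x| ≤ 1 then q * x else 0 : ℝ) : ℂ) := by
  unfold levyKernel
  split_ifs <;> push_cast <;> rfl

lemma laplaceExponent_ofReal (σ : ℝ) (ν : Measure ℝ) (q : ℝ) :
    laplaceExponent σ ν q = logMoment σ ν q := by
  unfold laplaceExponent logMoment
  simp_rw [levyKernel_ofReal]
  rw [integral_complex_ofReal]
  push_cast
  rfl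

lemma phi_eq_logMoment (σ : ℝ) (ν : Measure ℝ) (q : ℝ) :
    phi σ ν q = logMoment σ ν q - (q - 1) := by
  unfold phi
  rw [normExponent_eq_laplaceExponent]
  have : Complex.I * (-Complex.I * q) = q := by
    linear_combination (-(q : ℂ)) * Complex.I_sq
  rw [this, laplaceExponent_ofReal, Complex.ofReal_re]

lemma re_laplaceExponent_le {ν : Measure ℝ} (hν : IsLevyMeasure ν) (σ : ℝ) {ζ : ℝ}
    (h0 : 0 ∈ expDomain ν) (hζ : ζ ∈ expDomain ν) {w : ℂ} (hw : w.re ∈ Icc 0 ζ) :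
    (laplaceExponent σ ν w).re ≤ logMoment σ ν w.re := by
  have hre : (laplaceExponent σ ν w.re).re = logMoment σ ν w.re := by
    rw [laplaceExponent_ofReal, Complex.ofReal_re]
  rw [← hre]
  unfold laplaceExponent
  simp only [Complex.add_re]
  have hi := integrable_levyKernel hν h0 hζ hw
  have hi' := integrable_levyKernel hν h0 hζ (w := (w.re : ℂ)) (by simpa using hw)
  refine add_le_add (add_le_add (by simp) ?_) ?_
  · simp [pow_two]
    have : 0 ≤ σ * σ * (w.im * w.im) := mul_nonneg (mul_self_nonneg σ) (mul_self_nonneg w.im)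
    linarith
  · have e1 : (∫ x, levyKernel w x ∂ν).re = ∫ x, (levyKernel w x).re ∂ν :=
      (integral_re (𝕜 := ℂ) hi).symm
    have e2 : (∫ x, levyKernel (w.re : ℂ) x ∂ν).re = ∫ x, (levyKernel (w.re : ℂ) x).re ∂ν :=
      (integral_re (𝕜 := ℂ) hi').symm
    rw [e1, e2]
    refine integral_mono hi.re hi'.re fun x => ?_
    have h1 : (Complex.exp (w * x)).re ≤ Real.exp (w.re * x) := by
      refine (Complex.re_le_norm _).trans (le_of_eq ?_)
      rw [Complex.norm_exp]
      simp
    have h2 : (Complex.exp ((w.re : ℂ) * x)).re = Real.exp (w.re * x) := by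
      rw [← Complex.ofReal_mul, Complex.exp_ofReal_re]
    simp only [levyKernel, Complex.sub_re]
    split_ifs
    · rw [h2]
      simp only [Complex.re_mul_ofReal, Complex.ofReal_re]
      linarith
    · rw [h2]
      linarith

/-- **Exponential moments.** A variable with characteristic function `e^{a ψ}` satisfies
`E e^{q X} = e^{a Ψ q}` for every `q` between `0` and a point `ζ` of `I_ν`. -/
lemma lintegral_exp_eq_of_charFun {Ω : Type*} [MeasurableSpace Ω] {P : Measure Ω}
    [IsProbabilityMeasure P] {ν : Measure ℝ} (hν : IsLevyMeasure ν) {σ ζ : ℝ}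
    (h0 : 0 ∈ expDomain ν) (hζ : ζ ∈ expDomain ν) {X : Ω → ℝ} (hX : Measurable X) {a : ℝ}
    (ha : 0 ≤ a)
    (hchar : ∀ q : ℝ, ∫ ω, Complex.exp (Complex.I * q * (X ω : ℂ)) ∂P =
      Complex.exp (normExponent σ ν q * (a : ℂ))) {q : ℝ} (hq : q ∈ Icc 0 ζ) :
    ∫⁻ ω, ENNReal.ofReal (Real.exp (q * X ω)) ∂P =
      ENNReal.ofReal (Real.exp (logMoment σ ν q * a)) := by
  rcases hq.1.eq_or_lt with rfl | hq0
  · simp [logMoment]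
  have hsub : {w : ℂ | w.re ∈ Icc 0 q} ⊆ {w | w.re ∈ Icc 0 ζ} :=
    fun w hw => ⟨hw.1, hw.2.trans hq.2⟩
  have hsub' : {w : ℂ | w.re ∈ Ioo 0 q} ⊆ {w | w.re ∈ Ioo 0 ζ} :=
    fun w hw => ⟨hw.1, hw.2.trans_le hq.2⟩
  have hcont := (continuousOn_laplaceExponent hν σ h0 hζ).mono hsub
  have hreal : ContinuousOn (fun s : ℝ => logMoment σ ν s) (Icc 0 q) := by
    have h1 : ContinuousOn (fun s : ℝ => (laplaceExponent σ ν (s : ℂ)).re) (Icc 0 q) :=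
      Complex.continuous_re.comp_continuousOn (hcont.comp (by fun_prop) fun s hs => by simpa using hs)
    refine h1.congr fun s _ => ?_
    simp only [laplaceExponent_ofReal, Complex.ofReal_re]
  obtain ⟨C, hC⟩ := isCompact_Icc.bddAbove_image hreal
  have h := lintegral_exp_eq_of_charFun_extends (P := P) hX
    (Φ := fun w => Complex.exp (laplaceExponent σ ν w * a)) (q := q) (C := Real.exp (C * a)) hq0
    (by fun_prop) (((differentiableOn_laplaceExponent hν σ h0 hζ).mono hsub').mul_const _).cexp
    (fun w hw => by
      rw [Complex.norm_exp, Complex.re_mul_ofReal]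
      refine Real.exp_le_exp.2 (mul_le_mul_of_nonneg_right ?_ ha)
      exact (re_laplaceExponent_le hν σ h0 hζ (hsub hw)).trans (hC ⟨w.re, hw, rfl⟩))
    (fun u => by
      have := hchar u
      rw [normExponent_eq_laplaceExponent, mul_comm Complex.I] at this
      exact this)
  rw [h, laplaceExponent_ofReal, ← Complex.ofReal_mul, Complex.exp_ofReal_re]

/-! ### Strict convexity of the log-moment function -/

lemma integrable_real_levyKernel {ν : Measure ℝ} (hν : IsLevyMeasure ν) {ζ : ℝ}
    (h0 : 0 ∈ expDomain ν) (hζ : ζ ∈ expDomain ν) {q : ℝ} (hq : q ∈ Icc 0 ζ) :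
    Integrable (fun x => Real.exp (q * x) - 1 - if |x| ≤ 1 then q * x else 0) ν := by
  have := (integrable_levyKernel hν h0 hζ (w := (q : ℂ)) (by simpa using hq)).re
  refine this.congr (ae_of_all _ fun x => ?_)
  simp only [levyKernel_ofReal, RCLike.re_to_complex, Complex.ofReal_re]

lemma logMoment_one (σ : ℝ) (ν : Measure ℝ) : logMoment σ ν 1 = 0 := by
  unfold logMoment drift
  simp only [one_mul]
  ring

/-- `φ` vanishes at `1` and at `ζ` and is strictly convex, hence negative in between. -/
lemma phi_neg_of_mem_Ioo {ν : Measure ℝ} (hν : IsLevyMeasure ν) {σ ζ : ℝ}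
    (hne : σ ≠ 0 ∨ ν ≠ 0) (h0 : 0 ∈ expDomain ν) (hζ : ζ ∈ expDomain ν)
    (hφ : phi σ ν ζ = 0) {q : ℝ} (hq : q ∈ Ioo 1 ζ) : phi σ ν q < 0 := by
  have hζ1 : 1 < ζ := hq.1.trans hq.2
  set b : ℝ := (q - 1) / (ζ - 1) with hb
  set a : ℝ := 1 - b with ha
  have hb0 : 0 < b := div_pos (sub_pos.2 hq.1) (sub_pos.2 hζ1)
  have hb1 : b < 1 := (div_lt_one (sub_pos.2 hζ1)).2 (by linarith [hq.2])
  have ha0 : 0 < a := sub_pos.2 hb1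
  have hab : a + b = 1 := by ring
  have hqab : q = a * 1 + b * ζ := by
    have : b * (ζ - 1) = q - 1 := div_mul_cancel₀ _ (sub_pos.2 hζ1).ne'
    rw [ha]
    linarith
  let k : ℝ → ℝ → ℝ := fun q x => Real.exp (q * x) - 1 - if |x| ≤ 1 then q * x else 0
  have hi1 : Integrable (k 1) ν := integrable_real_levyKernel hν h0 hζ ⟨zero_le_one, hζ1.le⟩
  have hiζ : Integrable (k ζ) ν :=
    integrable_real_levyKernel hν h0 hζ ⟨by linarith, le_rfl⟩
  have hiq : Integrable (k q) ν :=
    integrable_real_levyKernel hν h0 hζ ⟨by linarith [hq.1], hq.2.le⟩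
  have hgap : ∀ x, a * k 1 x + b * k ζ x - k q x =
      a * Real.exp (1 * x) + b * Real.exp (ζ * x) - Real.exp (q * x) := by
    intro x
    simp only [k]
    split_ifs
    · rw [hqab, ha]
      ring
    · rw [ha]
      ring
  have hpos : ∀ x, x ≠ 0 → 0 < a * k 1 x + b * k ζ x - k q x := by
    intro x hx
    rw [hgap, sub_pos, hqab]
    have h := strictConvexOn_exp.2 (mem_univ (1 * x)) (mem_univ (ζ * x))
      (fun h => hζ1.ne (mul_right_cancel₀ hx h)) ha0 hb0 hab
    simp only [smul_eq_mul] at h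
    rwa [show (a * 1 + b * ζ) * x = a * (1 * x) + b * (ζ * x) by ring]
  have hnonneg : ∀ x, 0 ≤ a * k 1 x + b * k ζ x - k q x := by
    intro x
    rcases eq_or_ne x 0 with rfl | hx
    · rw [hgap]
      simp [hab]
    · exact (hpos x hx).le
  have hint : Integrable (fun x => a * k 1 x + b * k ζ x - k q x) ν :=
    ((hi1.const_mul a).add (hiζ.const_mul b)).sub hiq
  have hI : ∫ x, (a * k 1 x + b * k ζ x - k q x) ∂ν =
      a * ∫ x, k 1 x ∂ν + b * ∫ x, k ζ x ∂ν - ∫ x, k q x ∂ν := by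
    have e1 := integral_sub (f := fun x => a * k 1 x + b * k ζ x)
      ((hi1.const_mul a).add (hiζ.const_mul b)) hiq
    have e2 := integral_add (hi1.const_mul a) (hiζ.const_mul b)
    rw [e1, e2, integral_const_mul, integral_const_mul]
  have hφ1 : phi σ ν 1 = 0 := by rw [phi_eq_logMoment, logMoment_one]; ring
  have hdiff : a * phi σ ν 1 + b * phi σ ν ζ - phi σ ν q =
      σ ^ 2 / 2 * (a + b * ζ ^ 2 - q ^ 2) + ∫ x, (a * k 1 x + b * k ζ x - k q x) ∂ν := by
    rw [hI]
    simp only [phi_eq_logMoment, logMoment]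
    rw [show (∫ x, k 1 x ∂ν) = ∫ x : ℝ, (Real.exp (1 * x) - 1 - if |x| ≤ 1 then 1 * x else 0) ∂ν
      from rfl, show (∫ x, k ζ x ∂ν) =
      ∫ x : ℝ, (Real.exp (ζ * x) - 1 - if |x| ≤ 1 then ζ * x else 0) ∂ν from rfl,
      show (∫ x, k q x ∂ν) =
      ∫ x : ℝ, (Real.exp (q * x) - 1 - if |x| ≤ 1 then q * x else 0) ∂ν from rfl]
    have e : drift σ ν * (a * 1 + b * ζ - q) = 0 := by rw [← hqab, sub_self, mul_zero]
    have e' : a * (1 - 1) + b * (ζ - 1) - (q - 1) = 0 := by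
      have : b * (ζ - 1) = q - 1 := div_mul_cancel₀ _ (sub_pos.2 hζ1).ne'
      linarith
    linear_combination e - e'
  have hsq : 0 < a + b * ζ ^ 2 - q ^ 2 := by
    have : a + b * ζ ^ 2 - q ^ 2 = a * b * (ζ - 1) ^ 2 := by
      rw [hqab, ha]
      ring
    rw [this]
    have := sub_pos.2 hζ1
    positivity
  have hmain : 0 < σ ^ 2 / 2 * (a + b * ζ ^ 2 - q ^ 2) +
      ∫ x, (a * k 1 x + b * k ζ x - k q x) ∂ν := by
    rcases hne with hσ | hν0
    · have h1 : 0 ≤ ∫ x, (a * k 1 x + b * k ζ x - k q x) ∂ν := integral_nonneg hnonneg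
      have h2 : 0 < σ ^ 2 / 2 * (a + b * ζ ^ 2 - q ^ 2) := by positivity
      linarith
    · have h1 : 0 < ∫ x, (a * k 1 x + b * k ζ x - k q x) ∂ν := by
        rw [integral_pos_iff_support_of_nonneg hnonneg hint]
        have hsupp : {0}ᶜ ⊆ Function.support fun x => a * k 1 x + b * k ζ x - k q x :=
          fun x hx => (hpos x hx).ne'
        refine lt_of_lt_of_le (pos_iff_ne_zero.2 fun h => hν0 ?_) (measure_mono hsupp)
        rw [← Measure.measure_univ_eq_zero, ← union_compl_self {(0 : ℝ)}]
        exact measure_union_null hν.zero_mass h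
      have h2 : 0 ≤ σ ^ 2 / 2 * (a + b * ζ ^ 2 - q ^ 2) := by positivity
      linarith
  rw [← hdiff, hφ1, hφ] at hmain
  linarith

/-! ### Independently scattered measures: additivity, independence over regions, invariance -/

lemma empty_mem_finiteAreaSets : (∅ : Set (ℝ × ℝ)) ∈ finiteAreaSets :=
  ⟨MeasurableSet.empty, empty_subset _, by simp⟩

lemma mem_finiteAreaSets_of_subset {A B : Set (ℝ × ℝ)} (hB : B ∈ finiteAreaSets)
    (hA : MeasurableSet A) (hAB : A ⊆ B) : A ∈ finiteAreaSets :=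
  ⟨hA, hAB.trans hB.2.1, (measure_mono hAB).trans_lt hB.2.2⟩

lemma union_mem_finiteAreaSets {A B : Set (ℝ × ℝ)} (hA : A ∈ finiteAreaSets)
    (hB : B ∈ finiteAreaSets) : A ∪ B ∈ finiteAreaSets :=
  ⟨hA.1.union hB.1, union_subset hA.2.1 hB.2.1, measure_union_lt_top hA.2.2 hB.2.2⟩

lemma biUnion_mem_finiteAreaSets {ι : Type*} (s : Finset ι) {B : ι → Set (ℝ × ℝ)}
    (hB : ∀ i ∈ s, B i ∈ finiteAreaSets) : (⋃ i ∈ s, B i) ∈ finiteAreaSets := by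
  classical
  induction s using Finset.induction_on with
  | empty => simpa using empty_mem_finiteAreaSets
  | insert a s ha ih =>
    rw [Finset.set_biUnion_insert]
    exact union_mem_finiteAreaSets (hB a (by simp)) (ih fun i hi => hB i (by simp [hi]))

section Scattered

variable {Ω : Type*} [MeasurableSpace Ω] {P : Measure Ω} [IsProbabilityMeasure P] {ψ : ℂ → ℂ}
  {Λ : Set (ℝ × ℝ) → Ω → ℝ}

lemma IsScatteredMeasure.charFun_map (hΛ : IsScatteredMeasure P ψ Λ) {B : Set (ℝ × ℝ)}
    (hB : B ∈ finiteAreaSets) (t : ℝ) :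
    charFun (P.map (Λ B)) t = Complex.exp (ψ t * ((hypArea B).toReal : ℂ)) := by
  rw [charFun_apply_real, integral_map (hΛ.measurable B hB).aemeasurable (by fun_prop),
    ← hΛ.charFun_eq B hB t]
  congr 1
  ext ω
  congr 1
  ring

/-- The law of `Λ(B)` depends on the area of `B` only. -/
lemma IsScatteredMeasure.map_eq_of_hypArea_eq (hΛ : IsScatteredMeasure P ψ Λ)
    {B C : Set (ℝ × ℝ)} (hB : B ∈ finiteAreaSets) (hC : C ∈ finiteAreaSets)
    (h : hypArea B = hypArea C) : P.map (Λ B) = P.map (Λ C) := by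
  have := Measure.isProbabilityMeasure_map (μ := P) (hΛ.measurable B hB).aemeasurable
  have := Measure.isProbabilityMeasure_map (μ := P) (hΛ.measurable C hC).aemeasurable
  refine Measure.ext_of_charFun (funext fun t => ?_)
  rw [hΛ.charFun_map hB, hΛ.charFun_map hC, h]

lemma IsScatteredMeasure.empty_ae (hΛ : IsScatteredMeasure P ψ Λ) : ∀ᵐ ω ∂P, Λ ∅ ω = 0 := by
  have hm := hΛ.measurable ∅ empty_mem_finiteAreaSets
  have := Measure.isProbabilityMeasure_map (μ := P) hm.aemeasurable
  have h : P.map (Λ ∅) = Measure.dirac 0 := by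
    refine Measure.ext_of_charFun (funext fun t => ?_)
    rw [hΛ.charFun_map empty_mem_finiteAreaSets, charFun_dirac]
    simp
  have h2 : ∀ᵐ x ∂(P.map (Λ ∅)), x = 0 := by
    rw [h]
    exact (ae_dirac_iff (measurableSet_singleton (0 : ℝ))).2 rfl
  exact ae_of_ae_map hm.aemeasurable h2

lemma IsScatteredMeasure.union_ae (hΛ : IsScatteredMeasure P ψ Λ) {A B : Set (ℝ × ℝ)}
    (hA : A ∈ finiteAreaSets) (hB : B ∈ finiteAreaSets) (hAB : Disjoint A B) :
    ∀ᵐ ω ∂P, Λ (A ∪ B) ω = Λ A ω + Λ B ω := by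
  let C : ℕ → Set (ℝ × ℝ) := fun n => if n = 0 then A else if n = 1 then B else ∅
  have hC : ∀ i, C i ∈ finiteAreaSets := by
    intro i
    simp only [C]
    split_ifs
    exacts [hA, hB, empty_mem_finiteAreaSets]
  have hU : ⋃ i, C i = A ∪ B := by
    ext z
    simp only [mem_iUnion, mem_union]
    constructor
    · rintro ⟨i, hi⟩
      simp only [C] at hi
      split_ifs at hi
      · exact Or.inl hi
      · exact Or.inr hi
      · exact hi.elim
    · rintro (h | h)
      · exact ⟨0, by simpa [C] using h⟩
      · exact ⟨1, by simpa [C] using h⟩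
  have hd : Pairwise fun i j => Disjoint (C i) (C j) := by
    intro i j hij
    simp only [C]
    split_ifs with h1 h2 h3 h4 h5 h6 h7
    · exact absurd (h1.trans h2.symm) hij
    · exact hAB
    · simp
    · exact hAB.symm
    · exact absurd (h4.trans h6.symm) hij
    all_goals simp
  have h := hΛ.sigma_additive C hC hd (by rw [hU]; exact union_mem_finiteAreaSets hA hB)
  filter_upwards [h, hΛ.empty_ae] with ω h1 h2
  rw [hU] at h1
  refine (tendsto_nhds_unique h1 (tendsto_atTop_of_eventually_const (i₀ := 2) fun n hn => ?_))
  obtain ⟨m, rfl⟩ := Nat.exists_eq_add_of_le' hn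
  rw [Finset.sum_range_succ', Finset.sum_range_succ', Finset.sum_eq_zero]
  · simp [C, add_comm]
  · intro i _
    simp [C, h2]

lemma IsScatteredMeasure.biUnion_ae (hΛ : IsScatteredMeasure P ψ Λ) {ι : Type*} (s : Finset ι)
    {B : ι → Set (ℝ × ℝ)} (hB : ∀ i, B i ∈ finiteAreaSets)
    (hd : Pairwise fun i j => Disjoint (B i) (B j)) :
    ∀ᵐ ω ∂P, Λ (⋃ i ∈ s, B i) ω = ∑ i ∈ s, Λ (B i) ω := by
  classical
  induction s using Finset.induction_on with
  | empty => simpa using hΛ.empty_ae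
  | insert a s ha ih =>
    have hdis : Disjoint (B a) (⋃ i ∈ s, B i) := by
      rw [disjoint_iUnion₂_right]
      exact fun i hi => hd fun h => ha (h ▸ hi)
    filter_upwards [ih, hΛ.union_ae (hB a) (biUnion_mem_finiteAreaSets s fun i _ => hB i) hdis]
      with ω h1 h2
    rw [Finset.set_biUnion_insert, h2, h1, Finset.sum_insert ha]

/-- Independence over a disjoint family with any countable index type. -/
lemma IsScatteredMeasure.iIndepFun_of_disjoint (hΛ : IsScatteredMeasure P ψ Λ) {ι : Type*}
    [Countable ι] {B : ι → Set (ℝ × ℝ)} (hB : ∀ i, B i ∈ finiteAreaSets)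
    (hd : Pairwise fun i j => Disjoint (B i) (B j)) : iIndepFun (fun i => Λ (B i)) P := by
  have := Encodable.ofCountable ι
  let C : ℕ → Set (ℝ × ℝ) := fun n => ⋃ b ∈ Encodable.decode₂ ι n, B b
  have hCe : ∀ i, C (Encodable.encode i) = B i := by
    intro i
    simp [C]
  have hC : ∀ n, C n ∈ finiteAreaSets := fun n =>
    Encodable.iUnion_decode₂_cases (C := fun s => s ∈ finiteAreaSets)
      empty_mem_finiteAreaSets hB
  have h := (hΛ.indep C hC (Encodable.iUnion_decode₂_disjoint_on hd)).precomp
    (Encodable.encode_injective (α := ι))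
  simpa only [hCe] using h

/-- The points lying in `B i` exactly for `i ∈ S`; the cell of `S = ∅`, which may have infinite
area, is replaced by the empty set. -/
def cell {ι : Type*} (B : ι → Set (ℝ × ℝ)) (S : Finset ι) : Set (ℝ × ℝ) :=
  {z | S.Nonempty ∧ ∀ i, z ∈ B i ↔ i ∈ S}

lemma cell_subset {ι : Type*} {B : ι → Set (ℝ × ℝ)} {S : Finset ι} {i : ι} (hi : i ∈ S) :
    cell B S ⊆ B i := fun _ hz => (hz.2 i).2 hi

lemma cell_subset_iUnion {ι : Type*} (B : ι → Set (ℝ × ℝ)) (S : Finset ι) :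
    cell B S ⊆ ⋃ i, B i := fun _ hz =>
  let ⟨i, hi⟩ := hz.1
  mem_iUnion.2 ⟨i, (hz.2 i).2 hi⟩

lemma disjoint_cell {ι : Type*} (B : ι → Set (ℝ × ℝ)) :
    Pairwise fun S T => Disjoint (cell B S) (cell B T) := by
  intro S T hST
  rw [disjoint_left]
  exact fun z hS hT => hST (Finset.ext fun i => (hS.2 i).symm.trans (hT.2 i))

lemma measurableSet_cell {ι : Type*} [Finite ι] {B : ι → Set (ℝ × ℝ)}
    (hB : ∀ i, MeasurableSet (B i)) (S : Finset ι) : MeasurableSet (cell B S) := by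
  have : cell B S = {z | S.Nonempty} ∩ ⋂ i, {z | z ∈ B i ↔ i ∈ S} := by
    ext z
    simp [cell]
  rw [this]
  refine (MeasurableSet.const _).inter (MeasurableSet.iInter fun i => ?_)
  by_cases h : i ∈ S
  · simpa [h] using hB i
  · simp only [h, iff_false]
    exact (hB i).compl

lemma cell_mem_finiteAreaSets {ι : Type*} [Finite ι] {B : ι → Set (ℝ × ℝ)}
    (hB : ∀ i, B i ∈ finiteAreaSets) (S : Finset ι) : cell B S ∈ finiteAreaSets := by
  rcases S.eq_empty_or_nonempty with rfl | ⟨i, hi⟩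
  · have : cell B ∅ = ∅ := by
      ext z
      simp [cell]
    rw [this]
    exact empty_mem_finiteAreaSets
  · exact mem_finiteAreaSets_of_subset (hB i) (measurableSet_cell (fun i => (hB i).1) S)
      (cell_subset hi)

lemma biUnion_cell {ι : Type*} [Fintype ι] [DecidableEq ι] (B : ι → Set (ℝ × ℝ)) (i : ι) :
    ⋃ S ∈ Finset.univ.filter (fun S : Finset ι => i ∈ S), cell B S = B i := by
  classical
  refine subset_antisymm (iUnion₂_subset fun S hS => cell_subset (by simpa using hS)) fun z hz => ?_
  refine mem_iUnion₂.2 ⟨Finset.univ.filter fun j => z ∈ B j, by simpa using hz, ⟨i, ?_⟩, ?_⟩ <;>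
    simp [hz]

lemma IsScatteredMeasure.sum_cell_ae (hΛ : IsScatteredMeasure P ψ Λ) {ι : Type*} [Fintype ι]
    [DecidableEq ι] {B : ι → Set (ℝ × ℝ)} (hB : ∀ i, B i ∈ finiteAreaSets) :
    (fun ω i => Λ (B i) ω) =ᵐ[P]
      fun ω i => ∑ S ∈ Finset.univ.filter (fun S : Finset ι => i ∈ S), Λ (cell B S) ω := by
  have h : ∀ᵐ ω ∂P, ∀ i, Λ (B i) ω =
      ∑ S ∈ Finset.univ.filter (fun S : Finset ι => i ∈ S), Λ (cell B S) ω := by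
    refine ae_all_iff.2 fun i => ?_
    have := hΛ.biUnion_ae (Finset.univ.filter fun S : Finset ι => i ∈ S)
      (cell_mem_finiteAreaSets hB) (disjoint_cell B)
    rwa [biUnion_cell] at this
  filter_upwards [h] with ω hω using funext hω

/-- The joint law of `Λ` on finitely many sets depends only on the areas of their cells. -/
lemma IsScatteredMeasure.map_pi_eq_of_hypArea_cell_eq (hΛ : IsScatteredMeasure P ψ Λ)
    {ι : Type*} [Fintype ι] {B C : ι → Set (ℝ × ℝ)} (hB : ∀ i, B i ∈ finiteAreaSets)
    (hC : ∀ i, C i ∈ finiteAreaSets) (h : ∀ S, hypArea (cell B S) = hypArea (cell C S)) :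
    P.map (fun ω i => Λ (B i) ω) = P.map fun ω i => Λ (C i) ω := by
  classical
  have hlaw : ∀ {D : ι → Set (ℝ × ℝ)}, (∀ i, D i ∈ finiteAreaSets) →
      P.map (fun ω i => Λ (D i) ω) = (Measure.pi fun S => P.map (Λ (cell D S))).map
        (fun v i => ∑ S ∈ Finset.univ.filter (fun S : Finset ι => i ∈ S), v S) := by
    intro D hD
    have hm : ∀ S, Measurable (Λ (cell D S)) := fun S =>
      hΛ.measurable _ (cell_mem_finiteAreaSets hD S)
    rw [← (iIndepFun_iff_map_fun_eq_pi_map fun S => (hm S).aemeasurable).1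
      (hΛ.iIndepFun_of_disjoint (cell_mem_finiteAreaSets hD) (disjoint_cell D)),
      Measure.map_map (by fun_prop) (by fun_prop)]
    exact Measure.map_congr (hΛ.sum_cell_ae hD)
  rw [hlaw hB, hlaw hC]
  congr 2
  ext1 S
  exact hΛ.map_eq_of_hypArea_eq (cell_mem_finiteAreaSets hB S) (cell_mem_finiteAreaSets hC S) (h S)

/-- The events determined by `Λ` inside the region `R`. -/
abbrev regionSigma (Λ : Set (ℝ × ℝ) → Ω → ℝ) (R : Set (ℝ × ℝ)) : MeasurableSpace Ω :=
  MeasurableSpace.comap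
    (fun ω (B : {B : Set (ℝ × ℝ) // B ∈ finiteAreaSets ∧ B ⊆ R}) => Λ B ω) MeasurableSpace.pi

lemma IsScatteredMeasure.regionSigma_le (hΛ : IsScatteredMeasure P ψ Λ) (R : Set (ℝ × ℝ)) :
    regionSigma Λ R ≤ ‹MeasurableSpace Ω› :=
  (measurable_pi_lambda _ fun B : {B : Set (ℝ × ℝ) // B ∈ finiteAreaSets ∧ B ⊆ R} =>
    hΛ.measurable B B.2.1).comap_le

lemma measurable_regionSigma {R B : Set (ℝ × ℝ)} (hB : B ∈ finiteAreaSets) (hBR : B ⊆ R) :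
    Measurable[regionSigma Λ R] (Λ B) :=
  (measurable_pi_apply (⟨B, hB, hBR⟩ : {B : Set (ℝ × ℝ) // B ∈ finiteAreaSets ∧ B ⊆ R})).comp
    (comap_measurable (fun ω (B : {B : Set (ℝ × ℝ) // B ∈ finiteAreaSets ∧ B ⊆ R}) => Λ B ω))

lemma regionSigma_mono {R S : Set (ℝ × ℝ)} (h : R ⊆ S) : regionSigma Λ R ≤ regionSigma Λ S := by
  refine Measurable.comap_le (m₁ := regionSigma Λ S) ?_
  refine @measurable_pi_lambda _ _ _ (regionSigma Λ S) _ _ fun B => ?_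
  exact measurable_regionSigma B.2.1 (B.2.2.trans h)

/-- `Λ` is independent over disjoint regions: the cells of finitely many sets in either region
form together one disjoint family. -/
lemma IsScatteredMeasure.indep_regionSigma (hΛ : IsScatteredMeasure P ψ Λ) {R S : Set (ℝ × ℝ)}
    (hRS : Disjoint R S) : Indep (regionSigma Λ R) (regionSigma Λ S) P := by
  classical
  refine IndepFun.process_indepFun_process
    (X := fun (B : {B : Set (ℝ × ℝ) // B ∈ finiteAreaSets ∧ B ⊆ R}) => Λ B)
    (Y := fun (B : {B : Set (ℝ × ℝ) // B ∈ finiteAreaSets ∧ B ⊆ S}) => Λ B)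
    (fun B => hΛ.measurable B B.2.1) (fun B => hΛ.measurable B B.2.1) fun I J => ?_
  let B : I → Set (ℝ × ℝ) := fun i => i.1
  let C : J → Set (ℝ × ℝ) := fun j => j.1
  have hB : ∀ i, B i ∈ finiteAreaSets := fun i => i.1.2.1
  have hC : ∀ j, C j ∈ finiteAreaSets := fun j => j.1.2.1
  let F : Finset I ⊕ Finset J → Set (ℝ × ℝ) := Sum.elim (cell B) (cell C)
  have hF : ∀ s, F s ∈ finiteAreaSets := by
    rintro (s | s)
    exacts [cell_mem_finiteAreaSets hB s, cell_mem_finiteAreaSets hC s]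
  have hcross : ∀ s t, Disjoint (cell B s) (cell C t) := fun s t =>
    hRS.mono ((cell_subset_iUnion B s).trans (iUnion_subset fun i => i.1.2.2))
      ((cell_subset_iUnion C t).trans (iUnion_subset fun j => j.1.2.2))
  have hd : Pairwise fun s t => Disjoint (F s) (F t) := by
    rintro (s | s) (t | t) hst
    · exact disjoint_cell B fun h => hst (by rw [h])
    · exact hcross s t
    · exact (hcross t s).symm
    · exact disjoint_cell C fun h => hst (by rw [h])
  have hind := (hΛ.iIndepFun_of_disjoint hF hd).indepFun_finset
    (Finset.univ.image Sum.inl) (Finset.univ.image Sum.inr)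
    (by
      rw [Finset.disjoint_left]
      intro x hx hy
      simp only [Finset.mem_image, Finset.mem_univ, true_and] at hx hy
      obtain ⟨a, rfl⟩ := hx
      obtain ⟨b, hb⟩ := hy
      exact absurd hb (by simp)) (fun s => hΛ.measurable _ (hF s))
  let fI : (↥(Finset.univ.image Sum.inl : Finset (Finset I ⊕ Finset J)) → ℝ) → I → ℝ := fun v i =>
    ∑ s ∈ Finset.univ.filter (fun s : Finset I => i ∈ s), v ⟨Sum.inl s, by simp⟩
  let fJ : (↥(Finset.univ.image Sum.inr : Finset (Finset I ⊕ Finset J)) → ℝ) → J → ℝ := fun v j =>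
    ∑ s ∈ Finset.univ.filter (fun s : Finset J => j ∈ s), v ⟨Sum.inr s, by simp⟩
  have hfI : Measurable fI := by fun_prop
  have hfJ : Measurable fJ := by fun_prop
  have hcomp := hind.comp hfI hfJ
  exact hcomp.congr (hΛ.sum_cell_ae hB).symm (hΛ.sum_cell_ae hC).symm

lemma IsScatteredMeasure.lintegral_mul_of_disjoint (hΛ : IsScatteredMeasure P ψ Λ)
    {R S : Set (ℝ × ℝ)} (hRS : Disjoint R S) {f g : Ω → ℝ≥0∞} (hf : Measurable[regionSigma Λ R] f)
    (hg : Measurable[regionSigma Λ S] g) : ∫⁻ ω, f ω * g ω ∂P = (∫⁻ ω, f ω ∂P) * ∫⁻ ω, g ω ∂P :=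
  lintegral_mul_eq_lintegral_mul_lintegral_of_independent_measurableSpace
    (hΛ.regionSigma_le R) (hΛ.regionSigma_le S) (hΛ.indep_regionSigma hRS) hf hg

/-! ### The multiplicative factors -/

/-- The factor `Q(B) = exp Λ(B)`, with values in `[0, ∞]` for the sake of Lebesgue integrals. -/
noncomputable def factor (Λ : Set (ℝ × ℝ) → Ω → ℝ) (B : Set (ℝ × ℝ)) (ω : Ω) : ℝ≥0∞ :=
  ENNReal.ofReal (Real.exp (Λ B ω))

lemma factor_ne_zero (B : Set (ℝ × ℝ)) (ω : Ω) : factor Λ B ω ≠ 0 := by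
  simp [factor, Real.exp_pos]

lemma factor_ne_top (B : Set (ℝ × ℝ)) (ω : Ω) : factor Λ B ω ≠ ⊤ := ENNReal.ofReal_ne_top

lemma measurable_factor_regionSigma {R B : Set (ℝ × ℝ)} (hB : B ∈ finiteAreaSets) (hBR : B ⊆ R) :
    Measurable[regionSigma Λ R] (factor Λ B) :=
  ((measurable_regionSigma hB hBR).exp).ennreal_ofReal

lemma IsScatteredMeasure.measurable_factor (hΛ : IsScatteredMeasure P ψ Λ) {B : Set (ℝ × ℝ)}
    (hB : B ∈ finiteAreaSets) : Measurable (factor Λ B) :=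
  ((hΛ.measurable B hB).exp).ennreal_ofReal

lemma IsScatteredMeasure.factor_union_ae (hΛ : IsScatteredMeasure P ψ Λ) {A B : Set (ℝ × ℝ)}
    (hA : A ∈ finiteAreaSets) (hB : B ∈ finiteAreaSets) (hAB : Disjoint A B) :
    ∀ᵐ ω ∂P, factor Λ (A ∪ B) ω = factor Λ A ω * factor Λ B ω := by
  filter_upwards [hΛ.union_ae hA hB hAB] with ω h
  rw [factor, h, Real.exp_add, ENNReal.ofReal_mul (Real.exp_pos _).le]
  rfl

lemma factor_rpow (B : Set (ℝ × ℝ)) (q : ℝ) (ω : Ω) :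
    factor Λ B ω ^ q = ENNReal.ofReal (Real.exp (q * Λ B ω)) := by
  rw [factor, ENNReal.ofReal_rpow_of_pos (Real.exp_pos _), ← Real.exp_mul, mul_comm]

end Scattered

/-! ### Hyperbolic areas of sets of cones -/

/-! A point `(x, y)` of the half-plane stands for the interval `[x - y/2, x + y/2)` of length `y`;
in these terms `cone t` is the set of the intervals which contain `t`. -/

lemma mem_cone {t : ℝ} {z : ℝ × ℝ} :
    z ∈ cone t ↔ 0 < z.2 ∧ z.1 - z.2 / 2 ≤ t ∧ t < z.1 + z.2 / 2 := by
  unfold cone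
  simp only [mem_ofPred_eq]
  constructor <;> rintro ⟨h1, h2, h3⟩ <;> refine ⟨h1, ?_, ?_⟩ <;> linarith

lemma mem_coneInter_Icc {a b : ℝ} (hab : a ≤ b) {z : ℝ × ℝ} :
    z ∈ coneInter (Icc a b) ↔ 0 < z.2 ∧ z.1 - z.2 / 2 ≤ a ∧ b < z.1 + z.2 / 2 := by
  simp only [coneInter, mem_iInter, mem_cone]
  constructor
  · intro h
    have h1 := h a ⟨le_rfl, hab⟩
    have h2 := h b ⟨hab, le_rfl⟩
    exact ⟨h1.1, h1.2.1, h2.2.2⟩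
  · rintro ⟨h1, h2, h3⟩ t ht
    exact ⟨h1, h2.trans ht.1, ht.2.trans_lt h3⟩

lemma mem_truncCone {a b : ℝ} (hab : a ≤ b) {ε t : ℝ} {z : ℝ × ℝ} :
    z ∈ truncCone (Icc a b) ε t ↔ (0 < z.2 ∧ z.1 - z.2 / 2 ≤ t ∧ t < z.1 + z.2 / 2) ∧
      ¬ (z.1 - z.2 / 2 ≤ a ∧ b < z.1 + z.2 / 2) ∧ ε ≤ z.2 := by
  simp only [truncCone, mem_inter_iff, Set.mem_sdiff, mem_cone, mem_coneInter_Icc hab, mem_ofPred_eq]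
  tauto

lemma measurableSet_cone (t : ℝ) : MeasurableSet (cone t) := by
  have : cone t = {z | 0 < z.2 ∧ z.1 - z.2 / 2 ≤ t ∧ t < z.1 + z.2 / 2} := by
    ext z
    exact mem_cone
  rw [this]
  measurability

lemma measurableSet_coneInter_Icc {a b : ℝ} (hab : a ≤ b) :
    MeasurableSet (coneInter (Icc a b)) := by
  have : coneInter (Icc a b) = {z | 0 < z.2 ∧ z.1 - z.2 / 2 ≤ a ∧ b < z.1 + z.2 / 2} := by
    ext z
    exact mem_coneInter_Icc hab
  rw [this]
  measurability

lemma measurableSet_truncCone {a b : ℝ} (hab : a ≤ b) (ε t : ℝ) :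
    MeasurableSet (truncCone (Icc a b) ε t) :=
  ((measurableSet_cone t).diff (measurableSet_coneInter_Icc hab)).inter
    (measurableSet_le measurable_const measurable_snd)

lemma measurableSet_halfPlane : MeasurableSet halfPlane :=
  measurableSet_lt measurable_const measurable_snd

/-- The hyperbolic area as an integral of the widths of the horizontal sections. -/
lemma hypArea_eq_lintegral {S : Set (ℝ × ℝ)} (hS : MeasurableSet S) :
    hypArea S = ∫⁻ y in Ioi (0 : ℝ), ENNReal.ofReal ((y ^ 2)⁻¹) * volume {x | (x, y) ∈ S} := by
  rw [hypArea, withDensity_apply _ hS, Measure.restrict_restrict hS,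
    ← lintegral_indicator (hS.inter measurableSet_halfPlane), Measure.volume_eq_prod,
    lintegral_prod_symm _ (Measurable.aemeasurable (Measurable.indicator (by fun_prop)
      (hS.inter measurableSet_halfPlane))), ← lintegral_indicator measurableSet_Ioi]
  congr 1
  ext y
  by_cases hy : 0 < y
  · have hmeas : MeasurableSet {x | (x, y) ∈ S} := measurable_prodMk_right hS
    rw [indicator_of_mem (mem_Ioi.2 hy), ← setLIntegral_const, ← lintegral_indicator hmeas]
    congr 1
    ext x
    by_cases hx : (x, y) ∈ S
    · rw [indicator_of_mem (show (x, y) ∈ S ∩ halfPlane from ⟨hx, hy⟩),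
        indicator_of_mem (show x ∈ {x | (x, y) ∈ S} from hx)]
    · rw [indicator_of_notMem (fun h => hx h.1),
        indicator_of_notMem (show x ∉ {x | (x, y) ∈ S} from hx)]
  · rw [indicator_of_notMem (show y ∉ Ioi 0 from hy)]
    refine lintegral_eq_zero_of_ae_eq_zero (ae_of_all _ fun x => ?_)
    exact indicator_of_notMem (fun h => hy h.2) _

lemma lintegral_Ioi_inv_sq {ε : ℝ} (hε : 0 < ε) :
    ∫⁻ y in Ioi ε, ENNReal.ofReal ((y ^ 2)⁻¹) = ENNReal.ofReal (1 / ε) := by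
  have hcongr : EqOn (fun y : ℝ => y ^ (-2 : ℝ)) (fun y => (y ^ 2)⁻¹) (Ioi ε) := by
    intro y hy
    have hy' : 0 < y := hε.trans hy
    simp only [Real.rpow_neg hy'.le]
    norm_cast
  have hint : IntegrableOn (fun y : ℝ => (y ^ 2)⁻¹) (Ioi ε) :=
    (integrableOn_Ioi_rpow_of_lt (by norm_num) hε).congr_fun hcongr measurableSet_Ioi
  rw [← ofReal_integral_eq_lintegral_ofReal hint (ae_of_all _ fun y => by positivity),
    ← setIntegral_congr_fun measurableSet_Ioi hcongr,
    integral_Ioi_rpow_of_lt (by norm_num) hε]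
  congr 1
  norm_num
  rw [Real.rpow_neg_one]

lemma hypArea_le_of_section_le {S : Set (ℝ × ℝ)} (hS : MeasurableSet S) {ε C : ℝ} (hε : 0 < ε)
    (hlow : ∀ z ∈ S, ε ≤ z.2)
    (hsec : ∀ y, 0 < y → volume {x | (x, y) ∈ S} ≤ ENNReal.ofReal C) :
    hypArea S ≤ ENNReal.ofReal (C / ε) := by
  have hIci : ∫⁻ y in Ici ε, ENNReal.ofReal ((y ^ 2)⁻¹) = ENNReal.ofReal (1 / ε) := by
    rw [← lintegral_Ioi_inv_sq hε]
    exact setLIntegral_congr Ioi_ae_eq_Ici.symm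
  rw [hypArea_eq_lintegral hS, ← lintegral_indicator measurableSet_Ioi]
  calc ∫⁻ y, (Ioi (0 : ℝ)).indicator
        (fun y => ENNReal.ofReal ((y ^ 2)⁻¹) * volume {x | (x, y) ∈ S}) y
      ≤ ∫⁻ y, (Ici ε).indicator
        (fun y => ENNReal.ofReal ((y ^ 2)⁻¹) * ENNReal.ofReal C) y := by
        refine lintegral_mono fun y => ?_
        by_cases hy : ε ≤ y
        · rw [indicator_of_mem (show y ∈ Ici ε from hy),
            indicator_of_mem (show y ∈ Ioi (0 : ℝ) from hε.trans_le hy)]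
          gcongr
          exact hsec y (hε.trans_le hy)
        · have : {x | (x, y) ∈ S} = ∅ := by
            ext x
            simp only [mem_ofPred_eq, mem_empty_iff_false, iff_false]
            exact fun h => hy (hlow _ h)
          refine le_of_eq_of_le ?_ zero_le
          by_cases hy0 : y ∈ Ioi (0 : ℝ)
          · rw [indicator_of_mem hy0, this]
            simp
          · rw [indicator_of_notMem hy0]
    _ = ENNReal.ofReal (C / ε) := by
        rw [lintegral_indicator measurableSet_Ici, lintegral_mul_const _ (by fun_prop), hIci,
          ← ENNReal.ofReal_mul (by positivity)]
        congr 1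
        ring

lemma hypArea_truncCone_le {ε t : ℝ} (hε : 0 < ε) (ht : t ∈ Icc (0 : ℝ) 1) :
    hypArea (truncCone (Icc 0 1) ε t) ≤ ENNReal.ofReal (1 / ε) := by
  refine hypArea_le_of_section_le (measurableSet_truncCone zero_le_one ε t) hε
    (fun z hz => hz.2) fun y hy => ?_
  rcases le_or_gt y 1 with hy1 | hy1
  · refine (measure_mono (t := Ioc (t - y / 2) (t + y / 2)) fun x hx => ?_).trans ?_
    · have := (mem_truncCone zero_le_one).1 hx
      simp only at this
      constructor <;> linarith [this.1.2.1, this.1.2.2]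
    · rw [Real.volume_Ioc]
      exact ENNReal.ofReal_le_ofReal (by linarith)
  · refine (measure_mono (t := Ioc (t - y / 2) (1 - y / 2) ∪ Ioc (y / 2) (t + y / 2))
      fun x hx => ?_).trans ((measure_union_le _ _).trans ?_)
    · have := (mem_truncCone zero_le_one).1 hx
      simp only at this
      obtain ⟨⟨-, h1, h2⟩, h3, -⟩ := this
      rcases not_and_or.1 h3 with h | h
      · right
        constructor <;> linarith
      · left
        constructor <;> linarith
    · rw [Real.volume_Ioc, Real.volume_Ioc,
        ← ENNReal.ofReal_add (by linarith [ht.2]) (by linarith [ht.1])]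
      exact ENNReal.ofReal_le_ofReal (by linarith)

lemma truncCone_mem_finiteAreaSets {ε t : ℝ} (hε : 0 < ε) (ht : t ∈ Icc (0 : ℝ) 1) :
    truncCone (Icc 0 1) ε t ∈ finiteAreaSets :=
  ⟨measurableSet_truncCone zero_le_one ε t, fun _ hz => hz.1.1.1,
    (hypArea_truncCone_le hε ht).trans_lt ENNReal.ofReal_lt_top⟩

/-- The intervals which contain `[c, c + 1/2]` but not `[0, 1]`. -/
def halfGap (c : ℝ) : Set (ℝ × ℝ) := coneInter (Icc c (c + 1 / 2)) \ coneInter (Icc 0 1)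

lemma mem_halfGap {c : ℝ} {z : ℝ × ℝ} : z ∈ halfGap c ↔
    (0 < z.2 ∧ z.1 - z.2 / 2 ≤ c ∧ c + 1 / 2 < z.1 + z.2 / 2) ∧
      ¬ (z.1 - z.2 / 2 ≤ 0 ∧ 1 < z.1 + z.2 / 2) := by
  rw [halfGap, Set.mem_sdiff, mem_coneInter_Icc (by linarith), mem_coneInter_Icc zero_le_one]
  tauto

lemma measurableSet_halfGap (c : ℝ) : MeasurableSet (halfGap c) :=
  (measurableSet_coneInter_Icc (by linarith)).diff (measurableSet_coneInter_Icc zero_le_one)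

lemma volume_section_halfGap {c : ℝ} (hc : c ∈ Icc (0 : ℝ) (1 / 2)) {y : ℝ} (hy : 0 < y) :
    volume {x | (x, y) ∈ halfGap c} = ENNReal.ofReal (min y 1 - 1 / 2) := by
  have hmem : ∀ x, (x, y) ∈ halfGap c ↔ (x - y / 2 ≤ c ∧ c + 1 / 2 < x + y / 2) ∧
      ¬ (x - y / 2 ≤ 0 ∧ 1 < x + y / 2) := by
    intro x
    rw [mem_halfGap]
    simp only [hy, true_and]
  rcases le_or_gt y 1 with hy1 | hy1
  · have : {x | (x, y) ∈ halfGap c} = Ioc (c + 1 / 2 - y / 2) (c + y / 2) := by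
      ext x
      rw [mem_ofPred_eq, hmem, mem_Ioc]
      constructor
      · rintro ⟨⟨h1, h2⟩, -⟩
        constructor <;> linarith
      · rintro ⟨h1, h2⟩
        exact ⟨⟨by linarith, by linarith⟩, fun h => by linarith [h.1, h.2]⟩
    rw [this, Real.volume_Ioc, min_eq_left hy1]
    congr 1
    ring
  · have : {x | (x, y) ∈ halfGap c} =
        Ioc (c + 1 / 2 - y / 2) (1 - y / 2) ∪ Ioc (y / 2) (c + y / 2) := by
      ext x
      rw [mem_ofPred_eq, hmem, mem_union, mem_Ioc, mem_Ioc]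
      constructor
      · rintro ⟨⟨h1, h2⟩, h3⟩
        rcases not_and_or.1 h3 with h | h
        · right
          constructor <;> linarith
        · left
          constructor <;> linarith
      · rintro (⟨h1, h2⟩ | ⟨h1, h2⟩)
        · exact ⟨⟨by linarith [hc.1], by linarith⟩, fun h => by linarith [h.1, h.2]⟩
        · exact ⟨⟨by linarith, by linarith [hc.2]⟩, fun h => by linarith [h.1, h.2]⟩
    rw [this, measure_union _ measurableSet_Ioc, Real.volume_Ioc, Real.volume_Ioc,
      ← ENNReal.ofReal_add (by linarith [hc.2]) (by linarith [hc.1]), min_eq_right hy1.le]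
    · congr 1
      ring
    · rw [disjoint_left]
      intro x h1 h2
      linarith [h1.2, h2.1]

/-- The area of `V(J) \ V([0,1])` for an interval `J ⊆ [0, 1]` of length `1/2` is `log 2`. -/
lemma hypArea_halfGap {c : ℝ} (hc : c ∈ Icc (0 : ℝ) (1 / 2)) :
    hypArea (halfGap c) = ENNReal.ofReal (Real.log 2) := by
  have hsec : ∀ y ∈ Ioi (0 : ℝ), ENNReal.ofReal ((y ^ 2)⁻¹) * volume {x | (x, y) ∈ halfGap c} =
      ENNReal.ofReal ((y ^ 2)⁻¹) * ENNReal.ofReal (min y 1 - 1 / 2) := fun y hy => by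
    rw [volume_section_halfGap hc hy]
  rw [hypArea_eq_lintegral (measurableSet_halfGap c), setLIntegral_congr_fun measurableSet_Ioi hsec]
  have hsplit : Ioi (0 : ℝ) = Ioc 0 (1 / 2) ∪ (Ioc (1 / 2) 1 ∪ Ioi 1) := by
    rw [Ioc_union_Ioi_eq_Ioi (by norm_num), Ioc_union_Ioi_eq_Ioi (by norm_num)]
  rw [hsplit, lintegral_union (measurableSet_Ioc.union measurableSet_Ioi),
    lintegral_union measurableSet_Ioi]
  rotate_left
  · exact disjoint_left.2 fun x h1 h2 => (mem_Ioi.1 h2).not_ge h1.2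
  · rw [Ioc_union_Ioi_eq_Ioi (by norm_num)]
    exact disjoint_left.2 fun x h1 h2 => (mem_Ioi.1 h2).not_ge h1.2
  have e1 : ∫⁻ y in Ioc (0 : ℝ) (1 / 2),
      ENNReal.ofReal ((y ^ 2)⁻¹) * ENNReal.ofReal (min y 1 - 1 / 2) = 0 := by
    rw [setLIntegral_congr_fun (g := fun _ => 0) measurableSet_Ioc, lintegral_zero]
    intro y hy
    have : min y 1 - 1 / 2 ≤ 0 := by
      have := min_le_left y 1
      linarith [hy.2]
    simp only [ENNReal.ofReal_of_nonpos this, mul_zero]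
  have e2 : ∫⁻ y in Ioc (1 / 2 : ℝ) 1,
      ENNReal.ofReal ((y ^ 2)⁻¹) * ENNReal.ofReal (min y 1 - 1 / 2) =
      ENNReal.ofReal (Real.log 2 - 1 / 2) := by
    have hder : ∀ y ∈ uIcc (1 / 2 : ℝ) 1,
        HasDerivAt (fun y => Real.log y + 1 / 2 * y⁻¹) (y⁻¹ + 1 / 2 * (-(y ^ 2)⁻¹)) y := by
      intro y hy
      rw [uIcc_of_le (by norm_num)] at hy
      have hy0 : y ≠ 0 := by linarith [hy.1]
      exact (Real.hasDerivAt_log hy0).add ((hasDerivAt_inv hy0).const_mul _)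
    have hcont : ContinuousOn (fun y : ℝ => y⁻¹ + 1 / 2 * (-(y ^ 2)⁻¹)) (uIcc (1 / 2) 1) := by
      rw [uIcc_of_le (by norm_num)]
      have h0 : ∀ y ∈ Icc (1 / 2 : ℝ) 1, y ≠ 0 := fun y hy => by linarith [hy.1]
      exact (continuousOn_id.inv₀ h0).add (continuousOn_const.mul
        (((continuousOn_id.pow 2).inv₀ fun y hy => pow_ne_zero 2 (h0 y hy)).neg))
    have hint := intervalIntegral.integral_eq_sub_of_hasDerivAt hder hcont.intervalIntegrable
    rw [intervalIntegral.integral_of_le (by norm_num)] at hint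
    have hI : IntegrableOn (fun y : ℝ => y⁻¹ + 1 / 2 * (-(y ^ 2)⁻¹)) (Ioc (1 / 2) 1) :=
      (intervalIntegrable_iff_integrableOn_Ioc_of_le (by norm_num)).1 hcont.intervalIntegrable
    have hnn : ∀ y ∈ Ioc (1 / 2 : ℝ) 1, 0 ≤ y⁻¹ + 1 / 2 * (-(y ^ 2)⁻¹) := by
      intro y hy
      have hy0 : 0 < y := by linarith [hy.1]
      have : y⁻¹ + 1 / 2 * (-(y ^ 2)⁻¹) = (y - 1 / 2) / y ^ 2 := by
        field_simp
        ring
      rw [this]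
      exact div_nonneg (by linarith [hy.1]) (by positivity)
    have h3 := ofReal_integral_eq_lintegral_ofReal hI
      ((ae_restrict_iff' measurableSet_Ioc).2 (ae_of_all _ hnn))
    rw [hint] at h3
    rw [setLIntegral_congr_fun measurableSet_Ioc
      (g := fun y => ENNReal.ofReal (y⁻¹ + 1 / 2 * (-(y ^ 2)⁻¹))), ← h3]
    · congr 1
      rw [show (1 / 2 : ℝ) = 2⁻¹ by norm_num, Real.log_inv, Real.log_one]
      norm_num
      ring
    · intro y hy
      have hy0 : 0 < y := by linarith [hy.1]
      simp only
      rw [min_eq_left hy.2, ← ENNReal.ofReal_mul (by positivity)]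
      congr 1
      field_simp
      ring
  have e3 : ∫⁻ y in Ioi (1 : ℝ),
      ENNReal.ofReal ((y ^ 2)⁻¹) * ENNReal.ofReal (min y 1 - 1 / 2) =
      ENNReal.ofReal (1 / 2) := by
    rw [setLIntegral_congr_fun measurableSet_Ioi
      (g := fun y => ENNReal.ofReal ((y ^ 2)⁻¹) * ENNReal.ofReal (1 / 2)),
      lintegral_mul_const _ (by fun_prop), lintegral_Ioi_inv_sq one_pos,
      ← ENNReal.ofReal_mul (by norm_num)]
    · norm_num
    · intro y hy
      simp only
      rw [min_eq_right (mem_Ioi.1 hy).le]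
      norm_num
  rw [e1, e2, e3, zero_add, ← ENNReal.ofReal_add _ (by norm_num)]
  · congr 1
    ring
  · have := Real.log_two_gt_d9
    linarith

lemma halfGap_mem_finiteAreaSets {c : ℝ} (hc : c ∈ Icc (0 : ℝ) (1 / 2)) :
    halfGap c ∈ finiteAreaSets :=
  ⟨measurableSet_halfGap c, fun _ hz => (mem_halfGap.1 hz).1.1,
    by rw [hypArea_halfGap hc]; exact ENNReal.ofReal_lt_top⟩

/-- The similarity of the half-plane which maps `[0, 1]` onto `[c, c + 1/2]`. -/
noncomputable def halfMap (c : ℝ) (z : ℝ × ℝ) : ℝ × ℝ := (c + z.1 / 2, z.2 / 2)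

lemma measurable_halfMap (c : ℝ) : Measurable (halfMap c) := by
  unfold halfMap
  fun_prop

lemma hypArea_preimage_halfMap (c : ℝ) {S : Set (ℝ × ℝ)} (hS : MeasurableSet S) :
    hypArea (halfMap c ⁻¹' S) = hypArea S := by
  rw [hypArea_eq_lintegral hS, hypArea_eq_lintegral (measurable_halfMap c hS),
    ← lintegral_indicator measurableSet_Ioi, ← lintegral_indicator measurableSet_Ioi]
  have hsec : ∀ y : ℝ, volume {x | (x, y) ∈ halfMap c ⁻¹' S} =
      2 * volume {x | (x, y / 2) ∈ S} := by
    intro y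
    have h1 : {x | (x, y) ∈ halfMap c ⁻¹' S} =
        (fun x => (1 / 2 : ℝ) * x) ⁻¹' ((fun x => c + x) ⁻¹' {x | (x, y / 2) ∈ S}) := by
      ext x
      simp only [halfMap, mem_preimage, mem_ofPred_eq]
      rw [show c + 1 / 2 * x = c + x / 2 by ring]
    rw [h1, Real.volume_preimage_mul_left (by norm_num), measure_preimage_add]
    norm_num
  simp only [hsec]
  set G : ℝ → ℝ≥0∞ := (Ioi (0 : ℝ)).indicator
    fun y => ENNReal.ofReal ((y ^ 2)⁻¹) * volume {x | (x, y) ∈ S} with hG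
  have hGm : Measurable G :=
    Measurable.indicator (Measurable.mul (by fun_prop) (measurable_measure_prodMk_right hS))
      measurableSet_Ioi
  have h2 : ∀ y : ℝ, (Ioi (0 : ℝ)).indicator (fun y => ENNReal.ofReal ((y ^ 2)⁻¹) *
      (2 * volume {x | (x, y / 2) ∈ S})) y = 1 / 2 * G ((1 / 2 : ℝ) * y) := by
    intro y
    by_cases hy : 0 < y
    · rw [hG, indicator_of_mem (mem_Ioi.2 hy),
        indicator_of_mem (mem_Ioi.2 (by positivity : 0 < (1 / 2 : ℝ) * y))]
      have e : ((1 / 2 * y) ^ 2)⁻¹ = 4 * (y ^ 2)⁻¹ := by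
        field_simp
        norm_num
      rw [e, ENNReal.ofReal_mul (by norm_num), show (1 / 2 : ℝ) * y = y / 2 by ring,
        ← mul_assoc, ← mul_assoc, ← mul_assoc]
      congr 1
      rw [mul_comm, show ENNReal.ofReal 4 = 2 * 2 by norm_num [← ENNReal.ofReal_ofNat], one_div,
        ← mul_assoc, ENNReal.inv_mul_cancel (by simp) (by simp), one_mul]
    · rw [hG, indicator_of_notMem (show y ∉ Ioi 0 from hy), indicator_of_notMem, mul_zero]
      rw [mem_Ioi]
      linarith
  simp only [h2]
  have hGm' : Measurable fun y : ℝ => G (1 / 2 * y) := hGm.comp (measurable_const_mul _)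
  rw [lintegral_const_mul _ hGm',
    ← lintegral_map hGm (by fun_prop : Measurable fun y : ℝ => (1 / 2 : ℝ) * y),
    Real.map_volume_mul_left (by norm_num), lintegral_smul_measure, smul_eq_mul, ← mul_assoc]
  norm_num
  rw [ENNReal.inv_mul_cancel (by simp) (by simp), one_mul]

lemma preimage_halfMap_truncCone (c ε τ : ℝ) :
    halfMap c ⁻¹' truncCone (Icc c (c + 1 / 2)) ε (c + τ / 2) = truncCone (Icc 0 1) (2 * ε) τ := by
  ext z
  rw [mem_preimage, mem_truncCone (by linarith), mem_truncCone zero_le_one]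
  simp only [halfMap]
  refine and_congr ?_ (and_congr (not_congr ?_) ?_)
  · constructor <;> rintro ⟨h1, h2, h3⟩ <;> refine ⟨?_, ?_, ?_⟩ <;> linarith
  · constructor <;> rintro ⟨h1, h2⟩ <;> refine ⟨?_, ?_⟩ <;> linarith
  · constructor <;> intro h <;> linarith

lemma truncCone_eq_halfGap_union {c ε t : ℝ} (hc : c ∈ Icc (0 : ℝ) (1 / 2)) (hε : ε ≤ 1 / 2)
    (ht : t ∈ Icc c (c + 1 / 2)) :
    truncCone (Icc 0 1) ε t = halfGap c ∪ truncCone (Icc c (c + 1 / 2)) ε t := by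
  ext z
  rw [mem_union, mem_halfGap, mem_truncCone zero_le_one, mem_truncCone (by linarith)]
  constructor
  · rintro ⟨h1, h2, h3⟩
    by_cases h : z.1 - z.2 / 2 ≤ c ∧ c + 1 / 2 < z.1 + z.2 / 2
    · exact Or.inl ⟨⟨h1.1, h⟩, h2⟩
    · exact Or.inr ⟨h1, h, h3⟩
  · rintro (⟨⟨h1, h2, h3⟩, h4⟩ | ⟨h1, h2, h3⟩)
    · exact ⟨⟨h1, by linarith [ht.1], by linarith [ht.2]⟩, h4, by linarith⟩
    · exact ⟨h1, fun h => h2 ⟨by linarith [hc.1], by linarith [hc.2]⟩, h3⟩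

lemma disjoint_halfGap_truncCone (c ε t : ℝ) :
    Disjoint (halfGap c) (truncCone (Icc c (c + 1 / 2)) ε t) :=
  disjoint_left.2 fun _ h1 h2 => h2.1.2 h1.1

lemma cell_preimage {ι : Type*} (h : ℝ × ℝ → ℝ × ℝ) (B : ι → Set (ℝ × ℝ)) (S : Finset ι) :
    cell (fun i => h ⁻¹' B i) S = h ⁻¹' cell B S := rfl

/-! ### Exact scaling -/

section Scaling

variable {Ω : Type*} [MeasurableSpace Ω] {P : Measure Ω} [IsProbabilityMeasure P] {ψ : ℂ → ℂ}
  {Λ : Set (ℝ × ℝ) → Ω → ℝ}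

/-- The factor `Q(V_ε(t))` of the cascade on `[0, 1]`. -/
noncomputable def density (Λ : Set (ℝ × ℝ) → Ω → ℝ) (ε t : ℝ) : Ω → ℝ≥0∞ :=
  factor Λ (truncCone (Icc 0 1) ε t)

/-- **Exact scaling.** On `[c, c + 1/2]` the densities at scale `ε` are those of an independent
copy on `[0, 1]` at scale `2 ε`, multiplied by the common factor of the intervals which contain
`[c, c + 1/2]`. -/
lemma IsScatteredMeasure.lintegral_scaling (hΛ : IsScatteredMeasure P ψ Λ) {c ε : ℝ}
    (hc : c ∈ Icc (0 : ℝ) (1 / 2)) (hε0 : 0 < ε) (hε : ε ≤ 1 / 2) {ι : Type*} [Fintype ι]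
    {τ : ι → ℝ} (hτ : ∀ i, τ i ∈ Icc (0 : ℝ) 1) {g : ℝ≥0∞ → ℝ≥0∞} (hg : Measurable g)
    {F : (ι → ℝ≥0∞) → ℝ≥0∞} (hF : Measurable F) :
    ∫⁻ ω, g (factor Λ (halfGap c) ω) *
        F (fun i => (factor Λ (halfGap c) ω)⁻¹ * density Λ ε (c + τ i / 2) ω) ∂P =
      (∫⁻ ω, g (factor Λ (halfGap c) ω) ∂P) *
        ∫⁻ ω, F (fun i => density Λ (2 * ε) (τ i) ω) ∂P := by
  have hmemJ : ∀ i, c + τ i / 2 ∈ Icc c (c + 1 / 2) := fun i =>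
    ⟨by linarith [(hτ i).1], by linarith [(hτ i).2]⟩
  have hmemI : ∀ i, c + τ i / 2 ∈ Icc (0 : ℝ) 1 := fun i =>
    ⟨by linarith [(hτ i).1, hc.1], by linarith [(hτ i).2, hc.2]⟩
  have hW := halfGap_mem_finiteAreaSets hc
  let B : ι → Set (ℝ × ℝ) := fun i => truncCone (Icc c (c + 1 / 2)) ε (c + τ i / 2)
  have hB : ∀ i, B i ∈ finiteAreaSets := fun i =>
    mem_finiteAreaSets_of_subset (truncCone_mem_finiteAreaSets hε0 (hmemI i))
      (measurableSet_truncCone (by linarith) _ _)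
      (by rw [truncCone_eq_halfGap_union hc hε (hmemJ i)]; exact subset_union_right)
  let C : ι → Set (ℝ × ℝ) := fun i => truncCone (Icc 0 1) (2 * ε) (τ i)
  have hC : ∀ i, C i ∈ finiteAreaSets := fun i =>
    truncCone_mem_finiteAreaSets (by positivity) (hτ i)
  have hCB : C = fun i => halfMap c ⁻¹' B i :=
    funext fun i => (preimage_halfMap_truncCone c ε (τ i)).symm
  have hlaw := hΛ.map_pi_eq_of_hypArea_cell_eq hB hC fun S => by
    rw [hCB, cell_preimage, hypArea_preimage_halfMap c (measurableSet_cell (fun i => (hB i).1) S)]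
  have hae : ∀ᵐ ω ∂P, ∀ i, density Λ ε (c + τ i / 2) ω =
      factor Λ (halfGap c) ω * factor Λ (B i) ω := by
    refine ae_all_iff.2 fun i => ?_
    rw [density, truncCone_eq_halfGap_union hc hε (hmemJ i)]
    exact hΛ.factor_union_ae hW (hB i) (disjoint_halfGap_truncCone _ _ _)
  have e1 : ∫⁻ ω, g (factor Λ (halfGap c) ω) *
        F (fun i => (factor Λ (halfGap c) ω)⁻¹ * density Λ ε (c + τ i / 2) ω) ∂P =
      ∫⁻ ω, g (factor Λ (halfGap c) ω) * F (fun i => factor Λ (B i) ω) ∂P := by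
    refine lintegral_congr_ae ?_
    filter_upwards [hae] with ω hω
    congr 2
    ext i
    rw [hω i, ← mul_assoc, ENNReal.inv_mul_cancel (factor_ne_zero _ _) (factor_ne_top _ _),
      one_mul]
  rw [e1, hΛ.lintegral_mul_of_disjoint (R := halfGap c) (S := (halfGap c)ᶜ)
    (f := fun ω => g (factor Λ (halfGap c) ω)) (g := fun ω => F fun i => factor Λ (B i) ω)
    disjoint_compl_right (hg.comp (measurable_factor_regionSigma hW subset_rfl))
    (hF.comp (@measurable_pi_lambda _ _ _ (regionSigma Λ (halfGap c)ᶜ) _ _ fun i => measurable_factor_regionSigma (hB i)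
      (disjoint_halfGap_truncCone _ _ _).subset_compl_left))]
  congr 1
  have hexp : Measurable fun v : ι → ℝ => F fun i => ENNReal.ofReal (Real.exp (v i)) :=
    hF.comp (by fun_prop)
  have e2 : ∀ {D : ι → Set (ℝ × ℝ)}, (∀ i, D i ∈ finiteAreaSets) →
      ∫⁻ ω, F (fun i => factor Λ (D i) ω) ∂P =
        ∫⁻ v, F (fun i => ENNReal.ofReal (Real.exp (v i))) ∂(P.map fun ω i => Λ (D i) ω) := by
    intro D hD
    rw [lintegral_map hexp (measurable_pi_lambda _ fun i => hΛ.measurable _ (hD i))]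
    rfl
  rw [e2 hB, hlaw, ← e2 hC]
  rfl

end Scaling

/-! ### Moments of the factors and a maximal inequality -/

/-- A scattered measure whose factors `Q(B)` have the moments `E Q(B)^q = e^{Ψ q λ(B)}` for
`0 ≤ q ≤ ζ`, where `1 < ζ`, normalized by `Ψ 1 = 0`. -/
structure IsCascadeModel {Ω : Type*} [MeasurableSpace Ω] (P : Measure Ω) (ψ : ℂ → ℂ)
    (Λ : Set (ℝ × ℝ) → Ω → ℝ) (Ψ : ℝ → ℝ) (ζ : ℝ) : Prop where
  scattered : IsScatteredMeasure P ψ Λ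
  moment : ∀ B ∈ finiteAreaSets, ∀ q ∈ Icc 0 ζ,
    ∫⁻ ω, factor Λ B ω ^ q ∂P = ENNReal.ofReal (Real.exp (Ψ q * (hypArea B).toReal))
  one_lt : 1 < ζ
  map_one : Ψ 1 = 0

lemma ofReal_mul_rpow_mul_le {q : ℝ} (hq : 1 < q) (m x : ℝ≥0∞) :
    ENNReal.ofReal q * (m ^ (q - 1) * x) ≤ ENNReal.ofReal (q - 1) * m ^ q + x ^ q := by
  have hq0 : 0 < q := by linarith
  have hq1 : 0 < q - 1 := by linarith
  have hconj : (q / (q - 1)).HolderConjugate q :=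
    (Real.HolderConjugate.conjExponent hq).symm
  have h := ENNReal.young_inequality (m ^ (q - 1)) x hconj
  have e1 : (m ^ (q - 1)) ^ (q / (q - 1)) = m ^ q := by
    rw [← ENNReal.rpow_mul, mul_div_cancel₀ _ hq1.ne']
  rw [e1] at h
  refine (mul_le_mul_right h (ENNReal.ofReal q)).trans (le_of_eq ?_)
  rw [mul_add]
  congr 1
  · rw [ENNReal.ofReal_div_of_pos hq1, div_eq_mul_inv, ENNReal.inv_div (by simp) (by simp [hq0]),
      mul_left_comm, ENNReal.mul_div_cancel (by simp [hq0]) (by simp), mul_comm]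
  · rw [ENNReal.mul_div_cancel (by simp [hq0]) (by simp)]

/-- One step of the pathwise form of Doob's inequality, `m` being the running maximum and `x` the
next value. -/
lemma sup_rpow_add_le {q : ℝ} (hq : 1 < q) (m x : ℝ≥0∞) :
    ENNReal.ofReal (q - 1) * (m ⊔ x) ^ q + ENNReal.ofReal q * (m ^ (q - 1) * x) ≤
      ENNReal.ofReal (q - 1) * m ^ q + ENNReal.ofReal q * ((m ⊔ x) ^ (q - 1) * x) := by
  rcases le_total x m with h | h
  · rw [sup_eq_left.2 h]
  · rw [sup_eq_right.2 h]
    have e : x ^ (q - 1) * x = x ^ q := by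
      nth_rw 2 [← ENNReal.rpow_one x]
      rw [← ENNReal.rpow_add_of_nonneg _ _ (by linarith) zero_le_one, sub_add_cancel]
    have e2 : ENNReal.ofReal q * x ^ q = ENNReal.ofReal (q - 1) * x ^ q + x ^ q := by
      nth_rw 3 [← one_mul (x ^ q)]
      rw [← add_mul, ← ENNReal.ofReal_one, ← ENNReal.ofReal_add (by linarith) zero_le_one,
        sub_add_cancel]
    rw [e, e2, add_comm (ENNReal.ofReal (q - 1) * m ^ q), add_assoc]
    refine add_le_add_right ?_ _
    rw [add_comm]
    exact ofReal_mul_rpow_mul_le hq m x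

lemma finset_sup_rpow_le_sum {ι : Type*} (s : Finset ι) (f : ι → ℝ≥0∞) {q : ℝ} (hq : 0 < q) :
    (s.sup f) ^ q ≤ ∑ i ∈ s, f i ^ q := by
  rcases s.eq_empty_or_nonempty with rfl | hs
  · simp [hq]
  · obtain ⟨i, hi, h⟩ := Finset.exists_mem_eq_sup s hs f
    rw [h]
    exact Finset.single_le_sum (f := fun i => f i ^ q) (fun _ _ => zero_le) hi

section Model

variable {Ω : Type*} [MeasurableSpace Ω] {P : Measure Ω} [IsProbabilityMeasure P] {ψ : ℂ → ℂ}
  {Λ : Set (ℝ × ℝ) → Ω → ℝ} {Ψ : ℝ → ℝ} {ζ : ℝ}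

lemma IsCascadeModel.lintegral_factor (hM : IsCascadeModel P ψ Λ Ψ ζ) {B : Set (ℝ × ℝ)}
    (hB : B ∈ finiteAreaSets) : ∫⁻ ω, factor Λ B ω ∂P = 1 := by
  have := hM.moment B hB 1 ⟨zero_le_one, hM.one_lt.le⟩
  simpa [hM.map_one] using this

lemma IsCascadeModel.lintegral_factor_rpow_le (hM : IsCascadeModel P ψ Λ Ψ ζ)
    {B : Set (ℝ × ℝ)} (hB : B ∈ finiteAreaSets) {q : ℝ} (hq : q ∈ Icc 0 ζ) {A : ℝ} (hA : 0 ≤ A)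
    (hBA : hypArea B ≤ ENNReal.ofReal A) :
    ∫⁻ ω, factor Λ B ω ^ q ∂P ≤ ENNReal.ofReal (Real.exp (|Ψ q| * A)) := by
  rw [hM.moment B hB q hq]
  refine ENNReal.ofReal_le_ofReal (Real.exp_le_exp.2 ?_)
  exact mul_le_mul (le_abs_self _) (ENNReal.toReal_le_of_le_ofReal hA hBA)
    ENNReal.toReal_nonneg (abs_nonneg _)

lemma IsCascadeModel.lintegral_mul_factor (hM : IsCascadeModel P ψ Λ Ψ ζ) {R B : Set (ℝ × ℝ)}
    (hB : B ∈ finiteAreaSets) (hRB : Disjoint R B) {f : Ω → ℝ≥0∞}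
    (hf : Measurable[regionSigma Λ R] f) : ∫⁻ ω, f ω * factor Λ B ω ∂P = ∫⁻ ω, f ω ∂P := by
  rw [hM.scattered.lintegral_mul_of_disjoint hRB hf (measurable_factor_regionSigma hB subset_rfl),
    hM.lintegral_factor hB, mul_one]

/-- The running maximum of the factors of an increasing sequence of sets. -/
noncomputable def runningMax (Λ : Set (ℝ × ℝ) → Ω → ℝ) (U : ℕ → Set (ℝ × ℝ)) (m : ℕ) (ω : Ω) :
    ℝ≥0∞ := (Finset.range (m + 1)).sup fun i => factor Λ (U i) ω

lemma runningMax_succ (U : ℕ → Set (ℝ × ℝ)) (m : ℕ) (ω : Ω) :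
    runningMax Λ U (m + 1) ω = runningMax Λ U m ω ⊔ factor Λ (U (m + 1)) ω := by
  unfold runningMax
  rw [Finset.range_add_one, Finset.sup_insert, sup_comm]

lemma measurable_runningMax {R : Set (ℝ × ℝ)} {U : ℕ → Set (ℝ × ℝ)} {m : ℕ}
    (hU : ∀ i ≤ m, U i ∈ finiteAreaSets) (hR : ∀ i ≤ m, U i ⊆ R) :
    Measurable[regionSigma Λ R] (runningMax Λ U m) := by
  induction m with
  | zero =>
    have : runningMax Λ U 0 = factor Λ (U 0) := by
      ext ω
      simp [runningMax]
    rw [this]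
    exact measurable_factor_regionSigma (hU 0 le_rfl) (hR 0 le_rfl)
  | succ m ih =>
    have : runningMax Λ U (m + 1) = fun ω => runningMax Λ U m ω ⊔ factor Λ (U (m + 1)) ω :=
      funext fun ω => runningMax_succ U m ω
    rw [this]
    exact Measurable.sup (ih (fun i hi => hU i (by omega)) fun i hi => hR i (by omega))
      (measurable_factor_regionSigma (hU _ le_rfl) (hR _ le_rfl))

/-- Doob's `L^q` inequality for the martingale of the factors of an increasing sequence of sets. -/
lemma IsCascadeModel.lintegral_runningMax_rpow_le (hM : IsCascadeModel P ψ Λ Ψ ζ)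
    {U : ℕ → Set (ℝ × ℝ)} (hU : ∀ i, U i ∈ finiteAreaSets) (hmono : Monotone U) {q : ℝ}
    (hq1 : 1 < q) (hqζ : q ≤ ζ) (m : ℕ) :
    ∫⁻ ω, runningMax Λ U m ω ^ q ∂P ≤
      ENNReal.ofReal (q / (q - 1)) ^ q * ∫⁻ ω, factor Λ (U m) ω ^ q ∂P := by
  have hq0 : 0 < q := by linarith
  have hΛ := hM.scattered
  have hmeasM : ∀ j, Measurable (runningMax Λ U j) := fun j =>
    (measurable_runningMax (R := univ) (fun i _ => hU i) fun _ _ => subset_univ _).mono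
      (hΛ.regionSigma_le _) le_rfl
  have hmeasQ : ∀ j, Measurable (factor Λ (U j)) := fun j => hΛ.measurable_factor (hU j)
  have hmeasMQ : ∀ i j, Measurable fun ω => runningMax Λ U i ω ^ (q - 1) * factor Λ (U j) ω :=
    fun i j => ((hmeasM i).pow_const _).mul (hmeasQ j)
  set a : ℕ → ℝ≥0∞ := fun j => ∫⁻ ω, runningMax Λ U j ω ^ q ∂P with ha
  set b : ℕ → ℝ≥0∞ := fun j => ∫⁻ ω, runningMax Λ U j ω ^ (q - 1) * factor Λ (U j) ω ∂P with hb
  have hafin : ∀ j, a j ≠ ⊤ := by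
    intro j
    refine ne_top_of_le_ne_top ?_ (lintegral_mono fun ω => finset_sup_rpow_le_sum _ _ hq0)
    rw [lintegral_finsetSum _ fun i _ => (hmeasQ i).pow_const q]
    refine ENNReal.sum_ne_top.2 fun i _ => ?_
    rw [hM.moment _ (hU i) q ⟨hq0.le, hqζ⟩]
    exact ENNReal.ofReal_ne_top
  have hle : ∀ j ω, factor Λ (U j) ω ≤ runningMax Λ U j ω := fun j ω =>
    Finset.le_sup (f := fun i => factor Λ (U i) ω) (Finset.self_mem_range_succ j)
  have hrpow : ∀ x : ℝ≥0∞, x ^ (q - 1) * x = x ^ q := by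
    intro x
    nth_rw 2 [← ENNReal.rpow_one x]
    rw [← ENNReal.rpow_add_of_nonneg _ _ (by linarith) zero_le_one, sub_add_cancel]
  have hba : ∀ j, b j ≤ a j := fun j => lintegral_mono fun ω => by
    rw [← hrpow]
    exact mul_le_mul_right (hle j ω) _
  have hstep : ∀ j, ENNReal.ofReal (q - 1) * a (j + 1) + ENNReal.ofReal q * b j ≤
      ENNReal.ofReal (q - 1) * a j + ENNReal.ofReal q * b (j + 1) := by
    intro j
    have hcond : ∫⁻ ω, runningMax Λ U j ω ^ (q - 1) * factor Λ (U (j + 1)) ω ∂P = b j := by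
      have hD : U (j + 1) \ U j ∈ finiteAreaSets :=
        mem_finiteAreaSets_of_subset (hU _) ((hU _).1.diff (hU _).1) Set.sdiff_subset
      have hdec := hΛ.factor_union_ae (hU j) hD disjoint_sdiff_right
      rw [union_sdiff_cancel (hmono j.le_succ)] at hdec
      rw [lintegral_congr_ae (g := fun ω => runningMax Λ U j ω ^ (q - 1) * factor Λ (U j) ω *
        factor Λ (U (j + 1) \ U j) ω)]
      · refine hM.lintegral_mul_factor hD (R := U j) disjoint_sdiff_right
          (Measurable.mul (Measurable.pow_const ?_ _)
            (measurable_factor_regionSigma (hU j) subset_rfl))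
        exact measurable_runningMax (fun i _ => hU i) fun i hi => hmono hi
      · filter_upwards [hdec] with ω hω
        rw [hω, mul_assoc]
    have h := lintegral_mono (μ := P) fun ω =>
      sup_rpow_add_le hq1 (runningMax Λ U j ω) (factor Λ (U (j + 1)) ω)
    simp only [← runningMax_succ] at h
    rw [lintegral_add_left (((hmeasM _).pow_const _).const_mul _),
      lintegral_add_left (((hmeasM _).pow_const _).const_mul _),
      lintegral_const_mul _ ((hmeasM _).pow_const _),
      lintegral_const_mul _ (hmeasMQ _ _),
      lintegral_const_mul _ ((hmeasM _).pow_const _),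
      lintegral_const_mul _ (hmeasMQ _ _), hcond] at h
    exact h
  have hmain : ∀ j, ENNReal.ofReal (q - 1) * a j ≤ ENNReal.ofReal q * b j := by
    intro j
    induction j with
    | zero =>
      have : a 0 = b 0 := by
        simp only [ha, hb, runningMax, zero_add, Finset.range_one, Finset.sup_singleton, hrpow]
      rw [this]
      exact mul_le_mul_left (ENNReal.ofReal_le_ofReal (by linarith)) _
    | succ j ih =>
      have hfin : ENNReal.ofReal q * b j ≠ ⊤ :=
        ENNReal.mul_ne_top ENNReal.ofReal_ne_top (ne_top_of_le_ne_top (hafin j) (hba j))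
      have h := (hstep j).trans (add_le_add_left ih _)
      rw [add_comm] at h
      exact (ENNReal.add_le_add_iff_left hfin).1 h
  -- Young's inequality with the weight `q / (q - 1)` on the last factor absorbs the maximum
  set c : ℝ≥0∞ := ENNReal.ofReal (q / (q - 1)) with hc
  have hyoung : ENNReal.ofReal q * (c * b m) ≤
      ENNReal.ofReal (q - 1) * a m + c ^ q * ∫⁻ ω, factor Λ (U m) ω ^ q ∂P := by
    have hmeasMcQ : Measurable fun ω => runningMax Λ U m ω ^ (q - 1) * (c * factor Λ (U m) ω) :=
      ((hmeasM _).pow_const _).mul ((hmeasQ _).const_mul _)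
    have h := lintegral_mono (μ := P) fun ω =>
      ofReal_mul_rpow_mul_le hq1 (runningMax Λ U m ω) (c * factor Λ (U m) ω)
    rw [lintegral_add_left (((hmeasM _).pow_const _).const_mul _),
      lintegral_const_mul _ ((hmeasM _).pow_const _),
      lintegral_const_mul _ hmeasMcQ] at h
    simp only [ENNReal.mul_rpow_of_nonneg _ _ hq0.le] at h
    rw [lintegral_const_mul _ ((hmeasQ _).pow_const _)] at h
    refine le_trans (le_of_eq ?_) h
    congr 1
    rw [hb, ← lintegral_const_mul _ (hmeasMQ _ _)]
    congr 1
    ext ω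
    ring
  have hcb : a m ≤ c * b m := by
    have hne : ENNReal.ofReal (q - 1) ≠ 0 := by simp [hq1]
    have h1 : ENNReal.ofReal (q - 1) * (c * b m) = ENNReal.ofReal q * b m := by
      rw [← mul_assoc, hc, ← ENNReal.ofReal_mul (by linarith),
        mul_div_cancel₀ _ (by linarith : q - 1 ≠ 0)]
    have h2 := hmain m
    rw [← h1] at h2
    exact (ENNReal.mul_le_mul_iff_right hne ENNReal.ofReal_ne_top).1 h2
  have hqa : ENNReal.ofReal q * a m = ENNReal.ofReal (q - 1) * a m + a m := by
    nth_rw 3 [← one_mul (a m)]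
    rw [← add_mul, ← ENNReal.ofReal_one, ← ENNReal.ofReal_add (by linarith) zero_le_one,
      sub_add_cancel]
  have hfin : ENNReal.ofReal (q - 1) * a m ≠ ⊤ :=
    ENNReal.mul_ne_top ENNReal.ofReal_ne_top (hafin m)
  refine (ENNReal.add_le_add_iff_left hfin).1 ?_
  rw [← hqa]
  exact (mul_le_mul_right hcb _).trans hyoung

/-! ### The large intervals -/

/-- The intervals of length at least `1/4` with left end point in `(c, t]`. -/
def enteringSet (c t : ℝ) : Set (ℝ × ℝ) :=
  {z | c < z.1 - z.2 / 2 ∧ z.1 - z.2 / 2 ≤ t ∧ 1 / 4 ≤ z.2}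

/-- The intervals of length at least `1/4` starting before `c`, with right end point in
`(t, c + 1/4]`. -/
def leavingSet (c t : ℝ) : Set (ℝ × ℝ) :=
  {z | z.1 - z.2 / 2 ≤ c ∧ t < z.1 + z.2 / 2 ∧ z.1 + z.2 / 2 ≤ c + 1 / 4 ∧ 1 / 4 ≤ z.2}

/-- The intervals which contain `[c, c + 1/4]` but not `[0, 1]`. -/
def stayingSet (c : ℝ) : Set (ℝ × ℝ) :=
  {z | 0 < z.2 ∧ z.1 - z.2 / 2 ≤ c ∧ c + 1 / 4 < z.1 + z.2 / 2 ∧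
    ¬ (z.1 - z.2 / 2 ≤ 0 ∧ 1 < z.1 + z.2 / 2)}

lemma measurableSet_enteringSet (c t : ℝ) : MeasurableSet (enteringSet c t) := by
  unfold enteringSet
  measurability

lemma measurableSet_leavingSet (c t : ℝ) : MeasurableSet (leavingSet c t) := by
  unfold leavingSet
  measurability

lemma measurableSet_stayingSet (c : ℝ) : MeasurableSet (stayingSet c) := by
  unfold stayingSet
  measurability

lemma hypArea_enteringSet_le {c t : ℝ} (ht : t ≤ c + 1 / 4) :
    hypArea (enteringSet c t) ≤ ENNReal.ofReal 1 := by
  have h := hypArea_le_of_section_le (measurableSet_enteringSet c t) (ε := 1 / 4) (C := 1 / 4)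
    (by norm_num) (fun z hz => hz.2.2) fun y _ => by
      refine (measure_mono (t := Ioc (c + y / 2) (c + 1 / 4 + y / 2)) fun x hx => ?_).trans ?_
      · have h1 : c < x - y / 2 := hx.1
        have h2 : x - y / 2 ≤ t := hx.2.1
        constructor <;> linarith
      · rw [Real.volume_Ioc]
        exact ENNReal.ofReal_le_ofReal (by linarith)
  norm_num at h ⊢
  exact h

lemma hypArea_leavingSet_le {c t : ℝ} (ht : c ≤ t) :
    hypArea (leavingSet c t) ≤ ENNReal.ofReal 1 := by
  have h := hypArea_le_of_section_le (measurableSet_leavingSet c t) (ε := 1 / 4) (C := 1 / 4)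
    (by norm_num) (fun z hz => hz.2.2.2) fun y _ => by
      refine (measure_mono (t := Ioc (c - y / 2) (c + 1 / 4 - y / 2)) fun x hx => ?_).trans ?_
      · have h1 : t < x + y / 2 := hx.2.1
        have h2 : x + y / 2 ≤ c + 1 / 4 := hx.2.2.1
        constructor <;> linarith
      · rw [Real.volume_Ioc]
        exact ENNReal.ofReal_le_ofReal (by linarith)
  norm_num at h ⊢
  exact h

lemma stayingSet_subset {c : ℝ} : stayingSet c ⊆ truncCone (Icc 0 1) (1 / 4) c := by
  rintro z ⟨h1, h2, h3, h4⟩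
  rw [mem_truncCone zero_le_one]
  exact ⟨⟨h1, h2, by linarith⟩, h4, by linarith⟩

lemma enteringSet_mem_finiteAreaSets {c t : ℝ} (ht : t ≤ c + 1 / 4) :
    enteringSet c t ∈ finiteAreaSets :=
  ⟨measurableSet_enteringSet c t, fun z hz => (by norm_num : (0 : ℝ) < 1 / 4).trans_le hz.2.2,
    (hypArea_enteringSet_le ht).trans_lt ENNReal.ofReal_lt_top⟩

lemma leavingSet_mem_finiteAreaSets {c t : ℝ} (ht : c ≤ t) :
    leavingSet c t ∈ finiteAreaSets :=
  ⟨measurableSet_leavingSet c t, fun z hz => (by norm_num : (0 : ℝ) < 1 / 4).trans_le hz.2.2.2,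
    (hypArea_leavingSet_le ht).trans_lt ENNReal.ofReal_lt_top⟩

lemma truncCone_eq_staying_union {c t : ℝ} (hc : c ∈ Icc (0 : ℝ) (3 / 4))
    (ht : t ∈ Icc c (c + 1 / 4)) :
    truncCone (Icc 0 1) (1 / 4) t = stayingSet c ∪ (leavingSet c t ∪ enteringSet c t) := by
  ext z
  rw [mem_truncCone zero_le_one]
  simp only [stayingSet, leavingSet, enteringSet, mem_union, mem_ofPred_eq]
  constructor
  · rintro ⟨⟨h1, h2, h3⟩, h4, h5⟩
    rcases le_or_gt (z.1 - z.2 / 2) c with h | h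
    · rcases lt_or_ge (c + 1 / 4) (z.1 + z.2 / 2) with h' | h'
      · exact Or.inl ⟨h1, h, h', h4⟩
      · exact Or.inr (Or.inl ⟨h, h3, h', h5⟩)
    · exact Or.inr (Or.inr ⟨h, h2, h5⟩)
  · rintro (⟨h1, h2, h3, h4⟩ | ⟨h1, h2, h3, h4⟩ | ⟨h1, h2, h3⟩)
    · exact ⟨⟨h1, by linarith [ht.1], by linarith [ht.2]⟩, h4, by linarith⟩
    · exact ⟨⟨by linarith, by linarith [ht.1], h2⟩, fun h => by linarith [h.2, hc.2], h4⟩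
    · exact ⟨⟨by linarith, h2, by linarith [ht.2]⟩, fun h => by linarith [h.1, hc.1], h3⟩

/-- The bound in the maximal inequality for the large intervals over a stretch of length `1/4`. -/
noncomputable def topConst (Ψ : ℝ → ℝ) (q : ℝ) : ℝ≥0∞ :=
  ENNReal.ofReal (Real.exp (|Ψ q| * 4)) *
    (ENNReal.ofReal (q / (q - 1)) ^ q * ENNReal.ofReal (Real.exp (|Ψ q| * 1))) ^ 2

lemma topConst_ne_top (Ψ : ℝ → ℝ) {q : ℝ} (hq : 1 < q) : topConst Ψ q ≠ ⊤ := by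
  unfold topConst
  refine ENNReal.mul_ne_top ENNReal.ofReal_ne_top (ENNReal.pow_ne_top (ENNReal.mul_ne_top
    (ENNReal.rpow_ne_top_of_nonneg (by linarith) ENNReal.ofReal_ne_top) ENNReal.ofReal_ne_top))

/-- As `t` runs through `[c, c + 1/4]`, the intervals around `t` of length at least `1/4` are the
permanent ones, those which leave and those which enter: three independent contributions, the
last two being martingales in `t`. -/
lemma IsCascadeModel.lintegral_sup_density_rpow_le (hM : IsCascadeModel P ψ Λ Ψ ζ) {c : ℝ}
    (hc : c ∈ Icc (0 : ℝ) (3 / 4)) {t : ℕ → ℝ} (htm : Monotone t)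
    (ht : ∀ j, t j ∈ Icc c (c + 1 / 4)) {q : ℝ} (hq1 : 1 < q) (hqζ : q ≤ ζ) (m : ℕ) :
    ∫⁻ ω, ((Finset.range (m + 1)).sup fun j => density Λ (1 / 4) (t j) ω) ^ q ∂P ≤
      topConst Ψ q := by
  have hq0 : 0 < q := by linarith
  have hΛ := hM.scattered
  have hcI : c ∈ Icc (0 : ℝ) 1 := ⟨hc.1, by linarith [hc.2]⟩
  have hS : stayingSet c ∈ finiteAreaSets :=
    mem_finiteAreaSets_of_subset (truncCone_mem_finiteAreaSets (by norm_num) hcI)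
      (measurableSet_stayingSet c) stayingSet_subset
  let G : ℕ → Set (ℝ × ℝ) := fun j => enteringSet c (t j)
  -- the leaving intervals decrease with `t`: they are listed backwards
  let E : ℕ → Set (ℝ × ℝ) := fun j => leavingSet c (t (m - j))
  have hG : ∀ j, G j ∈ finiteAreaSets := fun j => enteringSet_mem_finiteAreaSets (ht j).2
  have hE : ∀ j, E j ∈ finiteAreaSets := fun j => leavingSet_mem_finiteAreaSets (ht _).1
  have hGm : Monotone G := fun i j hij z hz => ⟨hz.1, hz.2.1.trans (htm hij), hz.2.2⟩
  have hEm : Monotone E := fun i j hij z hz =>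
    ⟨hz.1, (htm (Nat.sub_le_sub_left hij m)).trans_lt hz.2.1, hz.2.2⟩
  let RE : Set (ℝ × ℝ) := {z | z.1 - z.2 / 2 ≤ c ∧ z.1 + z.2 / 2 ≤ c + 1 / 4}
  let RG : Set (ℝ × ℝ) := {z | c < z.1 - z.2 / 2}
  have hER : ∀ j, E j ⊆ RE := fun j z hz => ⟨hz.1, hz.2.2.1⟩
  have hGR : ∀ j, G j ⊆ RG := fun j z hz => hz.1
  have hLR : ∀ j, leavingSet c (t j) ⊆ RE := fun j z hz => ⟨hz.1, hz.2.2.1⟩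
  have hREG : Disjoint RE RG := disjoint_left.2 fun z h1 h2 => not_lt.2 h1.1 h2
  have hSR : Disjoint (stayingSet c) (RE ∪ RG) := by
    refine disjoint_left.2 fun z h1 h2 => ?_
    rcases h2 with h2 | h2
    · exact not_lt.2 h2.2 h1.2.2.1
    · exact not_lt.2 h1.2.1 h2
  have hae : ∀ᵐ ω ∂P, ∀ j, density Λ (1 / 4) (t j) ω = factor Λ (stayingSet c) ω *
      (factor Λ (leavingSet c (t j)) ω * factor Λ (enteringSet c (t j)) ω) := by
    refine ae_all_iff.2 fun j => ?_
    have hEj := leavingSet_mem_finiteAreaSets (ht j).1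
    have h1 := hΛ.factor_union_ae hEj (hG j)
      (hREG.mono (hLR j) (hGR j))
    have h2 := hΛ.factor_union_ae hS (union_mem_finiteAreaSets hEj (hG j))
      (hSR.mono_right (union_subset_union (hLR j) (hGR j)))
    filter_upwards [h1, h2] with ω h1 h2
    rw [density, truncCone_eq_staying_union hc (ht j), h2, h1]
  have hbound : ∀ᵐ ω ∂P, ((Finset.range (m + 1)).sup fun j => density Λ (1 / 4) (t j) ω) ^ q ≤
      factor Λ (stayingSet c) ω ^ q * (runningMax Λ E m ω ^ q * runningMax Λ G m ω ^ q) := by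
    filter_upwards [hae] with ω hω
    rw [← ENNReal.mul_rpow_of_nonneg _ _ hq0.le, ← ENNReal.mul_rpow_of_nonneg _ _ hq0.le]
    refine ENNReal.rpow_le_rpow (Finset.sup_le fun j hj => ?_) hq0.le
    rw [hω j]
    have hj' : j ≤ m := Nat.lt_succ_iff.1 (Finset.mem_range.1 hj)
    gcongr
    · have h := Finset.le_sup (f := fun i => factor Λ (E i) ω)
        (Finset.mem_range.2 (by omega : m - j < m + 1))
      simp only [E, Nat.sub_sub_self hj'] at h
      exact h
    · exact Finset.le_sup (f := fun i => factor Λ (G i) ω) hj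
  have hmE : Measurable[regionSigma Λ RE] (runningMax Λ E m) :=
    measurable_runningMax (fun i _ => hE i) fun i _ => hER i
  have hmG : Measurable[regionSigma Λ RG] (runningMax Λ G m) :=
    measurable_runningMax (fun i _ => hG i) fun i _ => hGR i
  refine (lintegral_mono_ae hbound).trans ?_
  rw [hΛ.lintegral_mul_of_disjoint hSR
      (f := fun ω => factor Λ (stayingSet c) ω ^ q)
      (g := fun ω => runningMax Λ E m ω ^ q * runningMax Λ G m ω ^ q)
      ((measurable_factor_regionSigma hS subset_rfl).pow_const q)
      (((hmE.mono (regionSigma_mono subset_union_left) le_rfl).pow_const q).mul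
        ((hmG.mono (regionSigma_mono subset_union_right) le_rfl).pow_const q)),
    hΛ.lintegral_mul_of_disjoint hREG (f := fun ω => runningMax Λ E m ω ^ q)
      (g := fun ω => runningMax Λ G m ω ^ q) (hmE.pow_const q) (hmG.pow_const q), topConst, pow_two]
  have hqI : q ∈ Icc 0 ζ := ⟨hq0.le, hqζ⟩
  refine mul_le_mul' ?_ (mul_le_mul' ?_ ?_)
  · refine hM.lintegral_factor_rpow_le hS hqI (by norm_num) ((measure_mono stayingSet_subset).trans
      ((hypArea_truncCone_le (by norm_num) hcI).trans (by norm_num)))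
  · refine (hM.lintegral_runningMax_rpow_le hE hEm hq1 hqζ m).trans (mul_le_mul_right ?_ _)
    exact hM.lintegral_factor_rpow_le (hE m) hqI zero_le_one (hypArea_leavingSet_le (ht _).1)
  · refine (hM.lintegral_runningMax_rpow_le hG hGm hq1 hqζ m).trans (mul_le_mul_right ?_ _)
    exact hM.lintegral_factor_rpow_le (hG m) hqI zero_le_one (hypArea_enteringSet_le (ht _).2)

end Model

/-! ### Riemann sums of the cascade and their scaling -/

lemma natCast_div_mem_Icc {a n : ℕ} (h : a ≤ 2 ^ n) : (a : ℝ) / 2 ^ n ∈ Icc (0 : ℝ) 1 := by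
  have : (a : ℝ) ≤ 2 ^ n := by exact_mod_cast h
  exact ⟨by positivity, (div_le_one (by positivity)).2 this⟩

lemma measurable_finset_sup {α ι : Type*} {m : MeasurableSpace α} (s : Finset ι)
    {f : ι → α → ℝ≥0∞} (hf : ∀ i ∈ s, Measurable (f i)) :
    Measurable fun a => s.sup fun i => f i a := by
  classical
  induction s using Finset.induction_on with
  | empty => simp
  | insert i s _ ih =>
    simp only [Finset.sup_insert]
    exact (hf i (by simp)).sup (ih fun j hj => hf j (by simp [hj]))

section Model

variable {Ω : Type*} [MeasurableSpace Ω] {P : Measure Ω} [IsProbabilityMeasure P] {ψ : ℂ → ℂ}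
  {Λ : Set (ℝ × ℝ) → Ω → ℝ} {Ψ : ℝ → ℝ} {ζ : ℝ}

/-- The right end point `(i + 1) / 2^n` of the `i`-th dyadic interval of generation `n`. -/
noncomputable def gridPoint (n i : ℕ) : ℝ := ((i + 1 : ℕ) : ℝ) / 2 ^ n

lemma gridPoint_mem {n i : ℕ} (h : i < 2 ^ n) : gridPoint n i ∈ Icc (0 : ℝ) 1 :=
  natCast_div_mem_Icc (Nat.succ_le_iff.2 h)

/-- The Riemann sum, with mesh `2^{-n}`, of the density at scale `ε` over the `m` dyadic intervals
which follow the `a`-th one, each represented by its right end point. -/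
noncomputable def block (Λ : Set (ℝ × ℝ) → Ω → ℝ) (ε : ℝ) (n a m : ℕ) (ω : Ω) : ℝ≥0∞ :=
  ∑ i ∈ Finset.range m, (2 ^ n)⁻¹ * density Λ ε (gridPoint n (a + i)) ω

lemma block_add (ε : ℝ) (n a m m' : ℕ) (ω : Ω) :
    block Λ ε n a (m + m') ω = block Λ ε n a m ω + block Λ ε n (a + m) m' ω := by
  simp only [block, Finset.sum_range_add, add_assoc]

lemma IsScatteredMeasure.measurable_density (hΛ : IsScatteredMeasure P ψ Λ) {ε t : ℝ}
    (hε : 0 < ε) (ht : t ∈ Icc (0 : ℝ) 1) : Measurable (density Λ ε t) :=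
  hΛ.measurable_factor (truncCone_mem_finiteAreaSets hε ht)

lemma IsScatteredMeasure.measurable_block (hΛ : IsScatteredMeasure P ψ Λ) {ε : ℝ} (hε : 0 < ε)
    {n a m : ℕ} (h : a + m ≤ 2 ^ n) : Measurable (block Λ ε n a m) :=
  Finset.measurable_sum _ fun i hi => (hΛ.measurable_density hε
    (gridPoint_mem (by have := Finset.mem_range.1 hi; omega))).const_mul _

lemma two_pow_inv_ne_top (n : ℕ) : ((2 : ℝ≥0∞) ^ n)⁻¹ ≠ ⊤ := by simp

lemma two_pow_mul_inv (n : ℕ) : (2 : ℝ≥0∞) ^ n * (2 ^ n)⁻¹ = 1 :=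
  ENNReal.mul_inv_cancel (by simp) (by simp)

/-- Scaling for two blocks contained in `[c, c + 1/2]`, `c = a / 2^{n+1}`, jointly. -/
lemma IsScatteredMeasure.lintegral_block_scaling (hΛ : IsScatteredMeasure P ψ Λ) {ε : ℝ}
    (hε0 : 0 < ε) (hε : ε ≤ 1 / 2) {n a b₁ m₁ b₂ m₂ : ℕ} (ha : a ≤ 2 ^ n)
    (h₁ : b₁ + m₁ ≤ 2 ^ n) (h₂ : b₂ + m₂ ≤ 2 ^ n) {g : ℝ≥0∞ → ℝ≥0∞} (hg : Measurable g)
    {F : ℝ≥0∞ → ℝ≥0∞ → ℝ≥0∞} (hF : Measurable (Function.uncurry F)) :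
    ∫⁻ ω, g (factor Λ (halfGap (a / 2 ^ (n + 1))) ω) *
        F (2 * (factor Λ (halfGap (a / 2 ^ (n + 1))) ω)⁻¹ * block Λ ε (n + 1) (a + b₁) m₁ ω)
          (2 * (factor Λ (halfGap (a / 2 ^ (n + 1))) ω)⁻¹ * block Λ ε (n + 1) (a + b₂) m₂ ω) ∂P =
      (∫⁻ ω, g (factor Λ (halfGap (a / 2 ^ (n + 1))) ω) ∂P) *
        ∫⁻ ω, F (block Λ (2 * ε) n b₁ m₁ ω) (block Λ (2 * ε) n b₂ m₂ ω) ∂P := by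
  set c : ℝ := a / 2 ^ (n + 1) with hcdef
  have hc : c ∈ Icc (0 : ℝ) (1 / 2) := by
    have h := natCast_div_mem_Icc ha
    have : c = (a : ℝ) / 2 ^ n / 2 := by rw [hcdef, pow_succ, div_div]
    rw [this]
    constructor <;> linarith [h.1, h.2]
  let τ : Fin m₁ ⊕ Fin m₂ → ℝ :=
    Sum.elim (fun i => gridPoint n (b₁ + i)) fun i => gridPoint n (b₂ + i)
  have hτ : ∀ i, τ i ∈ Icc (0 : ℝ) 1 := by
    rintro (i | i)
    · exact gridPoint_mem (by omega)
    · exact gridPoint_mem (by omega)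
  let G : (Fin m₁ ⊕ Fin m₂ → ℝ≥0∞) → ℝ≥0∞ := fun v =>
    F (∑ i, (2 ^ n)⁻¹ * v (Sum.inl i)) (∑ i, (2 ^ n)⁻¹ * v (Sum.inr i))
  have hG : Measurable G := by
    have : Measurable fun v : Fin m₁ ⊕ Fin m₂ → ℝ≥0∞ =>
        (∑ i, (2 ^ n : ℝ≥0∞)⁻¹ * v (Sum.inl i), ∑ i, (2 ^ n : ℝ≥0∞)⁻¹ * v (Sum.inr i)) := by
      fun_prop
    exact hF.comp this
  have h := hΛ.lintegral_scaling hc hε0 hε hτ hg hG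
  have hpt : ∀ b i : ℕ, c + gridPoint n (b + i) / 2 = gridPoint (n + 1) (a + b + i) := by
    intro b i
    simp only [hcdef, gridPoint]
    push_cast
    field_simp
    ring
  have hpow : ((2 : ℝ≥0∞) ^ n)⁻¹ = 2 * (2 ^ (n + 1))⁻¹ := by
    rw [pow_succ, ENNReal.mul_inv (by simp) (by simp), mul_left_comm,
      ENNReal.mul_inv_cancel (by simp) (by simp), mul_one]
  have hblk : ∀ b m : ℕ, ∀ ω, ∑ i : Fin m, ((2 : ℝ≥0∞) ^ n)⁻¹ *
      ((factor Λ (halfGap c) ω)⁻¹ * density Λ ε (c + gridPoint n (b + i) / 2) ω) =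
      2 * (factor Λ (halfGap c) ω)⁻¹ * block Λ ε (n + 1) (a + b) m ω := by
    intro b m ω
    rw [block, Finset.mul_sum, Finset.sum_range]
    refine Finset.sum_congr rfl fun i _ => ?_
    rw [hpt, hpow]
    ring
  have hblk' : ∀ b m : ℕ, ∀ ω, ∑ i : Fin m, ((2 : ℝ≥0∞) ^ n)⁻¹ *
      density Λ (2 * ε) (gridPoint n (b + i)) ω = block Λ (2 * ε) n b m ω := by
    intro b m ω
    rw [block, Finset.sum_range]
  simp only [G, τ, Sum.elim_inl, Sum.elim_inr, hblk, hblk'] at h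
  exact h

/-- The function `φ` in terms of the log-moment function. -/
noncomputable def structureFun (Ψ : ℝ → ℝ) (q : ℝ) : ℝ := Ψ q - (q - 1)

lemma IsCascadeModel.lintegral_halfGap_rpow (hM : IsCascadeModel P ψ Λ Ψ ζ) {c : ℝ}
    (hc : c ∈ Icc (0 : ℝ) (1 / 2)) {q : ℝ} (hq : q ∈ Icc 0 ζ) :
    ∫⁻ ω, factor Λ (halfGap c) ω ^ q ∂P = 2 ^ Ψ q := by
  have hlog := Real.log_pos one_lt_two
  rw [hM.moment _ (halfGap_mem_finiteAreaSets hc) q hq, hypArea_halfGap hc,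
    ENNReal.toReal_ofReal hlog.le, mul_comm, Real.exp_mul, Real.exp_log two_pos,
    ← ENNReal.ofReal_rpow_of_pos two_pos]
  norm_num

/-- Expectations of `q`-homogeneous functionals of two blocks are multiplied by `2^{φ(q) - 1}` when
`[0, 1]` is replaced by an interval of half the length. -/
lemma IsCascadeModel.lintegral_homogeneous (hM : IsCascadeModel P ψ Λ Ψ ζ) {ε : ℝ}
    (hε0 : 0 < ε) (hε : ε ≤ 1 / 2) {n a b₁ m₁ b₂ m₂ : ℕ} (ha : a ≤ 2 ^ n)
    (h₁ : b₁ + m₁ ≤ 2 ^ n) (h₂ : b₂ + m₂ ≤ 2 ^ n) {q : ℝ} (hq : q ∈ Icc 0 ζ)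
    {F : ℝ≥0∞ → ℝ≥0∞ → ℝ≥0∞} (hF : Measurable (Function.uncurry F))
    (hhom : ∀ c x y : ℝ≥0∞, c ≠ 0 → c ≠ ⊤ → F (c * x) (c * y) = c ^ q * F x y) :
    ∫⁻ ω, F (block Λ ε (n + 1) (a + b₁) m₁ ω) (block Λ ε (n + 1) (a + b₂) m₂ ω) ∂P =
      2 ^ (structureFun Ψ q - 1) *
        ∫⁻ ω, F (block Λ (2 * ε) n b₁ m₁ ω) (block Λ (2 * ε) n b₂ m₂ ω) ∂P := by
  have hc : (a / 2 ^ (n + 1) : ℝ) ∈ Icc (0 : ℝ) (1 / 2) := by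
    have h := natCast_div_mem_Icc ha
    have : (a / 2 ^ (n + 1) : ℝ) = (a : ℝ) / 2 ^ n / 2 := by rw [pow_succ, div_div]
    rw [this]
    constructor <;> linarith [h.1, h.2]
  have h := hM.scattered.lintegral_block_scaling hε0 hε ha h₁ h₂
    (g := fun w => (2⁻¹ * w) ^ q) (by fun_prop) hF
  set W := factor Λ (halfGap (a / 2 ^ (n + 1))) with hW
  have hl : ∀ ω, (2⁻¹ * W ω) ^ q *
      F (2 * (W ω)⁻¹ * block Λ ε (n + 1) (a + b₁) m₁ ω)
        (2 * (W ω)⁻¹ * block Λ ε (n + 1) (a + b₂) m₂ ω) =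
      F (block Λ ε (n + 1) (a + b₁) m₁ ω) (block Λ ε (n + 1) (a + b₂) m₂ ω) := by
    intro ω
    have hW0 : W ω ≠ 0 := factor_ne_zero _ _
    have hWt : W ω ≠ ⊤ := factor_ne_top _ _
    rw [← hhom _ _ _ (mul_ne_zero (by simp) hW0) (ENNReal.mul_ne_top (by simp) hWt)]
    have hcancel : 2⁻¹ * W ω * (2 * (W ω)⁻¹) = 1 := by
      rw [mul_mul_mul_comm, ENNReal.inv_mul_cancel (by simp) (by simp),
        ENNReal.mul_inv_cancel hW0 hWt, one_mul]
    rw [← mul_assoc (2⁻¹ * W ω), ← mul_assoc (2⁻¹ * W ω) (2 * (W ω)⁻¹), hcancel, one_mul, one_mul]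
  simp only [hl] at h
  rw [h]
  congr 1
  simp only [ENNReal.mul_rpow_of_nonneg _ _ hq.1]
  rw [lintegral_const_mul' _ _ (ENNReal.rpow_ne_top_of_nonneg hq.1 (by simp)), hW,
    hM.lintegral_halfGap_rpow hc hq, ENNReal.inv_rpow, ← ENNReal.rpow_neg,
    ← ENNReal.rpow_add _ _ (by simp) (by simp)]
  congr 1
  unfold structureFun
  ring

/-! ### The maximum of the large-interval densities over the grid -/

/-- The largest of the densities at scale `1/4` over the grid of generation `n`. -/
noncomputable def topMax (Λ : Set (ℝ × ℝ) → Ω → ℝ) (n : ℕ) (ω : Ω) : ℝ≥0∞ :=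
  (Finset.range (2 ^ n)).sup fun i => density Λ (1 / 4) (gridPoint n i) ω

lemma IsCascadeModel.lintegral_topMax_rpow_le (hM : IsCascadeModel P ψ Λ Ψ ζ) {q : ℝ}
    (hq1 : 1 < q) (hqζ : q ≤ ζ) (k : ℕ) :
    ∫⁻ ω, topMax Λ (k + 2) ω ^ q ∂P ≤ 4 * topConst Ψ q := by
  have hq0 : 0 < q := by linarith
  have hΛ := hM.scattered
  let t : ℕ → ℕ → ℝ := fun r j => (r : ℝ) / 4 + (min j (2 ^ k) : ℕ) / 2 ^ (k + 2)
  have hpow : (2 : ℝ) ^ (k + 2) = 4 * 2 ^ k := by ring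
  have htmem : ∀ r j : ℕ, t r j ∈ Icc ((r : ℝ) / 4) (r / 4 + 1 / 4) := by
    intro r j
    have h := natCast_div_mem_Icc (min_le_right j (2 ^ k))
    have : ((min j (2 ^ k) : ℕ) : ℝ) / 2 ^ (k + 2) = ((min j (2 ^ k) : ℕ) : ℝ) / 2 ^ k / 4 := by
      rw [hpow, mul_comm, div_div]
    simp only [t, this]
    constructor <;> linarith [h.1, h.2]
  have htmono : ∀ r, Monotone (t r) := by
    intro r i j hij
    simp only [t]
    gcongr
  let M : ℕ → Ω → ℝ≥0∞ := fun r ω =>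
    (Finset.range (2 ^ k + 1)).sup fun j => density Λ (1 / 4) (t r j) ω
  have hle : ∀ ω, topMax Λ (k + 2) ω ≤ (Finset.range 4).sup fun r => M r ω := by
    intro ω
    refine Finset.sup_le fun i hi => ?_
    have hi' : i < 4 * 2 ^ k := by
      have := Finset.mem_range.1 hi
      rw [pow_add] at this
      omega
    have hpos : 0 < 2 ^ k := by positivity
    have hr : i / 2 ^ k < 4 := (Nat.div_lt_iff_lt_mul hpos).2 hi'
    have hj : i % 2 ^ k + 1 ≤ 2 ^ k := Nat.mod_lt _ hpos
    refine le_trans ?_ (Finset.le_sup (f := fun r => M r ω) (Finset.mem_range.2 hr))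
    have hpt : gridPoint (k + 2) i = t (i / 2 ^ k) (i % 2 ^ k + 1) := by
      simp only [gridPoint, t, min_eq_left hj]
      have h := Nat.div_add_mod i (2 ^ k)
      have h' : (i : ℝ) = 2 ^ k * ((i / 2 ^ k : ℕ) : ℝ) + ((i % 2 ^ k : ℕ) : ℝ) := by
        exact_mod_cast h.symm
      rw [hpow, div_add_div _ _ (by norm_num) (by positivity),
        div_eq_div_iff (by positivity) (by positivity)]
      push_cast
      rw [h']
      ring
    rw [hpt]
    exact Finset.le_sup (f := fun j => density Λ (1 / 4) (t (i / 2 ^ k) j) ω)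
      (Finset.mem_range.2 (Nat.lt_succ_of_le hj))
  have hmeas : ∀ r < 4, Measurable (M r) := by
    intro r hr
    have hr' : (r : ℝ) ≤ 3 := by exact_mod_cast Nat.lt_succ_iff.1 hr
    refine measurable_finset_sup _ fun j _ => hΛ.measurable_density (by norm_num) ?_
    have := htmem r j
    have hr0 : (0 : ℝ) ≤ r := by positivity
    exact ⟨by linarith [this.1], by linarith [this.2]⟩
  calc ∫⁻ ω, topMax Λ (k + 2) ω ^ q ∂P
      ≤ ∫⁻ ω, ∑ r ∈ Finset.range 4, M r ω ^ q ∂P := lintegral_mono fun ω =>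
        (ENNReal.rpow_le_rpow (hle ω) hq0.le).trans (finset_sup_rpow_le_sum _ _ hq0)
    _ = ∑ r ∈ Finset.range 4, ∫⁻ ω, M r ω ^ q ∂P :=
        lintegral_finsetSum' _ fun r hr =>
          ((hmeas r (Finset.mem_range.1 hr)).pow_const q).aemeasurable
    _ ≤ ∑ r ∈ Finset.range 4, topConst Ψ q := by
        refine Finset.sum_le_sum fun r hr => ?_
        have hr' : (r : ℝ) ≤ 3 := by exact_mod_cast Nat.lt_succ_iff.1 (Finset.mem_range.1 hr)
        have hr0 : (0 : ℝ) ≤ r := by positivity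
        exact hM.lintegral_sup_density_rpow_le (c := r / 4) ⟨by linarith, by linarith⟩ (htmono r) (htmem r)
          hq1 hqζ (2 ^ k)
    _ = 4 * topConst Ψ q := by simp

end Model

/-! ### Elementary inequalities for powers of sums -/

lemma mul_rpow_self {κ : ℝ} (hκ : 0 ≤ κ) (x : ℝ≥0∞) : x * x ^ κ = x ^ (κ + 1) := by
  nth_rw 1 [← ENNReal.rpow_one x]
  rw [← ENNReal.rpow_add_of_nonneg _ _ zero_le_one hκ, add_comm]

lemma ENNReal_rpow_le_one_add {q : ℝ} (hq0 : 0 ≤ q) (hq1 : q ≤ 1) (x : ℝ≥0∞) : x ^ q ≤ 1 + x := by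
  rcases le_total x 1 with h | h
  · exact (ENNReal.rpow_le_one h hq0).trans le_self_add
  · calc x ^ q ≤ x ^ (1 : ℝ) := ENNReal.rpow_le_rpow_of_exponent_le h hq1
      _ ≤ 1 + x := by rw [ENNReal.rpow_one]; exact le_add_self

/-- A power of a sum, with a coefficient as close to `1` as needed in front of one of the terms. -/
lemma exists_add_rpow_le {κ : ℝ} (hκ : 0 < κ) : ∃ C : ℝ≥0∞, C ≠ ⊤ ∧
    ∀ x y : ℝ≥0∞, (x + y) ^ κ ≤ (3 / 2) * x ^ κ + C * y ^ κ := by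
  have hlim : Tendsto (fun η : ℝ => (1 + η) ^ κ) (𝓝[>] 0) (𝓝 1) := by
    have : ContinuousAt (fun η : ℝ => (1 + η) ^ κ) 0 :=
      ContinuousAt.rpow_const (by fun_prop) (Or.inr hκ.le)
    have h := this.tendsto
    simp only [add_zero, Real.one_rpow] at h
    exact h.mono_left nhdsWithin_le_nhds
  obtain ⟨η, hη, hη0⟩ := ((hlim.eventually (Iio_mem_nhds (by norm_num : (1 : ℝ) < 3 / 2))).and
    self_mem_nhdsWithin).exists
  have hη0 : 0 < η := hη0
  set e : ℝ≥0∞ := ENNReal.ofReal η with he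
  have he0 : e ≠ 0 := by simp [he, hη0]
  have het : e ≠ ⊤ := ENNReal.ofReal_ne_top
  have h32 : (1 + e) ^ κ ≤ 3 / 2 := by
    rw [he, ← ENNReal.ofReal_one, ← ENNReal.ofReal_add zero_le_one hη0.le,
      ENNReal.ofReal_rpow_of_pos (by positivity)]
    refine (ENNReal.ofReal_le_ofReal (le_of_lt hη)).trans (le_of_eq ?_)
    rw [ENNReal.ofReal_div_of_pos two_pos]
    norm_num
  refine ⟨(1 + e⁻¹) ^ κ, ENNReal.rpow_ne_top_of_nonneg hκ.le
    (ENNReal.add_ne_top.2 ⟨by simp, by simp [he0]⟩), fun x y => ?_⟩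
  rcases le_total y (e * x) with h | h
  · calc (x + y) ^ κ ≤ ((1 + e) * x) ^ κ := by
          refine ENNReal.rpow_le_rpow ?_ hκ.le
          rw [add_mul, one_mul]
          gcongr
      _ = (1 + e) ^ κ * x ^ κ := ENNReal.mul_rpow_of_nonneg _ _ hκ.le
      _ ≤ (3 / 2) * x ^ κ := by gcongr
      _ ≤ _ := le_self_add
  · calc (x + y) ^ κ ≤ ((1 + e⁻¹) * y) ^ κ := by
          refine ENNReal.rpow_le_rpow ?_ hκ.le
          rw [add_mul, one_mul, add_comm]
          gcongr
          calc x = e⁻¹ * (e * x) := by rw [← mul_assoc, ENNReal.inv_mul_cancel he0 het, one_mul]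
            _ ≤ e⁻¹ * y := by gcongr
      _ = (1 + e⁻¹) ^ κ * y ^ κ := ENNReal.mul_rpow_of_nonneg _ _ hκ.le
      _ ≤ _ := le_add_self

/-- The symmetrized product `x y^κ + y x^κ`. -/
noncomputable def crossFun (κ : ℝ) (x y : ℝ≥0∞) : ℝ≥0∞ := x * y ^ κ + y * x ^ κ

lemma measurable_crossFun (κ : ℝ) : Measurable (Function.uncurry (crossFun κ)) := by
  unfold crossFun Function.uncurry
  fun_prop

lemma crossFun_mul {κ : ℝ} (hκ : 0 ≤ κ) (c x y : ℝ≥0∞) :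
    crossFun κ (c * x) (c * y) = c ^ (κ + 1) * crossFun κ x y := by
  unfold crossFun
  rw [ENNReal.mul_rpow_of_nonneg _ _ hκ, ENNReal.mul_rpow_of_nonneg _ _ hκ,
    ← mul_rpow_self hκ c]
  ring

lemma crossFun_le {κ : ℝ} (hκ : 0 ≤ κ) (x y : ℝ≥0∞) :
    crossFun κ x y ≤ 2 * (x + y) ^ (κ + 1) := by
  rw [← mul_rpow_self hκ, crossFun, two_mul]
  gcongr
  · exact le_self_add
  · exact le_add_self
  · exact le_add_self
  · exact le_self_add

lemma add_rpow_le_add_crossFun {κ : ℝ} (hκ : 0 ≤ κ) (x y : ℝ≥0∞) :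
    (x + y) ^ (κ + 1) ≤ x ^ (κ + 1) + y ^ (κ + 1) + 2 ^ (κ + 1) * crossFun κ x y := by
  have key : ∀ x y : ℝ≥0∞, x ≤ y →
      (x + y) ^ (κ + 1) ≤ y ^ (κ + 1) + 2 ^ (κ + 1) * (x * y ^ κ) := by
    intro x y hxy
    rcases eq_or_ne y 0 with rfl | hy0
    · rw [nonpos_iff_eq_zero.1 hxy]
      simp
    rcases eq_or_ne y ⊤ with rfl | hyt
    · rw [ENNReal.top_rpow_of_pos (by linarith), top_add]
      exact le_top
    -- `x + y` is the convex combination of `y` and `2 y` with weight `x / y`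
    set t := x / y with ht
    have ht1 : t ≤ 1 := ENNReal.div_le_of_le_mul (by rwa [one_mul])
    have hxt : x = t * y := (ENNReal.div_mul_cancel hy0 hyt).symm
    have hw : (1 - t) + t = 1 := tsub_add_cancel_of_le ht1
    have h := ENNReal.rpow_arith_mean_le_arith_mean2_rpow (1 - t) t y (2 * y) hw
      (by linarith : 1 ≤ κ + 1)
    have e : (1 - t) * y + t * (2 * y) = x + y := by
      calc (1 - t) * y + t * (2 * y) = ((1 - t) + t) * y + t * y := by ring
        _ = x + y := by rw [hw, one_mul, ← hxt, add_comm]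
    rw [e] at h
    refine h.trans (add_le_add ?_ (le_of_eq ?_))
    · exact mul_le_of_le_one_left zero_le tsub_le_self
    · rw [ENNReal.mul_rpow_of_nonneg _ _ (by linarith), ← mul_rpow_self hκ y]
      calc t * (2 ^ (κ + 1) * (y * y ^ κ)) = 2 ^ (κ + 1) * (t * y * y ^ κ) := by ring
        _ = 2 ^ (κ + 1) * (x * y ^ κ) := by rw [← hxt]
  rcases le_total x y with h | h
  · refine (key x y h).trans ?_
    rw [crossFun]
    gcongr
    · exact le_add_self
    · exact le_self_add
  · rw [add_comm x y]
    refine (key y x h).trans ?_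
    rw [crossFun]
    gcongr
    · exact le_self_add
    · exact le_add_self

lemma grid_average_rpow_le {q : ℝ} (hq : 1 ≤ q) (n : ℕ) (x : ℕ → ℝ≥0∞) :
    (∑ i ∈ Finset.range (2 ^ n), (2 ^ n)⁻¹ * x i) ^ q ≤
      ∑ i ∈ Finset.range (2 ^ n), (2 ^ n)⁻¹ * x i ^ q := by
  refine ENNReal.rpow_arith_mean_le_arith_mean_rpow _ _ _ ?_ hq
  rw [Finset.sum_const, Finset.card_range, nsmul_eq_mul]
  push_cast
  exact two_pow_mul_inv n

lemma sum_grid_const (n : ℕ) (c : ℝ≥0∞) :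
    ∑ _i ∈ Finset.range (2 ^ n), (2 ^ n)⁻¹ * c = c := by
  rw [Finset.sum_const, Finset.card_range, nsmul_eq_mul, ← mul_assoc]
  push_cast
  rw [two_pow_mul_inv, one_mul]

section Model

variable {Ω : Type*} [MeasurableSpace Ω] {P : Measure Ω} [IsProbabilityMeasure P] {ψ : ℂ → ℂ}
  {Λ : Set (ℝ × ℝ) → Ω → ℝ} {Ψ : ℝ → ℝ} {ζ : ℝ}

/-! ### The small intervals -/

/-- The intervals around `t` of length in `[ε, 1/4)`. -/
def lowCone (ε t : ℝ) : Set (ℝ × ℝ) := cone t ∩ {z | ε ≤ z.2 ∧ z.2 < 1 / 4}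

lemma mem_lowCone {ε t : ℝ} {z : ℝ × ℝ} : z ∈ lowCone ε t ↔
    (0 < z.2 ∧ z.1 - z.2 / 2 ≤ t ∧ t < z.1 + z.2 / 2) ∧ ε ≤ z.2 ∧ z.2 < 1 / 4 := by
  rw [lowCone, mem_inter_iff, mem_cone]
  rfl

lemma measurableSet_lowCone (ε t : ℝ) : MeasurableSet (lowCone ε t) :=
  (measurableSet_cone t).inter (MeasurableSet.inter
    (measurableSet_le measurable_const measurable_snd)
    (measurableSet_lt measurable_snd measurable_const))

lemma truncCone_eq_lowCone_union {ε t : ℝ} (hε : ε ≤ 1 / 4) :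
    truncCone (Icc 0 1) ε t = truncCone (Icc 0 1) (1 / 4) t ∪ lowCone ε t := by
  ext z
  rw [mem_union, mem_truncCone zero_le_one, mem_truncCone zero_le_one, mem_lowCone]
  constructor
  · rintro ⟨h1, h2, h3⟩
    rcases le_or_gt (1 / 4) z.2 with h | h
    · exact Or.inl ⟨h1, h2, h⟩
    · exact Or.inr ⟨h1, h3, h⟩
  · rintro (⟨h1, h2, h3⟩ | ⟨h1, h2, h3⟩)
    · exact ⟨h1, h2, hε.trans h3⟩
    · exact ⟨h1, fun h => by linarith [h.1, h.2], h2⟩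

lemma lowCone_mem_finiteAreaSets {ε t : ℝ} (hε0 : 0 < ε) (hε : ε ≤ 1 / 4)
    (ht : t ∈ Icc (0 : ℝ) 1) : lowCone ε t ∈ finiteAreaSets :=
  mem_finiteAreaSets_of_subset (truncCone_mem_finiteAreaSets hε0 ht) (measurableSet_lowCone ε t)
    (by rw [truncCone_eq_lowCone_union hε]; exact subset_union_right)

lemma IsScatteredMeasure.density_eq_ae (hΛ : IsScatteredMeasure P ψ Λ) {ε t : ℝ} (hε0 : 0 < ε)
    (hε : ε ≤ 1 / 4) (ht : t ∈ Icc (0 : ℝ) 1) :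
    ∀ᵐ ω ∂P, density Λ ε t ω = density Λ (1 / 4) t ω * factor Λ (lowCone ε t) ω := by
  rw [density, truncCone_eq_lowCone_union hε]
  refine hΛ.factor_union_ae (truncCone_mem_finiteAreaSets (by norm_num) ht)
    (lowCone_mem_finiteAreaSets hε0 hε ht) (disjoint_left.2 fun z h1 h2 => ?_)
  exact not_lt.2 ((mem_truncCone zero_le_one).1 h1).2.2 (mem_lowCone.1 h2).2.2

/-- The Riemann sum over `[0, 1]` of the factors of the small intervals. -/
noncomputable def lowSum (Λ : Set (ℝ × ℝ) → Ω → ℝ) (ε : ℝ) (n : ℕ) (ω : Ω) : ℝ≥0∞ :=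
  ∑ i ∈ Finset.range (2 ^ n), (2 ^ n)⁻¹ * factor Λ (lowCone ε (gridPoint n i)) ω

lemma measurable_lowSum {ε : ℝ} (hε0 : 0 < ε) (hε : ε ≤ 1 / 4) (n : ℕ) :
    Measurable[regionSigma Λ {z | z.2 < 1 / 4}] (lowSum Λ ε n) :=
  Finset.measurable_sum _ fun _ hi => (measurable_factor_regionSigma
    (lowCone_mem_finiteAreaSets hε0 hε (gridPoint_mem (Finset.mem_range.1 hi)))
    fun _ hz => (mem_lowCone.1 hz).2.2).const_mul _

lemma measurable_density_quarter {n i : ℕ} (hi : i < 2 ^ n) :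
    Measurable[regionSigma Λ {z | 1 / 4 ≤ z.2}] (density Λ (1 / 4) (gridPoint n i)) :=
  measurable_factor_regionSigma (truncCone_mem_finiteAreaSets (by norm_num) (gridPoint_mem hi))
    fun _ hz => hz.2

lemma disjoint_high_low : Disjoint {z : ℝ × ℝ | 1 / 4 ≤ z.2} {z : ℝ × ℝ | z.2 < 1 / 4} :=
  disjoint_left.2 fun z (h1 : 1 / 4 ≤ z.2) (h2 : z.2 < 1 / 4) => not_lt.2 h1 h2

lemma IsCascadeModel.lintegral_lowSum (hM : IsCascadeModel P ψ Λ Ψ ζ) {ε : ℝ} (hε0 : 0 < ε)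
    (hε : ε ≤ 1 / 4) (n : ℕ) : ∫⁻ ω, lowSum Λ ε n ω ∂P = 1 := by
  unfold lowSum
  have hmem : ∀ i ∈ Finset.range (2 ^ n), lowCone ε (gridPoint n i) ∈ finiteAreaSets :=
    fun i hi => lowCone_mem_finiteAreaSets hε0 hε (gridPoint_mem (Finset.mem_range.1 hi))
  rw [lintegral_finsetSum' _ fun i hi =>
    ((hM.scattered.measurable_factor (hmem i hi)).const_mul _).aemeasurable,
    Finset.sum_congr rfl (g := fun _ => (2 ^ n)⁻¹ * 1), sum_grid_const]
  intro i hi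
  rw [lintegral_const_mul' _ _ (two_pow_inv_ne_top n), hM.lintegral_factor (hmem i hi)]

lemma IsCascadeModel.lintegral_block (hM : IsCascadeModel P ψ Λ Ψ ζ) {ε : ℝ} (hε0 : 0 < ε)
    {n a m : ℕ} (h : a + m ≤ 2 ^ n) : ∫⁻ ω, block Λ ε n a m ω ∂P = m * (2 ^ n)⁻¹ := by
  unfold block
  have hmem : ∀ i ∈ Finset.range m, gridPoint n (a + i) ∈ Icc (0 : ℝ) 1 :=
    fun i hi => gridPoint_mem (by have := Finset.mem_range.1 hi; omega)
  rw [lintegral_finsetSum' _ fun i hi =>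
    ((hM.scattered.measurable_density hε0 (hmem i hi)).const_mul _).aemeasurable,
    Finset.sum_congr rfl (g := fun _ => (2 ^ n)⁻¹), Finset.sum_const, Finset.card_range,
    nsmul_eq_mul]
  intro i hi
  rw [lintegral_const_mul' _ _ (two_pow_inv_ne_top n), density,
    hM.lintegral_factor (truncCone_mem_finiteAreaSets hε0 (hmem i hi)), mul_one]

/-- The moments of order at least `1` of the small-interval sums are at most those of the full
sums: conditionally on the small intervals, Jensen's inequality applies to the large ones. In
tangent form, `κ w^{κ-1} x ≤ (κ - 1) w^κ + x^κ`. -/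
lemma IsCascadeModel.lintegral_lowSum_rpow_le (hM : IsCascadeModel P ψ Λ Ψ ζ) {ε : ℝ}
    (hε0 : 0 < ε) (hε : ε ≤ 1 / 4) (n : ℕ) {κ : ℝ} (hκ1 : 1 < κ) (hκζ : κ ≤ ζ) :
    ∫⁻ ω, lowSum Λ ε n ω ^ κ ∂P ≤ ∫⁻ ω, block Λ ε n 0 (2 ^ n) ω ^ κ ∂P := by
  have hΛ := hM.scattered
  have hκ0 : 0 < κ := by linarith
  set s := Finset.range (2 ^ n) with hs
  have hg : ∀ i ∈ s, gridPoint n i ∈ Icc (0 : ℝ) 1 := fun i hi =>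
    gridPoint_mem (Finset.mem_range.1 hi)
  have hlow : ∀ i ∈ s, lowCone ε (gridPoint n i) ∈ finiteAreaSets := fun i hi =>
    lowCone_mem_finiteAreaSets hε0 hε (hg i hi)
  have hmlow : Measurable (lowSum Λ ε n) :=
    (measurable_lowSum hε0 hε n).mono (hΛ.regionSigma_le _) le_rfl
  set a := ∫⁻ ω, lowSum Λ ε n ω ^ κ ∂P with ha
  have hafin : a ≠ ⊤ := by
    refine ne_top_of_le_ne_top ?_ (lintegral_mono fun ω => grid_average_rpow_le hκ1.le n _)
    rw [lintegral_finsetSum' _ fun i hi =>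
      (((hΛ.measurable_factor (hlow i hi)).pow_const κ).const_mul _).aemeasurable]
    refine ENNReal.sum_ne_top.2 fun i hi => ?_
    rw [lintegral_const_mul' _ _ (two_pow_inv_ne_top n), hM.moment _ (hlow i hi) κ ⟨hκ0.le, hκζ⟩]
    exact ENNReal.mul_ne_top (two_pow_inv_ne_top n) ENNReal.ofReal_ne_top
  have hblock : ∀ᵐ ω ∂P, block Λ ε n 0 (2 ^ n) ω = ∑ i ∈ s, (2 ^ n)⁻¹ *
      (factor Λ (lowCone ε (gridPoint n i)) ω * density Λ (1 / 4) (gridPoint n i) ω) := by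
    have : ∀ᵐ ω ∂P, ∀ i ∈ s, density Λ ε (gridPoint n i) ω =
        density Λ (1 / 4) (gridPoint n i) ω * factor Λ (lowCone ε (gridPoint n i)) ω :=
      (ae_ball_iff s.countable_toSet).2 fun i hi => hΛ.density_eq_ae hε0 hε (hg i hi)
    filter_upwards [this] with ω hω
    refine Finset.sum_congr rfl fun i hi => ?_
    rw [zero_add, hω i hi, mul_comm (density Λ (1 / 4) _ ω)]
  have hcross : ∫⁻ ω, lowSum Λ ε n ω ^ (κ - 1) * block Λ ε n 0 (2 ^ n) ω ∂P = a := by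
    have hmlow' : ∀ i ∈ s, Measurable[regionSigma Λ {z | z.2 < 1 / 4}] fun ω =>
        lowSum Λ ε n ω ^ (κ - 1) * ((2 ^ n)⁻¹ * factor Λ (lowCone ε (gridPoint n i)) ω) :=
      fun i hi => Measurable.mul ((measurable_lowSum hε0 hε n).pow_const _)
        ((measurable_factor_regionSigma (hlow i hi)
          fun _ hz => (mem_lowCone.1 hz).2.2).const_mul _)
    calc ∫⁻ ω, lowSum Λ ε n ω ^ (κ - 1) * block Λ ε n 0 (2 ^ n) ω ∂P
        = ∫⁻ ω, ∑ i ∈ s, lowSum Λ ε n ω ^ (κ - 1) *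
            ((2 ^ n)⁻¹ * factor Λ (lowCone ε (gridPoint n i)) ω) *
              density Λ (1 / 4) (gridPoint n i) ω ∂P := by
          refine lintegral_congr_ae ?_
          filter_upwards [hblock] with ω hω
          rw [hω, Finset.mul_sum]
          exact Finset.sum_congr rfl fun i _ => by ring
      _ = ∑ i ∈ s, ∫⁻ ω, lowSum Λ ε n ω ^ (κ - 1) *
            ((2 ^ n)⁻¹ * factor Λ (lowCone ε (gridPoint n i)) ω) *
              density Λ (1 / 4) (gridPoint n i) ω ∂P := by
          refine lintegral_finsetSum' _ fun i hi => Measurable.aemeasurable ?_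
          exact ((hmlow' i hi).mono (hΛ.regionSigma_le _) le_rfl).mul
            (hΛ.measurable_density (by norm_num) (hg i hi))
      _ = ∑ i ∈ s, ∫⁻ ω, lowSum Λ ε n ω ^ (κ - 1) *
            ((2 ^ n)⁻¹ * factor Λ (lowCone ε (gridPoint n i)) ω) ∂P := by
          refine Finset.sum_congr rfl fun i hi => ?_
          refine hM.lintegral_mul_factor (truncCone_mem_finiteAreaSets (by norm_num) (hg i hi))
            ?_ (hmlow' i hi)
          exact disjoint_high_low.symm.mono_right fun z hz => hz.2
      _ = a := by
          rw [← lintegral_finsetSum' _ fun i hi =>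
            ((hmlow' i hi).mono (hΛ.regionSigma_le _) le_rfl).aemeasurable]
          refine lintegral_congr fun ω => ?_
          rw [← Finset.mul_sum]
          change lowSum Λ ε n ω ^ (κ - 1) * lowSum Λ ε n ω = _
          rw [mul_comm, mul_rpow_self (by linarith), sub_add_cancel]
  have hmblock : Measurable (block Λ ε n 0 (2 ^ n)) := hΛ.measurable_block hε0 (by simp)
  have h := lintegral_mono (μ := P) fun ω =>
    ofReal_mul_rpow_mul_le hκ1 (lowSum Λ ε n ω) (block Λ ε n 0 (2 ^ n) ω)
  rw [lintegral_const_mul' _ _ ENNReal.ofReal_ne_top, hcross,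
    lintegral_add_left ((hmlow.pow_const _).const_mul _),
    lintegral_const_mul' _ _ ENNReal.ofReal_ne_top] at h
  have hqa : ENNReal.ofReal κ * a = ENNReal.ofReal (κ - 1) * a + a := by
    nth_rw 3 [← one_mul a]
    rw [← add_mul, ← ENNReal.ofReal_one, ← ENNReal.ofReal_add (by linarith) zero_le_one,
      sub_add_cancel]
  rw [hqa] at h
  exact (ENNReal.add_le_add_iff_left (ENNReal.mul_ne_top ENNReal.ofReal_ne_top hafin)).1 h

/-! ### Products over separated sets -/

/-- A density at one grid point times a power of the sum over grid points at distance at least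
`1/4`: only intervals of length at least `1/4` are shared. -/
lemma IsCascadeModel.lintegral_density_mul_sum_rpow_le (hM : IsCascadeModel P ψ Λ Ψ ζ) {ε : ℝ}
    (hε0 : 0 < ε) (hε : ε ≤ 1 / 4) {n i₀ : ℕ} (hi₀ : i₀ < 2 ^ n) {T : Finset ℕ}
    (hT : T ⊆ Finset.range (2 ^ n))
    (hsep : ∀ i ∈ T, 1 / 4 ≤ |gridPoint n i - gridPoint n i₀|) {κ : ℝ} (hκ : 0 < κ) :
    ∫⁻ ω, density Λ ε (gridPoint n i₀) ω *
        (∑ i ∈ T, (2 ^ n)⁻¹ * density Λ ε (gridPoint n i) ω) ^ κ ∂P ≤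
      (∫⁻ ω, topMax Λ n ω ^ (κ + 1) ∂P) * ∫⁻ ω, lowSum Λ ε n ω ^ κ ∂P := by
  have hΛ := hM.scattered
  have hg : ∀ i ∈ Finset.range (2 ^ n), gridPoint n i ∈ Icc (0 : ℝ) 1 := fun i hi =>
    gridPoint_mem (Finset.mem_range.1 hi)
  have hlow : ∀ i ∈ Finset.range (2 ^ n), lowCone ε (gridPoint n i) ∈ finiteAreaSets :=
    fun i hi => lowCone_mem_finiteAreaSets hε0 hε (hg i hi)
  have hi₀' := Finset.mem_range.2 hi₀
  let A : Ω → ℝ≥0∞ := fun ω => ∑ i ∈ T, (2 ^ n)⁻¹ * factor Λ (lowCone ε (gridPoint n i)) ω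
  have hdec : ∀ᵐ ω ∂P, ∀ i ∈ Finset.range (2 ^ n), density Λ ε (gridPoint n i) ω =
      density Λ (1 / 4) (gridPoint n i) ω * factor Λ (lowCone ε (gridPoint n i)) ω :=
    (ae_ball_iff (Finset.countable_toSet _)).2 fun i hi => hΛ.density_eq_ae hε0 hε (hg i hi)
  have htop : ∀ i ∈ Finset.range (2 ^ n), ∀ ω,
      density Λ (1 / 4) (gridPoint n i) ω ≤ topMax Λ n ω := fun i hi ω =>
    Finset.le_sup (f := fun i => density Λ (1 / 4) (gridPoint n i) ω) hi
  have hbound : ∀ᵐ ω ∂P, density Λ ε (gridPoint n i₀) ω *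
      (∑ i ∈ T, (2 ^ n)⁻¹ * density Λ ε (gridPoint n i) ω) ^ κ ≤
      topMax Λ n ω ^ (κ + 1) * A ω ^ κ * factor Λ (lowCone ε (gridPoint n i₀)) ω := by
    filter_upwards [hdec] with ω hω
    have h1 : ∑ i ∈ T, (2 ^ n)⁻¹ * density Λ ε (gridPoint n i) ω ≤ topMax Λ n ω * A ω := by
      rw [Finset.mul_sum]
      refine Finset.sum_le_sum fun i hi => ?_
      rw [hω i (hT hi), mul_left_comm]
      gcongr
      exact htop i (hT hi) ω
    rw [hω i₀ hi₀']
    calc _ ≤ topMax Λ n ω * factor Λ (lowCone ε (gridPoint n i₀)) ω *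
          (topMax Λ n ω * A ω) ^ κ := by
          gcongr
          exact htop i₀ hi₀' ω
      _ = _ := by
          rw [ENNReal.mul_rpow_of_nonneg _ _ hκ.le, ← mul_rpow_self hκ.le]
          ring
  have hmtop : Measurable[regionSigma Λ {z | 1 / 4 ≤ z.2}] (topMax Λ n) :=
    measurable_finset_sup _ fun i hi => measurable_density_quarter (Finset.mem_range.1 hi)
  have hmA : ∀ R : Set (ℝ × ℝ), (∀ i ∈ T, lowCone ε (gridPoint n i) ⊆ R) →
      Measurable[regionSigma Λ R] A := fun R hR =>
    Finset.measurable_sum _ fun i hi =>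
      (measurable_factor_regionSigma (hlow i (hT hi)) (hR i hi)).const_mul _
  refine (lintegral_mono_ae hbound).trans ?_
  rw [hM.lintegral_mul_factor (R := (lowCone ε (gridPoint n i₀))ᶜ) (hlow i₀ hi₀')
    disjoint_compl_left]
  · rw [hΛ.lintegral_mul_of_disjoint disjoint_high_low (f := fun ω => topMax Λ n ω ^ (κ + 1))
      (g := fun ω => A ω ^ κ) (hmtop.pow_const _)
      ((hmA _ fun i _ z hz => (mem_lowCone.1 hz).2.2).pow_const _)]
    gcongr with ω
    exact Finset.sum_le_sum_of_subset hT
  · refine Measurable.mul (Measurable.pow_const (hmtop.mono (regionSigma_mono ?_) le_rfl) _)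
      (Measurable.pow_const (hmA _ fun i hi => ?_) _)
    · exact fun z h1 h2 => not_lt.2 h1 (mem_lowCone.1 h2).2.2
    · intro z h1 h2
      have h1' := mem_lowCone.1 h1
      have h2' := mem_lowCone.1 h2
      have := hsep i hi
      rcases le_abs'.1 this with h | h <;>
        linarith [h1'.1.2.1, h1'.1.2.2, h2'.1.2.1, h2'.1.2.2, h1'.2.2]

lemma IsCascadeModel.lintegral_block_mul_block_rpow_le (hM : IsCascadeModel P ψ Λ Ψ ζ) {ε : ℝ}
    (hε0 : 0 < ε) (hε : ε ≤ 1 / 4) {n a m b m' : ℕ} (ha : a + m ≤ 2 ^ n) (hb : b + m' ≤ 2 ^ n)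
    (hsep : ∀ i < m, ∀ j < m', 1 / 4 ≤ |gridPoint n (b + j) - gridPoint n (a + i)|)
    {κ : ℝ} (hκ : 0 < κ) :
    ∫⁻ ω, block Λ ε n a m ω * block Λ ε n b m' ω ^ κ ∂P ≤
      (∫⁻ ω, topMax Λ n ω ^ (κ + 1) ∂P) * ∫⁻ ω, lowSum Λ ε n ω ^ κ ∂P := by
  have hΛ := hM.scattered
  have hmb := hΛ.measurable_block hε0 hb
  have hma : ∀ i ∈ Finset.range m, Measurable (density Λ ε (gridPoint n (a + i))) := fun i hi =>
    hΛ.measurable_density hε0 (gridPoint_mem (by have := Finset.mem_range.1 hi; omega))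
  have hbl : ∀ ω, block Λ ε n b m' ω = ∑ i ∈ (Finset.range m').map (addLeftEmbedding b),
      (2 ^ n)⁻¹ * density Λ ε (gridPoint n i) ω := by
    intro ω
    rw [Finset.sum_map]
    rfl
  calc ∫⁻ ω, block Λ ε n a m ω * block Λ ε n b m' ω ^ κ ∂P
      = ∑ i ∈ Finset.range m, (2 ^ n)⁻¹ * ∫⁻ ω, density Λ ε (gridPoint n (a + i)) ω *
          block Λ ε n b m' ω ^ κ ∂P := by
        simp only [block.eq_def Λ ε n a m, Finset.sum_mul, mul_assoc]
        have hmeas : ∀ i ∈ Finset.range m, Measurable fun ω =>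
            (2 ^ n : ℝ≥0∞)⁻¹ * (density Λ ε (gridPoint n (a + i)) ω * block Λ ε n b m' ω ^ κ) :=
          fun i hi => ((hma i hi).mul (hmb.pow_const κ)).const_mul _
        rw [lintegral_finsetSum' _ fun i hi => (hmeas i hi).aemeasurable]
        exact Finset.sum_congr rfl fun i hi => lintegral_const_mul' _ _ (two_pow_inv_ne_top n)
    _ ≤ ∑ i ∈ Finset.range m, (2 ^ n)⁻¹ * ((∫⁻ ω, topMax Λ n ω ^ (κ + 1) ∂P) *
          ∫⁻ ω, lowSum Λ ε n ω ^ κ ∂P) := by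
        refine Finset.sum_le_sum fun i hi => mul_le_mul_right ?_ _
        simp only [hbl]
        refine hM.lintegral_density_mul_sum_rpow_le hε0 hε
          (by have := Finset.mem_range.1 hi; omega) ?_ ?_ hκ
        · intro j hj
          simp only [Finset.mem_map, Finset.mem_range, addLeftEmbedding_apply] at hj ⊢
          obtain ⟨j, hj, rfl⟩ := hj
          omega
        · intro j hj
          simp only [Finset.mem_map, Finset.mem_range, addLeftEmbedding_apply] at hj
          obtain ⟨j, hj, rfl⟩ := hj
          exact hsep i (Finset.mem_range.1 hi) j hj
    _ ≤ ∑ i ∈ Finset.range (2 ^ n), (2 ^ n)⁻¹ * ((∫⁻ ω, topMax Λ n ω ^ (κ + 1) ∂P) *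
          ∫⁻ ω, lowSum Λ ε n ω ^ κ ∂P) :=
        Finset.sum_le_sum_of_subset (Finset.range_subset_range.2 (by omega))
    _ = _ := sum_grid_const n _

end Model

section Model

variable {Ω : Type*} [MeasurableSpace Ω] {P : Measure Ω} [IsProbabilityMeasure P] {ψ : ℂ → ℂ}
  {Λ : Set (ℝ × ℝ) → Ω → ℝ} {Ψ : ℝ → ℝ} {ζ : ℝ}

/-! ### Uniform bounds for the moments and for the cross moment -/

lemma IsCascadeModel.lintegral_block_rpow_le_of_quarter_le (hM : IsCascadeModel P ψ Λ Ψ ζ)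
    {ε : ℝ} (hε : 1 / 4 ≤ ε) (n : ℕ) {q : ℝ} (hq1 : 1 ≤ q) (hqζ : q ≤ ζ) :
    ∫⁻ ω, block Λ ε n 0 (2 ^ n) ω ^ q ∂P ≤ ENNReal.ofReal (Real.exp (|Ψ q| * 4)) := by
  have hε0 : 0 < ε := by linarith
  have hg : ∀ i ∈ Finset.range (2 ^ n), gridPoint n (0 + i) ∈ Icc (0 : ℝ) 1 := fun i hi =>
    gridPoint_mem (by have := Finset.mem_range.1 hi; omega)
  refine (lintegral_mono fun ω => grid_average_rpow_le hq1 n _).trans ?_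
  rw [lintegral_finsetSum' _ fun i hi =>
    (((hM.scattered.measurable_density hε0 (hg i hi)).pow_const q).const_mul _).aemeasurable,
    ← sum_grid_const n (ENNReal.ofReal (Real.exp (|Ψ q| * 4)))]
  refine Finset.sum_le_sum fun i hi => ?_
  rw [lintegral_const_mul' _ _ (two_pow_inv_ne_top n)]
  refine mul_le_mul_right ?_ _
  refine hM.lintegral_factor_rpow_le (truncCone_mem_finiteAreaSets hε0 (hg i hi))
    ⟨by linarith, hqζ⟩ (by norm_num) ((hypArea_truncCone_le hε0 (hg i hi)).trans ?_)
  refine ENNReal.ofReal_le_ofReal ?_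
  rw [div_le_iff₀ hε0]
  linarith

lemma quarter_le_abs_gridPoint_sub {k i j : ℕ} (h : i + 2 ^ k ≤ j) :
    1 / 4 ≤ |gridPoint (k + 2) j - gridPoint (k + 2) i| := by
  refine le_trans ?_ (le_abs_self _)
  have h' : (i : ℝ) + 2 ^ k ≤ j := by exact_mod_cast h
  rw [gridPoint, gridPoint, ← sub_div, le_div_iff₀ (by positivity), pow_add]
  push_cast
  linarith

/-- The cross moment of the two halves is bounded uniformly in the scale. Pairs of separated
quarters have bounded cross moments, and the pair of adjacent quarters in the middle is a copy of
the two halves, reduced by the factor `2^{φ(κ + 1) - 1} ≤ 1/2`. -/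
lemma IsCascadeModel.exists_lintegral_crossFun_le_of_lowSum (hM : IsCascadeModel P ψ Λ Ψ ζ)
    {κ : ℝ} (hκ : 0 < κ) (hκζ : κ + 1 ≤ ζ) (hφ : structureFun Ψ (κ + 1) ≤ 0) {L : ℝ≥0∞}
    (hL : L ≠ ⊤) (hlow : ∀ (n : ℕ) (ε : ℝ), 0 < ε → ε ≤ 1 / 4 → 1 ≤ 2 ^ n * ε →
      ∫⁻ ω, lowSum Λ ε n ω ^ κ ∂P ≤ L) :
    ∃ K : ℝ≥0∞, K ≠ ⊤ ∧ ∀ (n : ℕ) (ε : ℝ), 0 < ε → 1 ≤ 2 ^ (n + 1) * ε →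
      ∫⁻ ω, crossFun κ (block Λ ε (n + 1) 0 (2 ^ n) ω) (block Λ ε (n + 1) (2 ^ n) (2 ^ n) ω) ∂P
        ≤ K := by
  have hΛ := hM.scattered
  obtain ⟨C, hC, hCle⟩ := exists_add_rpow_le hκ
  set b : ℝ≥0∞ := 2 * ENNReal.ofReal (Real.exp (|Ψ (κ + 1)| * 4)) with hb
  set d : ℝ≥0∞ := 4 * topConst Ψ (κ + 1) * L with hd
  have hbt : b ≠ ⊤ := ENNReal.mul_ne_top (by simp) ENNReal.ofReal_ne_top
  have hdt : d ≠ ⊤ := ENNReal.mul_ne_top (ENNReal.mul_ne_top (by simp) (topConst_ne_top _ (by linarith))) hL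
  have hbase : ∀ (n : ℕ) (ε : ℝ), 1 / 4 ≤ ε → ∫⁻ ω, crossFun κ (block Λ ε (n + 1) 0 (2 ^ n) ω)
      (block Λ ε (n + 1) (2 ^ n) (2 ^ n) ω) ∂P ≤ b := by
    intro n ε hε
    refine (lintegral_mono fun ω => crossFun_le hκ.le _ _).trans ?_
    rw [lintegral_const_mul' _ _ (by simp)]
    refine mul_le_mul_right ?_ _
    have := hM.lintegral_block_rpow_le_of_quarter_le hε (n + 1) (q := κ + 1) (by linarith) hκζ
    have e : ∀ ω, block Λ ε (n + 1) 0 (2 ^ n) ω + block Λ ε (n + 1) (2 ^ n) (2 ^ n) ω =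
        block Λ ε (n + 1) 0 (2 ^ (n + 1)) ω := fun ω => by
      rw [pow_succ, mul_two, block_add, zero_add]
    simpa only [e] using this
  refine ⟨4 * (2 * d + 2 * C * d) + b, by finiteness, fun n => ?_⟩
  induction n with
  | zero =>
    intro ε hε0 hε
    exact (hbase 0 ε (by norm_num at hε; linarith)).trans le_add_self
  | succ k ih =>
    intro ε hε0 hε
    rcases le_or_gt (1 / 4) ε with h4 | h4
    · exact (hbase _ ε h4).trans le_add_self
    have hsum : ∀ a : ℕ, ∀ ω, block Λ ε (k + 1 + 1) a (2 ^ (k + 1)) ω =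
        block Λ ε (k + 2) a (2 ^ k) ω + block Λ ε (k + 2) (a + 2 ^ k) (2 ^ k) ω := fun a ω => by
      rw [pow_succ 2 k, mul_two, block_add]
    have h4k : 2 ^ (k + 2) = 4 * 2 ^ k := by ring
    have h2k : 2 ^ (k + 1) = 2 * 2 ^ k := by ring
    have hsep : ∀ a m b m' : ℕ, a + m ≤ 2 ^ (k + 2) → b + m' ≤ 2 ^ (k + 2) →
        (a + m + 2 ^ k ≤ b ∨ b + m' + 2 ^ k ≤ a) →
        ∫⁻ ω, block Λ ε (k + 2) a m ω * block Λ ε (k + 2) b m' ω ^ κ ∂P ≤ d := by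
      intro a m b m' ha hb hab
      refine (hM.lintegral_block_mul_block_rpow_le hε0 h4.le ha hb (fun i hi j hj => ?_) hκ).trans ?_
      · rcases hab with h | h
        · exact quarter_le_abs_gridPoint_sub (by omega)
        · rw [abs_sub_comm]
          exact quarter_le_abs_gridPoint_sub (by omega)
      · exact mul_le_mul' (hM.lintegral_topMax_rpow_le (by linarith) hκζ k)
          (hlow _ _ hε0 h4.le hε)
    set q₀ := block Λ ε (k + 2) 0 (2 ^ k) with hq₀
    set q₁ := block Λ ε (k + 2) (2 ^ k) (2 ^ k) with hq₁
    set q₂ := block Λ ε (k + 2) (2 ^ (k + 1)) (2 ^ k) with hq₂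
    set q₃ := block Λ ε (k + 2) (2 ^ (k + 1) + 2 ^ k) (2 ^ k) with hq₃
    have hm₀ : Measurable q₀ := hΛ.measurable_block hε0 (by omega)
    have hm₁ : Measurable q₁ := hΛ.measurable_block hε0 (by omega)
    have hm₂ : Measurable q₂ := hΛ.measurable_block hε0 (by omega)
    have hm₃ : Measurable q₃ := hΛ.measurable_block hε0 (by omega)
    have hmid : ∫⁻ ω, crossFun κ (q₁ ω) (q₂ ω) ∂P ≤
        2⁻¹ * (4 * (2 * d + 2 * C * d) + b) := by
      have h := hM.lintegral_homogeneous hε0 (by linarith) (n := k + 1) (a := 2 ^ k) (b₁ := 0)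
        (m₁ := 2 ^ k) (b₂ := 2 ^ k) (m₂ := 2 ^ k) (q := κ + 1) (by omega) (by omega) (by omega)
        ⟨by linarith, hκζ⟩ (measurable_crossFun κ) fun c x y _ _ => crossFun_mul hκ.le c x y
      rw [add_zero, ← two_mul, ← h2k] at h
      rw [h]
      refine mul_le_mul' ?_ (ih (2 * ε) (by linarith) ?_)
      · rw [← ENNReal.rpow_neg_one]
        exact ENNReal.rpow_le_rpow_of_exponent_le (by norm_num) (by linarith)
      · refine hε.trans (le_of_eq ?_)
        ring
    have hpt : ∀ ω, crossFun κ (q₀ ω + q₁ ω) (q₂ ω + q₃ ω) ≤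
        (3 / 2) * crossFun κ (q₁ ω) (q₂ ω) + (q₀ ω * (q₂ ω + q₃ ω) ^ κ +
          (q₃ ω * (q₀ ω + q₁ ω) ^ κ + (C * (q₁ ω * q₃ ω ^ κ) + C * (q₂ ω * q₀ ω ^ κ)))) := by
      intro ω
      have h1 := hCle (q₂ ω) (q₃ ω)
      have h2 := hCle (q₁ ω) (q₀ ω)
      calc crossFun κ (q₀ ω + q₁ ω) (q₂ ω + q₃ ω)
          = q₀ ω * (q₂ ω + q₃ ω) ^ κ + q₁ ω * (q₂ ω + q₃ ω) ^ κ +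
              (q₃ ω * (q₀ ω + q₁ ω) ^ κ + q₂ ω * (q₁ ω + q₀ ω) ^ κ) := by
            rw [crossFun, add_comm (q₁ ω) (q₀ ω)]
            ring
        _ ≤ q₀ ω * (q₂ ω + q₃ ω) ^ κ + q₁ ω * ((3 / 2) * q₂ ω ^ κ + C * q₃ ω ^ κ) +
              (q₃ ω * (q₀ ω + q₁ ω) ^ κ + q₂ ω * ((3 / 2) * q₁ ω ^ κ + C * q₀ ω ^ κ)) := by
            gcongr
        _ = _ := by
            rw [crossFun]
            ring
    have hI : ∫⁻ ω, crossFun κ (q₀ ω + q₁ ω) (q₂ ω + q₃ ω) ∂P ≤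
        (3 / 2) * (2⁻¹ * (4 * (2 * d + 2 * C * d) + b)) + (d + (d + (C * d + C * d))) := by
      refine (lintegral_mono hpt).trans ?_
      have hmc : Measurable fun ω => crossFun κ (q₁ ω) (q₂ ω) :=
        (measurable_crossFun κ).comp (hm₁.prodMk hm₂)
      rw [lintegral_add_left (by fun_prop), lintegral_add_left (by fun_prop),
        lintegral_add_left (by fun_prop), lintegral_add_left (by fun_prop),
        lintegral_const_mul' _ _ (by finiteness), lintegral_const_mul' _ _ hC,
        lintegral_const_mul' _ _ hC]
      have e1 : ∀ ω, q₀ ω + q₁ ω = block Λ ε (k + 2) 0 (2 ^ (k + 1)) ω := fun ω => by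
        rw [hsum, zero_add]
      have e2 : ∀ ω, q₂ ω + q₃ ω = block Λ ε (k + 2) (2 ^ (k + 1)) (2 ^ (k + 1)) ω := fun ω => by
        rw [hsum]
      simp only [e1, e2]
      refine add_le_add (mul_le_mul_right hmid _) (add_le_add ?_ (add_le_add ?_
        (add_le_add (mul_le_mul_right ?_ _) (mul_le_mul_right ?_ _))))
      all_goals exact hsep _ _ _ _ (by omega) (by omega) (by omega)
    have e1 : ∀ ω, block Λ ε (k + 1 + 1) 0 (2 ^ (k + 1)) ω = q₀ ω + q₁ ω := fun ω => by
      rw [hsum, zero_add]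
    have e2 : ∀ ω, block Λ ε (k + 1 + 1) (2 ^ (k + 1)) (2 ^ (k + 1)) ω = q₂ ω + q₃ ω := fun ω => by
      rw [hsum]
    simp only [e1, e2]
    refine hI.trans ?_
    have h34 : (3 / 2 : ℝ≥0∞) * 2⁻¹ = 3 / 4 := by
      rw [div_eq_mul_inv, mul_assoc, ← ENNReal.mul_inv (by simp) (by simp)]
      norm_num
      rfl
    have h344 : (3 / 4 : ℝ≥0∞) * 4 = 3 := ENNReal.div_mul_cancel (by simp) (by simp)
    have h341 : (3 / 4 : ℝ≥0∞) ≤ 1 := ENNReal.div_le_of_le_mul (by norm_num)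
    calc (3 / 2) * (2⁻¹ * (4 * (2 * d + 2 * C * d) + b)) + (d + (d + (C * d + C * d)))
        = (3 / 2 * 2⁻¹) * 4 * (2 * d + 2 * C * d) + (3 / 2 * 2⁻¹) * b +
            (2 * d + 2 * C * d) := by ring
      _ = 3 * (2 * d + 2 * C * d) + 3 / 4 * b + (2 * d + 2 * C * d) := by rw [h34, h344]
      _ ≤ 3 * (2 * d + 2 * C * d) + 1 * b + (2 * d + 2 * C * d) := by gcongr
      _ = 4 * (2 * d + 2 * C * d) + b := by ring

lemma IsCascadeModel.exists_lowSum_rpow_le (hM : IsCascadeModel P ψ Λ Ψ ζ) {κ : ℝ}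
    (hκ : 0 < κ) (hκζ : κ ≤ ζ) {C : ℝ≥0∞} (hC : C ≠ ⊤) (hbd : ∀ (n : ℕ) (ε : ℝ), 0 < ε →
      1 ≤ 2 ^ n * ε → ∫⁻ ω, block Λ ε n 0 (2 ^ n) ω ^ κ ∂P ≤ C) :
    ∃ L : ℝ≥0∞, L ≠ ⊤ ∧ ∀ (n : ℕ) (ε : ℝ), 0 < ε → ε ≤ 1 / 4 → 1 ≤ 2 ^ n * ε →
      ∫⁻ ω, lowSum Λ ε n ω ^ κ ∂P ≤ L := by
  rcases le_or_gt κ 1 with h1 | h1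
  · refine ⟨2, by simp, fun n ε hε0 hε _ => ?_⟩
    refine (lintegral_mono fun ω => ENNReal_rpow_le_one_add hκ.le h1 _).trans ?_
    rw [lintegral_add_left measurable_const, hM.lintegral_lowSum hε0 hε]
    simp [one_add_one_eq_two]
  · exact ⟨C, hC, fun n ε hε0 hε h =>
      (hM.lintegral_lowSum_rpow_le hε0 hε n h1 hκζ).trans (hbd n ε hε0 h)⟩

/-- If `φ < 0` on `(1, ζ)` then the moments of order less than `ζ` are bounded uniformly in the
scale. The passage from order `q - 1` to order `q` uses the bound for the cross moment, and that
the two halves contribute `2^{φ(q)}` times the moment at the double scale. -/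
lemma IsCascadeModel.exists_lintegral_block_rpow_le (hM : IsCascadeModel P ψ Λ Ψ ζ)
    (hφ : ∀ q ∈ Ioo 1 ζ, structureFun Ψ q < 0) {q : ℝ} (hq0 : 0 < q) (hqζ : q < ζ) :
    ∃ C : ℝ≥0∞, C ≠ ⊤ ∧ ∀ (n : ℕ) (ε : ℝ), 0 < ε → 1 ≤ 2 ^ n * ε →
      ∫⁻ ω, block Λ ε n 0 (2 ^ n) ω ^ q ∂P ≤ C := by
  have hΛ := hM.scattered
  obtain ⟨m, hm⟩ := exists_nat_ge q
  induction m generalizing q with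
  | zero => exact absurd hm (by simpa using hq0)
  | succ m ih =>
    rcases le_or_gt q 1 with hq1 | hq1
    · refine ⟨2, by simp, fun n ε hε0 _ => ?_⟩
      refine (lintegral_mono fun ω => ENNReal_rpow_le_one_add hq0.le hq1 _).trans ?_
      rw [lintegral_add_left measurable_const, hM.lintegral_block hε0 (by simp)]
      push_cast
      rw [two_pow_mul_inv]
      simp [one_add_one_eq_two]
    have hκ0 : 0 < q - 1 := by linarith
    have hφq := hφ q ⟨hq1, hqζ⟩
    obtain ⟨C, hC, hCb⟩ := ih hκ0 (by linarith) (by push_cast at hm; linarith)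
    obtain ⟨L, hL, hLb⟩ := hM.exists_lowSum_rpow_le hκ0 (by linarith) hC hCb
    obtain ⟨K, hK, hKb⟩ := hM.exists_lintegral_crossFun_le_of_lowSum hκ0
      (by linarith : q - 1 + 1 ≤ ζ) (by rw [sub_add_cancel]; exact hφq.le) hL hLb
    set ρ : ℝ≥0∞ := 2 ^ structureFun Ψ q with hρ
    have hρ1 : ρ < 1 := ENNReal.rpow_lt_one_of_one_lt_of_neg (by norm_num) hφq
    set b : ℝ≥0∞ := ENNReal.ofReal (Real.exp (|Ψ q| * 4)) with hb
    set z : ℝ≥0∞ := 2 ^ q * K with hz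
    have hzt : z ≠ ⊤ := ENNReal.mul_ne_top (ENNReal.rpow_ne_top_of_nonneg hq0.le (by simp)) hK
    have hρ0 : 1 - ρ ≠ 0 := (tsub_pos_of_lt hρ1).ne'
    have hρt : 1 - ρ ≠ ⊤ := ne_top_of_le_ne_top ENNReal.one_ne_top tsub_le_self
    refine ⟨b + z * (1 - ρ)⁻¹, ENNReal.add_ne_top.2 ⟨ENNReal.ofReal_ne_top,
      ENNReal.mul_ne_top hzt (ENNReal.inv_ne_top.2 hρ0)⟩, fun n => ?_⟩
    induction n with
    | zero =>
      intro ε hε0 hε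
      refine (hM.lintegral_block_rpow_le_of_quarter_le (by linarith) _ hq1.le hqζ.le).trans
        le_self_add
    | succ k ihk =>
      intro ε hε0 hε
      rcases le_or_gt (1 / 4) ε with h4 | h4
      · exact (hM.lintegral_block_rpow_le_of_quarter_le h4 _ hq1.le hqζ.le).trans le_self_add
      have h2k : 2 ^ (k + 1) = 2 ^ k + 2 ^ k := by ring
      have hm0 : Measurable (block Λ ε (k + 1) 0 (2 ^ k)) := hΛ.measurable_block hε0 (by rw [h2k, zero_add]; exact le_self_add)
      have hm1 : Measurable (block Λ ε (k + 1) (2 ^ k) (2 ^ k)) :=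
        hΛ.measurable_block hε0 (by omega)
      have hhalf : ∀ a ≤ 2 ^ k, ∫⁻ ω, block Λ ε (k + 1) a (2 ^ k) ω ^ q ∂P ≤
          2⁻¹ * ρ * (b + z * (1 - ρ)⁻¹) := by
        intro a ha
        have h := hM.lintegral_homogeneous hε0 (by linarith) (n := k) (a := a) (b₁ := 0)
          (m₁ := 2 ^ k) (b₂ := 0) (m₂ := 0) (q := q) ha (by omega) (by omega)
          ⟨hq0.le, hqζ.le⟩ (F := fun x _ => x ^ q) (measurable_fst.pow_const q)
          fun c x y _ _ => ENNReal.mul_rpow_of_nonneg _ _ hq0.le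
        rw [add_zero] at h
        rw [h, ENNReal.rpow_sub _ _ (by simp) (by simp), ENNReal.rpow_one, div_eq_mul_inv,
          mul_comm _ (2⁻¹ : ℝ≥0∞)]
        refine mul_le_mul_right (ihk (2 * ε) (by linarith) (hε.trans (le_of_eq ?_))) _
        ring
      have e : ∀ ω, block Λ ε (k + 1) 0 (2 ^ (k + 1)) ω =
          block Λ ε (k + 1) 0 (2 ^ k) ω + block Λ ε (k + 1) (2 ^ k) (2 ^ k) ω := fun ω => by
        rw [h2k, block_add, zero_add]
      have hpt : ∀ ω, block Λ ε (k + 1) 0 (2 ^ (k + 1)) ω ^ q ≤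
          block Λ ε (k + 1) 0 (2 ^ k) ω ^ q + block Λ ε (k + 1) (2 ^ k) (2 ^ k) ω ^ q +
            2 ^ q * crossFun (q - 1) (block Λ ε (k + 1) 0 (2 ^ k) ω)
              (block Λ ε (k + 1) (2 ^ k) (2 ^ k) ω) := fun ω => by
        have h := add_rpow_le_add_crossFun hκ0.le (block Λ ε (k + 1) 0 (2 ^ k) ω)
          (block Λ ε (k + 1) (2 ^ k) (2 ^ k) ω)
        rw [sub_add_cancel] at h
        rw [e]
        exact h
      refine (lintegral_mono hpt).trans ?_
      rw [lintegral_add_left (by fun_prop), lintegral_add_left (by fun_prop),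
        lintegral_const_mul' _ _ (ENNReal.rpow_ne_top_of_nonneg hq0.le (by simp))]
      refine (add_le_add (add_le_add (hhalf 0 (Nat.zero_le _)) (hhalf _ le_rfl))
        (mul_le_mul_right (hKb k ε hε0 hε) _)).trans ?_
      have h1 : ρ * (1 - ρ)⁻¹ + 1 = (1 - ρ)⁻¹ := by
        calc ρ * (1 - ρ)⁻¹ + 1 = ρ * (1 - ρ)⁻¹ + (1 - ρ) * (1 - ρ)⁻¹ := by
              rw [ENNReal.mul_inv_cancel hρ0 hρt]
          _ = (ρ + (1 - ρ)) * (1 - ρ)⁻¹ := by rw [add_mul]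
          _ = _ := by rw [add_tsub_cancel_of_le hρ1.le, one_mul]
      have h2 : (2⁻¹ : ℝ≥0∞) + 2⁻¹ = 1 := ENNReal.inv_two_add_inv_two
      calc 2⁻¹ * ρ * (b + z * (1 - ρ)⁻¹) + 2⁻¹ * ρ * (b + z * (1 - ρ)⁻¹) + 2 ^ q * K
          = (2⁻¹ + 2⁻¹) * (ρ * b + z * (ρ * (1 - ρ)⁻¹)) + z := by rw [hz]; ring
        _ = ρ * b + z * (ρ * (1 - ρ)⁻¹ + 1) := by rw [h2]; ring
        _ ≤ 1 * b + z * (1 - ρ)⁻¹ := by rw [h1]; gcongr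
        _ = _ := by rw [one_mul]

lemma IsCascadeModel.exists_lintegral_crossFun_le (hM : IsCascadeModel P ψ Λ Ψ ζ)
    (hφ : ∀ q ∈ Ioo 1 ζ, structureFun Ψ q < 0) (hφζ : structureFun Ψ ζ = 0) :
    ∃ K : ℝ≥0∞, K ≠ ⊤ ∧ ∀ (n : ℕ) (ε : ℝ), 0 < ε → 1 ≤ 2 ^ (n + 1) * ε →
      ∫⁻ ω, crossFun (ζ - 1) (block Λ ε (n + 1) 0 (2 ^ n) ω)
        (block Λ ε (n + 1) (2 ^ n) (2 ^ n) ω) ∂P ≤ K := by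
  have hκ : 0 < ζ - 1 := by linarith [hM.one_lt]
  obtain ⟨C, hC, hCb⟩ := hM.exists_lintegral_block_rpow_le hφ hκ (by linarith)
  obtain ⟨L, hL, hLb⟩ := hM.exists_lowSum_rpow_le hκ (by linarith) hC hCb
  exact hM.exists_lintegral_crossFun_le_of_lowSum hκ (by linarith)
    (by rw [sub_add_cancel, hφζ]) hL hLb

end Model

/-! ### Riemann sums of right-continuous functions -/

/-- The dyadic interval of generation `n` with right end point `gridPoint n i`. -/
def gridInterval (n i : ℕ) : Set ℝ := Ioc ((i : ℝ) / 2 ^ n) (gridPoint n i)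

lemma measurableSet_gridInterval (n i : ℕ) : MeasurableSet (gridInterval n i) := measurableSet_Ioc

lemma volume_gridInterval (n i : ℕ) : volume (gridInterval n i) = (2 ^ n)⁻¹ := by
  rw [gridInterval, Real.volume_Ioc, gridPoint]
  have : ((i + 1 : ℕ) : ℝ) / 2 ^ n - i / 2 ^ n = (2 ^ n)⁻¹ := by
    push_cast
    ring
  rw [this, ENNReal.ofReal_inv_of_pos (by positivity), ENNReal.ofReal_pow zero_le_two]
  norm_num

lemma exists_mem_gridInterval {x : ℝ} (hx : x ∈ Ioo (0 : ℝ) 1) (n : ℕ) :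
    ∃ i < 2 ^ n, x ∈ gridInterval n i := by
  have h2 : (0 : ℝ) < 2 ^ n := by positivity
  have hpos : 0 < x * 2 ^ n := mul_pos hx.1 h2
  have hc : 0 < ⌈x * 2 ^ n⌉₊ := Nat.ceil_pos.2 hpos
  have hle : ⌈x * 2 ^ n⌉₊ ≤ 2 ^ n := Nat.ceil_le.2 (by push_cast; nlinarith [hx.2])
  obtain ⟨i, hi⟩ := Nat.exists_eq_succ_of_ne_zero hc.ne'
  refine ⟨i, by omega, ?_, ?_⟩
  · rw [div_lt_iff₀ h2]
    exact Nat.lt_ceil.1 (by omega)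
  · rw [gridPoint, le_div_iff₀ h2, ← Nat.succ_eq_add_one, ← hi]
    exact Nat.le_ceil _

lemma eq_of_mem_gridInterval {x : ℝ} {n i j : ℕ} (hi : x ∈ gridInterval n i)
    (hj : x ∈ gridInterval n j) : i = j := by
  have h2 : (0 : ℝ) < 2 ^ n := by positivity
  have key : ∀ {i j : ℕ}, x ∈ gridInterval n i → x ∈ gridInterval n j → i ≤ j := by
    intro i j hi hj
    have h := hi.1.trans_le hj.2
    rw [gridPoint, div_lt_div_iff_of_pos_right h2] at h
    exact Nat.lt_succ_iff.1 (by exact_mod_cast h)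
  exact le_antisymm (key hi hj) (key hj hi)

/-- The function equal to `h (gridPoint n i)` on the `i`-th dyadic interval of generation `n`. -/
noncomputable def gridStep (h : ℝ → ℝ≥0∞) (n : ℕ) (x : ℝ) : ℝ≥0∞ :=
  ∑ i ∈ Finset.range (2 ^ n), (gridInterval n i).indicator (fun _ => h (gridPoint n i)) x

lemma measurable_gridStep (h : ℝ → ℝ≥0∞) (n : ℕ) : Measurable (gridStep h n) :=
  Finset.measurable_sum _ fun _ _ => measurable_const.indicator (measurableSet_gridInterval n _)

lemma gridStep_eq {h : ℝ → ℝ≥0∞} {n i : ℕ} (hi : i < 2 ^ n) {x : ℝ} (hx : x ∈ gridInterval n i) :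
    gridStep h n x = h (gridPoint n i) := by
  rw [gridStep, Finset.sum_eq_single i, indicator_of_mem hx]
  · exact fun j _ hj => indicator_of_notMem (fun hxj => hj (eq_of_mem_gridInterval hxj hx)) _
  · exact fun h => absurd (Finset.mem_range.2 hi) h

lemma lintegral_gridStep (h : ℝ → ℝ≥0∞) (n : ℕ) :
    ∫⁻ x in Icc 0 1, gridStep h n x =
      ∑ i ∈ Finset.range (2 ^ n), (2 ^ n)⁻¹ * h (gridPoint n i) := by
  unfold gridStep
  rw [lintegral_finsetSum _ fun i _ => measurable_const.indicator (measurableSet_gridInterval n _)]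
  refine Finset.sum_congr rfl fun i hi => ?_
  have hi' := Finset.mem_range.1 hi
  have hsub : gridInterval n i ⊆ Icc (0 : ℝ) 1 := fun x hx =>
    ⟨le_trans (by positivity) hx.1.le, hx.2.trans (gridPoint_mem hi').2⟩
  rw [lintegral_indicator_const (measurableSet_gridInterval n i), mul_comm]
  congr 1
  change volume.restrict (Icc 0 1) (gridInterval n i) = _
  rw [Measure.restrict_apply (measurableSet_gridInterval n i), inter_eq_left.2 hsub, volume_gridInterval]

lemma tendsto_gridStep {h : ℝ → ℝ≥0∞} {x : ℝ} (hx : x ∈ Ioo (0 : ℝ) 1)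
    (hr : Tendsto h (𝓝[≥] x) (𝓝 (h x))) : Tendsto (fun n => gridStep h n x) atTop (𝓝 (h x)) := by
  choose i hi hxi using exists_mem_gridInterval hx
  have e : (fun n => gridStep h n x) = fun n => h (gridPoint n (i n)) :=
    funext fun n => gridStep_eq (hi n) (hxi n)
  rw [e]
  refine hr.comp (tendsto_nhdsWithin_iff.2 ⟨?_, Eventually.of_forall fun n => (hxi n).2⟩)
  have hlim : Tendsto (fun n : ℕ => x + (1 / 2 : ℝ) ^ n) atTop (𝓝 x) := by
    simpa using (tendsto_pow_atTop_nhds_zero_of_lt_one (r := (1 / 2 : ℝ)) (by norm_num)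
      (by norm_num)).const_add x
  refine tendsto_of_tendsto_of_tendsto_of_le_of_le tendsto_const_nhds hlim (fun n => (hxi n).2)
    fun n => ?_
  have h1 := (hxi n).1
  have h2 : gridPoint n (i n) = (i n : ℝ) / 2 ^ n + (1 / 2) ^ n := by
    rw [gridPoint, one_div, inv_pow]
    push_cast
    ring
  simp only
  linarith

lemma ae_tendsto_gridStep {h : ℝ → ℝ≥0∞}
    (hr : ∀ᵐ x, x ∈ Ioo (0 : ℝ) 1 → Tendsto h (𝓝[≥] x) (𝓝 (h x))) :
    ∀ᵐ x ∂(volume.restrict (Icc (0 : ℝ) 1)),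
      Tendsto (fun n => gridStep h n x) atTop (𝓝 (h x)) := by
  rw [← Measure.restrict_congr_set (Ioo_ae_eq_Icc (μ := volume)), ae_restrict_iff' measurableSet_Ioo]
  filter_upwards [hr] with x h1 h2 using tendsto_gridStep h2 (h1 h2)

lemma aemeasurable_of_rightContinuous {h : ℝ → ℝ≥0∞}
    (hr : ∀ᵐ x, x ∈ Ioo (0 : ℝ) 1 → Tendsto h (𝓝[≥] x) (𝓝 (h x))) :
    AEMeasurable h (volume.restrict (Icc (0 : ℝ) 1)) :=
  aemeasurable_of_tendsto_metrizable_ae atTop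
    (fun n => (measurable_gridStep h n).aemeasurable) (ae_tendsto_gridStep hr)

lemma tendsto_gridSum {h : ℝ → ℝ≥0∞} {b : ℝ≥0∞} (hb : b ≠ ⊤) (hle : ∀ x ∈ Icc (0 : ℝ) 1, h x ≤ b)
    (hr : ∀ᵐ x, x ∈ Ioo (0 : ℝ) 1 → Tendsto h (𝓝[≥] x) (𝓝 (h x))) :
    Tendsto (fun n : ℕ => ∑ i ∈ Finset.range (2 ^ n), (2 ^ n)⁻¹ * h (gridPoint n i)) atTop
      (𝓝 (∫⁻ x in Icc 0 1, h x)) := by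
  simp only [← lintegral_gridStep]
  refine tendsto_lintegral_of_dominated_convergence (fun _ => b) (measurable_gridStep h) (fun n => ?_)
    ?_ (ae_tendsto_gridStep hr)
  · rw [EventuallyLE, ← Measure.restrict_congr_set (Ioo_ae_eq_Icc (μ := volume)),
      ae_restrict_iff' measurableSet_Ioo]
    refine ae_of_all _ fun x hx => ?_
    obtain ⟨i, hi, hxi⟩ := exists_mem_gridInterval hx n
    rw [gridStep_eq hi hxi]
    exact hle _ (gridPoint_mem hi)
  · simp [hb]

/-- A càdlàg function on `[0, 1]` is bounded. -/
lemma IsCadlagOn.bounded {f : ℝ → ℝ} (hf : IsCadlagOn f 0 1) :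
    ∃ C : ℝ, ∀ x ∈ Icc (0 : ℝ) 1, f x ≤ C := by
  have hone : ∀ {l : Filter ℝ} {a : ℝ}, Tendsto f l (𝓝 a) → ∀ᶠ x in l, f x ≤ a + 1 := fun h =>
    h.eventually (Iic_mem_nhds (by linarith))
  have h := isCompact_Icc.induction_on (s := Icc (0 : ℝ) 1)
    (p := fun s => ∃ C : ℝ, ∀ x ∈ s ∩ Icc (0 : ℝ) 1, f x ≤ C)
    ⟨0, by simp⟩ (fun s t hst ⟨C, hC⟩ => ⟨C, fun x hx => hC x ⟨hst hx.1, hx.2⟩⟩)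
    (fun s t ⟨C, hC⟩ ⟨C', hC'⟩ => ⟨max C C', fun x hx => by
      rcases hx.1 with h | h
      · exact (hC x ⟨h, hx.2⟩).trans (le_max_left _ _)
      · exact (hC' x ⟨h, hx.2⟩).trans (le_max_right _ _)⟩)
    fun x hx => by
      have hleft : ∃ C : ℝ, ∀ᶠ y in 𝓝[<] x, y ∈ Icc (0 : ℝ) 1 → f y ≤ C := by
        rcases hx.1.eq_or_lt with h0 | h0
        · refine ⟨0, eventually_nhdsWithin_of_forall fun y (hy : y < x) hyI => ?_⟩
          exact absurd hyI.1 (by linarith)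
        · obtain ⟨l, hl⟩ := hf.2 x ⟨h0, hx.2⟩
          exact ⟨l + 1, (hone hl).mono fun y hy _ => hy⟩
      have hright : ∃ C : ℝ, ∀ᶠ y in 𝓝[≥] x, y ∈ Icc (0 : ℝ) 1 → f y ≤ C := by
        rcases hx.2.eq_or_lt with h1 | h1
        · refine ⟨f 1, eventually_nhdsWithin_of_forall fun y (hy : x ≤ y) hyI => ?_⟩
          rw [le_antisymm hyI.2 (h1 ▸ hy)]
        · exact ⟨f x + 1, (hone (hf.1 x ⟨hx.1, h1⟩)).mono fun y hy _ => hy⟩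
      obtain ⟨C, hC⟩ := hleft
      obtain ⟨C', hC'⟩ := hright
      have hev : ∀ᶠ y in 𝓝 x, y ∈ Icc (0 : ℝ) 1 → f y ≤ max C C' := by
        rw [← nhdsLT_sup_nhdsGE, eventually_sup]
        exact ⟨hC.mono fun y h hy => (h hy).trans (le_max_left _ _),
          hC'.mono fun y h hy => (h hy).trans (le_max_right _ _)⟩
      exact ⟨_, mem_nhdsWithin_of_mem_nhds hev, max C C', fun y hy => hy.1 hy.2⟩
  simpa using h

/-! ### Convergence of integrals under a moment bound -/

/-- Convergence of integrals of almost everywhere convergent functions with bounded moments of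
order `p > 1`. -/
lemma tendsto_lintegral_of_moment_bound {α : Type*} [MeasurableSpace α] {μ : Measure α}
    [IsFiniteMeasure μ] {p : ℝ} (hp : 1 < p) {C : ℝ≥0∞} (hC : C ≠ ⊤) {f : ℕ → α → ℝ≥0∞}
    {g : α → ℝ≥0∞} (hf : ∀ n, AEMeasurable (f n) μ)
    (hlim : ∀ᵐ a ∂μ, Tendsto (fun n => f n a) atTop (𝓝 (g a)))
    (hbd : ∀ᶠ n in atTop, ∫⁻ a, f n a ^ p ∂μ ≤ C) :
    Tendsto (fun n => ∫⁻ a, f n a ∂μ) atTop (𝓝 (∫⁻ a, g a ∂μ)) := by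
  refine tendsto_of_le_liminf_of_limsup_le ?_ ?_
  · calc ∫⁻ a, g a ∂μ = ∫⁻ a, liminf (fun n => f n a) atTop ∂μ :=
          lintegral_congr_ae (hlim.mono fun _ h => h.liminf_eq.symm)
      _ ≤ _ := lintegral_liminf_le' hf
  -- above the level `K` the functions contribute at most `K^{1 - p} C`
  have hK : ∀ K : ℕ, 0 < K → limsup (fun n => ∫⁻ a, f n a ∂μ) atTop ≤
      ∫⁻ a, g a ∂μ + (K : ℝ≥0∞) ^ (1 - p) * C := by
    intro K hK
    have hK0 : (K : ℝ≥0∞) ≠ 0 := by simpa using hK.ne'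
    have hKt : (K : ℝ≥0∞) ≠ ⊤ := ENNReal.natCast_ne_top K
    have hpt : ∀ x : ℝ≥0∞, x ≤ min x K + (K : ℝ≥0∞) ^ (1 - p) * x ^ p := by
      intro x
      rcases le_total x K with h | h
      · rw [min_eq_left h]
        exact le_self_add
      · refine le_trans ?_ le_add_self
        rcases eq_or_ne x ⊤ with rfl | hxt
        · rw [ENNReal.top_rpow_of_pos (by linarith), ENNReal.mul_top]
          exact (ENNReal.rpow_pos (pos_iff_ne_zero.2 hK0) hKt).ne'
        have hx0 : x ≠ 0 := fun h0 => hK0 (by simpa [h0] using h)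
        have e : x = x ^ (1 - p) * x ^ p := by
          rw [← ENNReal.rpow_add _ _ hx0 hxt, sub_add_cancel, ENNReal.rpow_one]
        calc x = x ^ (1 - p) * x ^ p := e
          _ ≤ _ := by
            rw [← neg_sub, ENNReal.rpow_neg, ENNReal.rpow_neg]
            gcongr
    have hmin : Tendsto (fun n => ∫⁻ a, min (f n a) K ∂μ) atTop (𝓝 (∫⁻ a, min (g a) K ∂μ)) := by
      refine tendsto_lintegral_of_dominated_convergence' (fun _ => (K : ℝ≥0∞))
        (fun n => (hf n).min aemeasurable_const) (fun n => ae_of_all _ fun a => min_le_right _ _)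
        ?_ ?_
      · rw [lintegral_const]
        exact ENNReal.mul_ne_top hKt (measure_ne_top _ _)
      · filter_upwards [hlim] with a ha using ha.min tendsto_const_nhds
    have hle : ∀ᶠ n in atTop, ∫⁻ a, f n a ∂μ ≤
        ∫⁻ a, min (f n a) K ∂μ + (K : ℝ≥0∞) ^ (1 - p) * C := by
      filter_upwards [hbd] with n hn
      refine (lintegral_mono fun a => hpt (f n a)).trans ?_
      rw [lintegral_add_left' ((hf n).min aemeasurable_const),
        lintegral_const_mul' _ _ (ENNReal.rpow_ne_top_of_ne_zero hK0 hKt)]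
      gcongr
    calc limsup (fun n => ∫⁻ a, f n a ∂μ) atTop
        ≤ limsup (fun n => ∫⁻ a, min (f n a) K ∂μ + (K : ℝ≥0∞) ^ (1 - p) * C) atTop :=
          limsup_le_limsup hle
      _ = ∫⁻ a, min (g a) K ∂μ + (K : ℝ≥0∞) ^ (1 - p) * C :=
          (hmin.add_const _).limsup_eq
      _ ≤ _ := by
          gcongr
          exact min_le_left _ _
  have hzero : Tendsto (fun K : ℕ => ∫⁻ a, g a ∂μ + (K : ℝ≥0∞) ^ (1 - p) * C) atTop
      (𝓝 (∫⁻ a, g a ∂μ + 0 * C)) := by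
    refine Tendsto.const_add _ (ENNReal.Tendsto.mul_const ?_ (Or.inr hC))
    have h := (ENNReal.tendsto_rpow_at_top (by linarith : 0 < p - 1)).comp
      ENNReal.tendsto_nat_nhds_top
    have h' := tendsto_inv_iff.2 h
    rw [ENNReal.inv_top] at h'
    refine h'.congr fun K => ?_
    rw [Function.comp_apply, ← ENNReal.rpow_neg, neg_sub]
  rw [zero_mul, add_zero] at hzero
  exact ge_of_tendsto hzero ((eventually_gt_atTop 0).mono hK)

section Model

variable {Ω : Type*} [MeasurableSpace Ω] {P : Measure Ω} [IsProbabilityMeasure P] {ψ : ℂ → ℂ}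
  {Λ : Set (ℝ × ℝ) → Ω → ℝ} {Ψ : ℝ → ℝ} {ζ : ℝ} {D : ℝ → ℝ → Ω → ℝ}

/-! ### Integrals against the approximating measures -/

/-- The Riemann sum, with mesh `2^{-n}`, of the integral of the weight `w` against the measure at
scale `ε`. -/
noncomputable def weightedSum (Λ : Set (ℝ × ℝ) → Ω → ℝ) (w : ℝ → ℝ≥0∞) (ε : ℝ) (n : ℕ) (ω : Ω) :
    ℝ≥0∞ :=
  ∑ i ∈ Finset.range (2 ^ n), (2 ^ n)⁻¹ * (w (gridPoint n i) * density Λ ε (gridPoint n i) ω)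

/-- A version of the integral of `w` against the measure at scale `ε` which is determined by the
intervals of length at least `ε`. -/
noncomputable def weightedLim (Λ : Set (ℝ × ℝ) → Ω → ℝ) (w : ℝ → ℝ≥0∞) (ε : ℝ) (ω : Ω) : ℝ≥0∞ :=
  liminf (fun n => weightedSum Λ w ε n ω) atTop

/-- Bounded weights which are right-continuous at almost every point. -/
structure IsWeight (w : ℝ → ℝ≥0∞) (b : ℝ≥0∞) : Prop where
  ne_top : b ≠ ⊤
  le : ∀ x, w x ≤ b
  right_cont : ∀ᵐ x, Tendsto w (𝓝[≥] x) (𝓝 (w x))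

lemma IsWeight.of_continuous {f : ℝ → ℝ≥0} (hf : Continuous f) {b : ℝ≥0} (hb : ∀ x, f x ≤ b) :
    IsWeight (fun x => f x) b where
  ne_top := ENNReal.coe_ne_top
  le x := ENNReal.coe_le_coe.2 (hb x)
  right_cont := ae_of_all _ fun x =>
    ((ENNReal.continuous_coe.comp hf).tendsto x).mono_left nhdsWithin_le_nhds

lemma IsWeight.indicator {s : Set ℝ} (hs : volume (frontier s) = 0) :
    IsWeight (s.indicator fun _ => 1) 1 where
  ne_top := ENNReal.one_ne_top
  le x := indicator_le_self' (fun _ _ => zero_le) x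
  right_cont := by
    have h : ∀ᵐ x, x ∉ frontier s := measure_eq_zero_iff_ae_notMem.1 hs
    filter_upwards [h] with x hx
    refine Tendsto.mono_left ?_ nhdsWithin_le_nhds
    rw [frontier_eq_closure_inter_closure, mem_inter_iff, not_and_or, ← mem_compl_iff,
      ← mem_compl_iff, ← interior_compl, ← interior_compl, compl_compl] at hx
    rcases hx with hx | hx
    · have hxs : x ∉ s := interior_subset hx
      rw [indicator_of_notMem hxs]
      refine tendsto_const_nhds.congr' ?_
      filter_upwards [mem_interior_iff_mem_nhds.1 hx] with y hy
      exact (indicator_of_notMem hy (fun _ => (1 : ℝ≥0∞))).symm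
    · rw [indicator_of_mem (interior_subset hx)]
      refine tendsto_const_nhds.congr' ?_
      filter_upwards [mem_interior_iff_mem_nhds.1 hx] with y hy
      exact (indicator_of_mem hy (fun _ => (1 : ℝ≥0∞))).symm

lemma IsWeight.aemeasurable {w : ℝ → ℝ≥0∞} {b : ℝ≥0∞} (hw : IsWeight w b) :
    AEMeasurable w (volume.restrict (Icc (0 : ℝ) 1)) :=
  aemeasurable_of_rightContinuous (hw.right_cont.mono fun _ h _ => h)

lemma IsScatteredMeasure.measurable_weightedSum (hΛ : IsScatteredMeasure P ψ Λ) (w : ℝ → ℝ≥0∞)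
    {ε : ℝ} (hε : 0 < ε) (n : ℕ) : Measurable (weightedSum Λ w ε n) :=
  Finset.measurable_sum _ fun _ hi => ((hΛ.measurable_density hε
    (gridPoint_mem (Finset.mem_range.1 hi))).const_mul _).const_mul _

lemma measurable_weightedLim_regionSigma (w : ℝ → ℝ≥0∞) {ε : ℝ} (hε : 0 < ε) :
    Measurable[regionSigma Λ {z | ε ≤ z.2}] (weightedLim Λ w ε) :=
  Measurable.liminf fun _ => Finset.measurable_sum _ fun _ hi =>
    ((measurable_factor_regionSigma (truncCone_mem_finiteAreaSets hε
      (gridPoint_mem (Finset.mem_range.1 hi))) fun _ hz => hz.2).const_mul _).const_mul _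

lemma lintegral_cascadeMeasure {w : ℝ → ℝ≥0∞} {b : ℝ≥0∞} (hw : IsWeight w b) {ε : ℝ} {ω : Ω}
    (h : IsCadlagOn (fun t => D ε t ω) 0 1) : ∫⁻ x, w x ∂(cascadeMeasure D ε ω) =
      ∫⁻ x in Icc 0 1, w x * ENNReal.ofReal (D ε x ω) := by
  have hD : AEMeasurable (fun x => ENNReal.ofReal (D ε x ω)) (volume.restrict (Icc (0 : ℝ) 1)) :=
    aemeasurable_of_rightContinuous (ae_of_all _ fun x hx =>
      (ENNReal.continuous_ofReal.tendsto _).comp (h.1 x ⟨hx.1.le, hx.2⟩))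
  rw [cascadeMeasure, lintegral_withDensity_eq_lintegral_mul₀' hD
    (hw.aemeasurable.mono_ac (withDensity_absolutelyContinuous _ _))]
  exact lintegral_congr fun x => mul_comm _ _

lemma IsCadlagDensity.ae_tendsto_weightedSum (hD : IsCadlagDensity P Λ D) {w : ℝ → ℝ≥0∞}
    {b : ℝ≥0∞} (hw : IsWeight w b) {ε : ℝ} (hε : 0 < ε) :
    ∀ᵐ ω ∂P, Tendsto (fun n => weightedSum Λ w ε n ω) atTop
      (𝓝 (∫⁻ x, w x ∂(cascadeMeasure D ε ω))) := by
  have hgrid : ∀ᵐ ω ∂P, ∀ n : ℕ, ∀ i ∈ Finset.range (2 ^ n),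
      D ε (gridPoint n i) ω = Real.exp (Λ (truncCone (Icc 0 1) ε (gridPoint n i)) ω) :=
    ae_all_iff.2 fun n => (ae_ball_iff (Finset.countable_toSet _)).2 fun i hi =>
      hD.modification ε hε _ (gridPoint_mem (Finset.mem_range.1 hi))
  filter_upwards [hgrid, hD.cadlag ε hε] with ω h1 h2
  rw [lintegral_cascadeMeasure hw h2]
  obtain ⟨C, hC⟩ := h2.bounded
  have h := tendsto_gridSum (h := fun x => w x * ENNReal.ofReal (D ε x ω))
    (b := b * ENNReal.ofReal C) (ENNReal.mul_ne_top hw.ne_top ENNReal.ofReal_ne_top)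
    (fun x hx => mul_le_mul' (hw.le x) (ENNReal.ofReal_le_ofReal (hC x hx))) (by
      filter_upwards [hw.right_cont] with x hx hxI
      exact ENNReal.Tendsto.mul hx (Or.inr ENNReal.ofReal_ne_top)
        ((ENNReal.continuous_ofReal.tendsto _).comp (h2.1 x ⟨hxI.1.le, hxI.2⟩))
        (Or.inr (ne_top_of_le_ne_top hw.ne_top (hw.le x))))
  refine h.congr fun n => Finset.sum_congr rfl fun i hi => ?_
  rw [h1 n i hi]
  rfl

lemma IsCadlagDensity.weightedLim_eq_ae (hD : IsCadlagDensity P Λ D) {w : ℝ → ℝ≥0∞}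
    {b : ℝ≥0∞} (hw : IsWeight w b) {ε : ℝ} (hε : 0 < ε) :
    ∀ᵐ ω ∂P, weightedLim Λ w ε ω = ∫⁻ x, w x ∂(cascadeMeasure D ε ω) :=
  (hD.ae_tendsto_weightedSum hw hε).mono fun _ h => h.liminf_eq

lemma IsCadlagDensity.ae_tendsto_weightedLim (hD : IsCadlagDensity P Λ D) {w : ℝ → ℝ≥0∞}
    {b : ℝ≥0∞} (hw : IsWeight w b) {ε : ℝ} (hε : 0 < ε) :
    ∀ᵐ ω ∂P, Tendsto (fun n => weightedSum Λ w ε n ω) atTop (𝓝 (weightedLim Λ w ε ω)) := by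
  filter_upwards [hD.ae_tendsto_weightedSum hw hε, hD.weightedLim_eq_ae hw hε] with ω h1 h2
  rwa [h2]

lemma weightedSum_le {w : ℝ → ℝ≥0∞} {b : ℝ≥0∞} (hw : IsWeight w b) (ε : ℝ) (n : ℕ) (ω : Ω) :
    weightedSum Λ w ε n ω ≤ b * block Λ ε n 0 (2 ^ n) ω := by
  rw [weightedSum, block, Finset.mul_sum]
  refine Finset.sum_le_sum fun i _ => ?_
  rw [zero_add, mul_left_comm]
  gcongr
  exact hw.le _

lemma eventually_one_le_two_pow_mul {ε : ℝ} (hε : 0 < ε) : ∀ᶠ n : ℕ in atTop, 1 ≤ 2 ^ n * ε := by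
  filter_upwards [(tendsto_pow_atTop_atTop_of_one_lt (one_lt_two (α := ℝ))).eventually_ge_atTop
    (1 / ε)] with n hn
  rwa [div_le_iff₀ hε] at hn

/-- The moments of order `p` of the measures at scale `ε` are bounded by `C`, in the form of a
bound for the Riemann sums. -/
structure HasMomentBound (P : Measure Ω) (Λ : Set (ℝ × ℝ) → Ω → ℝ) (p : ℝ) (C : ℝ≥0∞) : Prop where
  one_lt : 1 < p
  ne_top : C ≠ ⊤
  le : ∀ (n : ℕ) (ε : ℝ), 0 < ε → 1 ≤ 2 ^ n * ε → ∫⁻ ω, block Λ ε n 0 (2 ^ n) ω ^ p ∂P ≤ C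

lemma HasMomentBound.eventually_weightedSum {p : ℝ} {C : ℝ≥0∞} (hB : HasMomentBound P Λ p C)
    {w : ℝ → ℝ≥0∞} {b : ℝ≥0∞} (hw : IsWeight w b) {ε : ℝ} (hε : 0 < ε) :
    ∀ᶠ n : ℕ in atTop, ∫⁻ ω, weightedSum Λ w ε n ω ^ p ∂P ≤ b ^ p * C := by
  have hp0 : 0 < p := by linarith [hB.one_lt]
  filter_upwards [eventually_one_le_two_pow_mul hε] with n hn
  calc ∫⁻ ω, weightedSum Λ w ε n ω ^ p ∂P
      ≤ ∫⁻ ω, b ^ p * block Λ ε n 0 (2 ^ n) ω ^ p ∂P := lintegral_mono fun ω => by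
        rw [← ENNReal.mul_rpow_of_nonneg _ _ hp0.le]
        exact ENNReal.rpow_le_rpow (weightedSum_le hw ε n ω) hp0.le
    _ = b ^ p * ∫⁻ ω, block Λ ε n 0 (2 ^ n) ω ^ p ∂P :=
        lintegral_const_mul' _ _ (ENNReal.rpow_ne_top_of_nonneg hp0.le hw.ne_top)
    _ ≤ _ := mul_le_mul_right (hB.le n ε hε hn) _

lemma HasMomentBound.const_ne_top {p : ℝ} {C : ℝ≥0∞} (hB : HasMomentBound P Λ p C)
    {w : ℝ → ℝ≥0∞} {b : ℝ≥0∞} (hw : IsWeight w b) : b ^ p * C ≠ ⊤ :=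
  ENNReal.mul_ne_top (ENNReal.rpow_ne_top_of_nonneg (by linarith [hB.one_lt]) hw.ne_top) hB.ne_top

lemma IsCascadeModel.lintegral_weightedLim_rpow_le (hM : IsCascadeModel P ψ Λ Ψ ζ)
    (hD : IsCadlagDensity P Λ D) {p : ℝ} {C : ℝ≥0∞} (hB : HasMomentBound P Λ p C)
    {w : ℝ → ℝ≥0∞} {b : ℝ≥0∞} (hw : IsWeight w b) {ε : ℝ} (hε : 0 < ε) :
    ∫⁻ ω, weightedLim Λ w ε ω ^ p ∂P ≤ b ^ p * C := by
  calc ∫⁻ ω, weightedLim Λ w ε ω ^ p ∂P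
      = ∫⁻ ω, liminf (fun n => weightedSum Λ w ε n ω ^ p) atTop ∂P := by
        refine lintegral_congr_ae ((hD.ae_tendsto_weightedLim hw hε).mono fun ω h => ?_)
        exact (((ENNReal.continuous_rpow_const (y := p)).tendsto _).comp h).liminf_eq.symm
    _ ≤ liminf (fun n => ∫⁻ ω, weightedSum Λ w ε n ω ^ p ∂P) atTop :=
        lintegral_liminf_le fun n => (hM.scattered.measurable_weightedSum w hε n).pow_const p
    _ ≤ _ := liminf_le_of_frequently_le' (hB.eventually_weightedSum hw hε).frequently

/-- The martingale property of the integrals of a fixed weight, as the scale decreases. -/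
lemma IsCascadeModel.setLIntegral_weightedLim_eq (hM : IsCascadeModel P ψ Λ Ψ ζ)
    (hD : IsCadlagDensity P Λ D) {p : ℝ} {C : ℝ≥0∞} (hB : HasMomentBound P Λ p C)
    {w : ℝ → ℝ≥0∞} {b : ℝ≥0∞} (hw : IsWeight w b) {ε ε' : ℝ} (hε' : 0 < ε') (hle : ε' ≤ ε)
    {A : Set Ω} (hA : MeasurableSet[regionSigma Λ {z | ε ≤ z.2}] A) :
    ∫⁻ ω in A, weightedLim Λ w ε' ω ∂P = ∫⁻ ω in A, weightedLim Λ w ε ω ∂P := by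
  have hΛ := hM.scattered
  have hε := hε'.trans_le hle
  have hA' : MeasurableSet A := hΛ.regionSigma_le _ _ hA
  have hlim : ∀ {δ : ℝ}, 0 < δ → Tendsto (fun n => ∫⁻ ω in A, weightedSum Λ w δ n ω ∂P) atTop
      (𝓝 (∫⁻ ω in A, weightedLim Λ w δ ω ∂P)) := fun {δ} hδ =>
    tendsto_lintegral_of_moment_bound hB.one_lt (hB.const_ne_top hw)
      (fun n => (hΛ.measurable_weightedSum w hδ n).aemeasurable)
      (ae_restrict_of_ae (hD.ae_tendsto_weightedLim hw hδ))
      ((hB.eventually_weightedSum hw hδ).mono fun n h => (setLIntegral_le_lintegral _ _).trans h)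
  refine tendsto_nhds_unique (hlim hε') ((hlim hε).congr fun n => ?_)
  unfold weightedSum
  have hg : ∀ i ∈ Finset.range (2 ^ n), gridPoint n i ∈ Icc (0 : ℝ) 1 := fun i hi =>
    gridPoint_mem (Finset.mem_range.1 hi)
  rw [lintegral_finsetSum' _ fun i hi =>
      (((hΛ.measurable_density hε (hg i hi)).const_mul _).const_mul _).aemeasurable,
    lintegral_finsetSum' _ fun i hi =>
      (((hΛ.measurable_density hε' (hg i hi)).const_mul _).const_mul _).aemeasurable]
  refine Finset.sum_congr rfl fun i hi => ?_
  have hwt : w (gridPoint n i) ≠ ⊤ := ne_top_of_le_ne_top hw.ne_top (hw.le _)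
  simp only [lintegral_const_mul' _ _ (two_pow_inv_ne_top n), lintegral_const_mul' _ _ hwt]
  congr 2
  -- the additional factor is independent of the intervals of length at least `ε`
  set V := truncCone (Icc 0 1) ε (gridPoint n i) with hV
  set V' := truncCone (Icc 0 1) ε' (gridPoint n i) with hV'
  have hVm : V ∈ finiteAreaSets := truncCone_mem_finiteAreaSets hε (hg i hi)
  have hVm' : V' ∈ finiteAreaSets := truncCone_mem_finiteAreaSets hε' (hg i hi)
  have hsub : V ⊆ V' := fun z hz => ⟨hz.1, hle.trans hz.2⟩
  have hdm : V' \ V ∈ finiteAreaSets :=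
    mem_finiteAreaSets_of_subset hVm' (hVm'.1.diff hVm.1) Set.sdiff_subset
  have hdec := hΛ.factor_union_ae hVm hdm disjoint_sdiff_right
  rw [union_sdiff_cancel hsub] at hdec
  have hind : ∀ f : Ω → ℝ≥0∞, ∫⁻ ω in A, f ω ∂P = ∫⁻ ω, A.indicator (fun _ => 1) ω * f ω ∂P := by
    intro f
    rw [← lintegral_indicator hA']
    refine lintegral_congr fun ω => ?_
    by_cases h : ω ∈ A <;> simp [h]
  rw [hind, hind]
  have hmul := hM.lintegral_mul_factor hdm (R := {z | ε ≤ z.2})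
    (f := fun ω => A.indicator (fun _ => 1) ω * factor Λ V ω)
    (disjoint_left.2 fun z h1 h2 => h2.2 ⟨h2.1.1, h1⟩)
    (Measurable.mul (Measurable.indicator (@measurable_const _ _ _ (regionSigma Λ {z | ε ≤ z.2}) 1) hA)
      (measurable_factor_regionSigma hVm fun z hz => hz.2))
  refine hmul.symm.trans (lintegral_congr_ae ?_)
  filter_upwards [hdec] with ω h
  change _ = A.indicator (fun _ => 1) ω * factor Λ V' ω
  rw [h, mul_assoc]

lemma IsCascadeModel.lintegral_weightedLim (hM : IsCascadeModel P ψ Λ Ψ ζ)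
    (hD : IsCadlagDensity P Λ D) {p : ℝ} {C : ℝ≥0∞} (hB : HasMomentBound P Λ p C)
    {w : ℝ → ℝ≥0∞} {b : ℝ≥0∞} (hw : IsWeight w b) {ε : ℝ} (hε : 0 < ε) :
    ∫⁻ ω, weightedLim Λ w ε ω ∂P = ∫⁻ x in Icc 0 1, w x := by
  have hΛ := hM.scattered
  have h1 := tendsto_lintegral_of_moment_bound hB.one_lt (hB.const_ne_top hw)
      (fun n => (hΛ.measurable_weightedSum w hε n).aemeasurable)
      (hD.ae_tendsto_weightedLim hw hε) (hB.eventually_weightedSum hw hε)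
  refine tendsto_nhds_unique h1 ((tendsto_gridSum hw.ne_top (fun x _ => hw.le x)
    (hw.right_cont.mono fun _ h _ => h)).congr fun n => ?_)
  unfold weightedSum
  have hg : ∀ i ∈ Finset.range (2 ^ n), gridPoint n i ∈ Icc (0 : ℝ) 1 := fun i hi =>
    gridPoint_mem (Finset.mem_range.1 hi)
  rw [lintegral_finsetSum' _ fun i hi =>
      (((hΛ.measurable_density hε (hg i hi)).const_mul _).const_mul _).aemeasurable]
  refine Finset.sum_congr rfl fun i hi => ?_
  have hwt : w (gridPoint n i) ≠ ⊤ := ne_top_of_le_ne_top hw.ne_top (hw.le _)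
  rw [lintegral_const_mul' _ _ (two_pow_inv_ne_top n), lintegral_const_mul' _ _ hwt, density,
    hM.lintegral_factor (truncCone_mem_finiteAreaSets hε (hg i hi)), mul_one]

end Model

/-! ### Convergence of martingales indexed by the rationals -/

section Martingale

variable {Ω : Type*} {m0 : MeasurableSpace Ω} {P : Measure Ω} [IsProbabilityMeasure P]

/-- A nonnegative martingale indexed by the rationals, bounded in `L^p` for some `p > 1`. The
martingale property is stated through integrals over the events of the past. -/
structure IsBoundedMartingale (P : Measure Ω) (F : ℚ → MeasurableSpace Ω) (Z : ℚ → Ω → ℝ)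
    (p : ℝ) (C : ℝ≥0∞) : Prop where
  le : ∀ t, F t ≤ m0
  mono : Monotone F
  measurable : ∀ t, Measurable[F t] (Z t)
  nonneg : ∀ t ω, 0 ≤ Z t ω
  one_lt : 1 < p
  ne_top : C ≠ ⊤
  moment : ∀ t, ∫⁻ ω, ENNReal.ofReal (Z t ω) ^ p ∂P ≤ C
  setIntegral_eq : ∀ s t, s ≤ t → ∀ A, MeasurableSet[F s] A →
    ∫ ω in A, Z t ω ∂P = ∫ ω in A, Z s ω ∂P

variable {F : ℚ → MeasurableSpace Ω} {Z : ℚ → Ω → ℝ} {p : ℝ} {C : ℝ≥0∞}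

lemma IsBoundedMartingale.measurable' (h : IsBoundedMartingale P F Z p C) (t : ℚ) :
    Measurable (Z t) := (h.measurable t).mono (h.le t) le_rfl

lemma le_one_add_rpow {p : ℝ} (hp : 1 ≤ p) (x : ℝ≥0∞) : x ≤ 1 + x ^ p := by
  rcases le_total x 1 with h | h
  · exact h.trans le_self_add
  · calc x = x ^ (1 : ℝ) := (ENNReal.rpow_one x).symm
      _ ≤ x ^ p := ENNReal.rpow_le_rpow_of_exponent_le h hp
      _ ≤ _ := le_add_self

lemma IsBoundedMartingale.lintegral_le (h : IsBoundedMartingale P F Z p C) (t : ℚ) :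
    ∫⁻ ω, ENNReal.ofReal (Z t ω) ∂P ≤ 1 + C := by
  refine (lintegral_mono fun ω => le_one_add_rpow h.one_lt.le _).trans ?_
  rw [lintegral_add_left measurable_const]
  gcongr
  · simp
  · exact h.moment t

lemma IsBoundedMartingale.integrable (h : IsBoundedMartingale P F Z p C) (t : ℚ) :
    Integrable (Z t) P := by
  refine ⟨(h.measurable' t).aestronglyMeasurable, ?_⟩
  rw [hasFiniteIntegral_iff_ofReal (ae_of_all _ (h.nonneg t))]
  exact (h.lintegral_le t).trans_lt (ENNReal.add_lt_top.2 ⟨by simp, h.ne_top.lt_top⟩)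

lemma IsBoundedMartingale.exists_integral_abs_sub_le (h : IsBoundedMartingale P F Z p C) {η : ℝ}
    (hη : 0 < η) : ∃ T : ℕ, ∀ U : ℕ, T ≤ U → ∫ ω, |Z U ω - Z T ω| ∂P ≤ η := by
  have hp0 : 0 < p := by linarith [h.one_lt]
  let ℱ : Filtration ℕ m0 := ⟨fun n => F n, fun i j hij => h.mono (by exact_mod_cast hij),
    fun n => h.le n⟩
  have hmart : Martingale (fun n : ℕ => Z n) ℱ P :=
    martingale_of_setIntegral_eq_succ (fun n => (h.measurable n).stronglyMeasurable)
      (fun n => h.integrable n) fun n A hA =>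
        (h.setIntegral_eq n (n + 1 : ℕ) (by push_cast; linarith) A hA).symm
  have hbdd : ∀ n : ℕ, eLpNorm (Z n) 1 P ≤ ((1 + C).toNNReal : ℝ≥0∞) := by
    intro n
    rw [eLpNorm_one_eq_lintegral_enorm, ENNReal.coe_toNNReal (by simp [h.ne_top])]
    refine le_trans (le_of_eq (lintegral_congr fun ω => ?_)) (h.lintegral_le n)
    rw [Real.enorm_eq_ofReal (h.nonneg _ _)]
  have hconv := hmart.submartingale.exists_ae_tendsto_of_bdd hbdd
  let g : Ω → ℝ := fun ω => limUnder atTop fun n : ℕ => Z n ω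
  have hg : ∀ᵐ ω ∂P, Tendsto (fun n : ℕ => Z n ω) atTop (𝓝 (g ω)) :=
    hconv.mono fun ω hω => tendsto_nhds_limUnder hω
  have hgm : AEMeasurable g P := aemeasurable_of_tendsto_metrizable_ae atTop
    (fun n : ℕ => (h.measurable' n).aemeasurable) hg
  have hgp : ∫⁻ ω, ENNReal.ofReal (g ω) ^ p ∂P ≤ C := by
    calc ∫⁻ ω, ENNReal.ofReal (g ω) ^ p ∂P
        = ∫⁻ ω, liminf (fun n : ℕ => ENNReal.ofReal (Z n ω) ^ p) atTop ∂P := by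
          refine lintegral_congr_ae (hg.mono fun ω hω => ?_)
          exact (((ENNReal.continuous_rpow_const (y := p)).tendsto _).comp
            ((ENNReal.continuous_ofReal.tendsto _).comp hω)).liminf_eq.symm
      _ ≤ liminf (fun n : ℕ => ∫⁻ ω, ENNReal.ofReal (Z n ω) ^ p ∂P) atTop :=
          lintegral_liminf_le fun n => (h.measurable' n).ennreal_ofReal.pow_const p
      _ ≤ C := liminf_le_of_frequently_le' (Frequently.of_forall fun n => h.moment n)
  have hlim : Tendsto (fun n : ℕ => ∫⁻ ω, ENNReal.ofReal |Z n ω - g ω| ∂P) atTop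
      (𝓝 (∫⁻ _, 0 ∂P)) := by
    refine tendsto_lintegral_of_moment_bound h.one_lt (C := C + C) (by simp [h.ne_top])
      (fun n => (((h.measurable' n).aemeasurable.sub hgm).norm).ennreal_ofReal) ?_
      (Eventually.of_forall fun n => ?_)
    · filter_upwards [hg] with ω hω
      have := (ENNReal.continuous_ofReal.tendsto _).comp (hω.sub_const (g ω)).abs
      simpa [Function.comp_def] using this
    · have hpt : ∀ᵐ ω ∂P, ENNReal.ofReal |Z n ω - g ω| ^ p ≤
          ENNReal.ofReal (Z n ω) ^ p + ENNReal.ofReal (g ω) ^ p := by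
        filter_upwards [hg] with ω hω
        have hg0 : 0 ≤ g ω := ge_of_tendsto' hω fun n => h.nonneg n ω
        have hZ0 := h.nonneg n ω
        rcases le_total (Z n ω) (g ω) with hle | hle
        · refine le_trans (ENNReal.rpow_le_rpow (ENNReal.ofReal_le_ofReal ?_) hp0.le) le_add_self
          rw [abs_le]
          constructor <;> linarith
        · refine le_trans (ENNReal.rpow_le_rpow (ENNReal.ofReal_le_ofReal ?_) hp0.le) le_self_add
          rw [abs_le]
          constructor <;> linarith
      refine (lintegral_mono_ae hpt).trans ?_
      rw [lintegral_add_left ((h.measurable' n).ennreal_ofReal.pow_const p)]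
      exact add_le_add (h.moment n) hgp
  rw [lintegral_zero] at hlim
  have hev := hlim.eventually (Iio_mem_nhds (ENNReal.ofReal_pos.2 (half_pos hη)))
  obtain ⟨T, hT⟩ := eventually_atTop.1 hev
  refine ⟨T, fun U hU => ?_⟩
  have hsub : AEMeasurable (fun ω => ENNReal.ofReal |Z U ω - g ω|) P :=
    (((h.measurable' U).aemeasurable.sub hgm).norm).ennreal_ofReal
  have hm : AEStronglyMeasurable (fun ω => |Z U ω - Z T ω|) P :=
    ((h.measurable' U).sub (h.measurable' T)).norm.aestronglyMeasurable
  rw [integral_eq_lintegral_of_nonneg_ae (ae_of_all _ fun ω => abs_nonneg _) hm]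
  refine ENNReal.toReal_le_of_le_ofReal hη.le ?_
  calc ∫⁻ ω, ENNReal.ofReal |Z U ω - Z T ω| ∂P
      ≤ ∫⁻ ω, ENNReal.ofReal |Z U ω - g ω| + ENNReal.ofReal |Z T ω - g ω| ∂P := by
        refine lintegral_mono fun ω => ?_
        rw [← ENNReal.ofReal_add (abs_nonneg _) (abs_nonneg _)]
        refine ENNReal.ofReal_le_ofReal ?_
        rw [abs_sub_comm (Z T ω)]
        exact abs_sub_le _ _ _
    _ = ∫⁻ ω, ENNReal.ofReal |Z U ω - g ω| ∂P + ∫⁻ ω, ENNReal.ofReal |Z T ω - g ω| ∂P :=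
        lintegral_add_left' hsub _
    _ ≤ ENNReal.ofReal (η / 2) + ENNReal.ofReal (η / 2) :=
        add_le_add (le_of_lt (hT U hU)) (le_of_lt (hT T le_rfl))
    _ = ENNReal.ofReal η := by
        rw [← ENNReal.ofReal_add (by linarith) (by linarith), add_halves]

/-- The increments after time `T` form a submartingale in absolute value. -/
lemma IsBoundedMartingale.setIntegral_abs_sub_le (h : IsBoundedMartingale P F Z p C) {T u U : ℚ}
    (hTu : T ≤ u) (huU : u ≤ U) {A : Set Ω} (hA : MeasurableSet[F u] A) :
    ∫ ω in A, |Z u ω - Z T ω| ∂P ≤ ∫ ω in A, |Z U ω - Z T ω| ∂P := by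
  have hint : ∀ s, Integrable (fun ω => Z s ω - Z T ω) P := fun s =>
    (h.integrable s).sub (h.integrable T)
  have hmZ : Measurable[F u] fun ω => Z u ω - Z T ω :=
    Measurable.sub (h.measurable u) ((h.measurable T).mono (h.mono hTu) le_rfl)
  let B : Set Ω := (fun ω => Z u ω - Z T ω) ⁻¹' Ici 0
  have hB : MeasurableSet[F u] B := hmZ measurableSet_Ici
  have hB' : MeasurableSet B := h.le u _ hB
  have hA' : MeasurableSet A := h.le u _ hA
  have heq : ∀ A', MeasurableSet[F u] A' →
      ∫ ω in A', (Z U ω - Z T ω) ∂P = ∫ ω in A', (Z u ω - Z T ω) ∂P := fun A' hA' => by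
    rw [integral_sub (h.integrable U).integrableOn (h.integrable T).integrableOn,
      integral_sub (h.integrable u).integrableOn (h.integrable T).integrableOn,
      h.setIntegral_eq u U huU A' hA']
  rw [← integral_inter_add_sdiff hB' (hint u).abs.integrableOn,
    ← integral_inter_add_sdiff hB' (hint U).abs.integrableOn]
  have hAB : MeasurableSet[F u] (A ∩ B) := MeasurableSet.inter hA hB
  have hAB2 : MeasurableSet[F u] (A \ B) := MeasurableSet.diff hA hB
  refine add_le_add ?_ ?_
  · rw [setIntegral_congr_fun (g := fun ω => Z u ω - Z T ω) (hA'.inter hB')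
      fun ω hω => abs_of_nonneg hω.2, ← heq _ hAB]
    exact integral_mono (hint U).integrableOn (hint U).abs.integrableOn fun ω => le_abs_self _
  · rw [setIntegral_congr_fun (g := fun ω => -(Z u ω - Z T ω)) (hA'.diff hB')
      fun ω hω => abs_of_neg (not_le.1 hω.2), integral_neg, ← heq _ hAB2, ← integral_neg]
    exact integral_mono (hint U).neg.integrableOn (hint U).abs.integrableOn fun ω => neg_le_abs _

/-- Doob's maximal inequality for the increments after time `T`, over finitely many times. -/
lemma IsBoundedMartingale.maximal (h : IsBoundedMartingale P F Z p C) {δ : ℝ} {T : ℚ}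
    (S : Finset ℚ) : ∀ U : ℚ, T ≤ U → (∀ s ∈ S, T ≤ s) → (∀ s ∈ S, s ≤ U) →
      MeasurableSet[F U] {ω | ∃ s ∈ S, δ ≤ |Z s ω - Z T ω|} ∧
      δ * P.real {ω | ∃ s ∈ S, δ ≤ |Z s ω - Z T ω|} ≤
        ∫ ω in {ω | ∃ s ∈ S, δ ≤ |Z s ω - Z T ω|}, |Z U ω - Z T ω| ∂P := by
  induction S using Finset.induction_on_max with
  | empty =>
    intro U _ _ _
    simp
  | insert u S hu ih =>
    intro U hTU hTS hSU
    have hTu : T ≤ u := hTS u (by simp)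
    have huU : u ≤ U := hSU u (by simp)
    obtain ⟨hmeas, hle⟩ := ih u hTu (fun s hs => hTS s (by simp [hs])) fun s hs => (hu s hs).le
    set A := {ω | ∃ s ∈ S, δ ≤ |Z s ω - Z T ω|} with hA
    let B : Set Ω := {ω | δ ≤ |Z u ω - Z T ω|}
    have hmZ : Measurable[F u] fun ω => |Z u ω - Z T ω| :=
      continuous_abs.measurable.comp
        (Measurable.sub (h.measurable u) ((h.measurable T).mono (h.mono hTu) le_rfl))
    have hB : MeasurableSet[F u] B := hmZ measurableSet_Ici
    have hun : {ω | ∃ s ∈ insert u S, δ ≤ |Z s ω - Z T ω|} = A ∪ B \ A := by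
      ext ω
      simp only [Finset.mem_insert, exists_eq_or_imp, mem_union, union_sdiff_self, hA, B,
        mem_ofPred_eq]
      exact or_comm
    have hBA : MeasurableSet[F u] (B \ A) := MeasurableSet.diff hB hmeas
    have hU' : MeasurableSet[F u] (A ∪ B \ A) := MeasurableSet.union hmeas hBA
    have hBA' : MeasurableSet (B \ A) := h.le u _ hBA
    have hint : ∀ s, Integrable (fun ω => |Z s ω - Z T ω|) P := fun s =>
      ((h.integrable s).sub (h.integrable T)).abs
    rw [hun]
    refine ⟨h.mono huU _ hU', le_trans ?_ (h.setIntegral_abs_sub_le hTu huU hU')⟩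
    rw [setIntegral_union disjoint_sdiff_right hBA' (hint u).integrableOn (hint u).integrableOn,
      measureReal_union disjoint_sdiff_right hBA', mul_add]
    refine add_le_add hle ?_
    have hc := setIntegral_mono_on (μ := P) (f := fun _ => δ) (s := B \ A)
      (integrable_const δ).integrableOn (hint u).integrableOn hBA' fun ω hω => hω.1
    rwa [setIntegral_const, smul_eq_mul, mul_comm] at hc

/-- Almost sure convergence along the rationals. -/
lemma IsBoundedMartingale.ae_exists_tendsto (h : IsBoundedMartingale P F Z p C) :
    ∀ᵐ ω ∂P, ∃ c : ℝ, Tendsto (fun t => Z t ω) atTop (𝓝 c) := by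
  -- the increments after a late time are uniformly small, with high probability
  have hbad : ∀ δ : ℝ, 0 < δ → ∀ᵐ ω ∂P, ∃ T : ℕ, ∀ s : ℚ, (T : ℚ) ≤ s →
      |Z s ω - Z T ω| < δ := by
    intro δ hδ
    have hbound : ∀ η : ℝ, 0 < η → P {ω | ∀ T : ℕ, ∃ s : ℚ, (T : ℚ) ≤ s ∧ δ ≤ |Z s ω - Z T ω|} ≤
        ENNReal.ofReal (η / δ) := by
      intro η hη
      obtain ⟨T, hT⟩ := h.exists_integral_abs_sub_le hη
      let e : ℕ → ℚ := fun n => (Denumerable.eqv ℚ).symm n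
      let S : ℕ → Finset ℚ := fun n => ((Finset.range n).image e).filter fun s => (T : ℚ) ≤ s
      let A : ℕ → Set Ω := fun n => {ω | ∃ s ∈ S n, δ ≤ |Z s ω - Z T ω|}
      have hSmono : Monotone S := fun i j hij => Finset.filter_subset_filter _
        (Finset.image_subset_image (Finset.range_subset_range.2 hij))
      have hAmono : Monotone A := fun i j hij ω ⟨s, hs, hd⟩ => ⟨s, hSmono hij hs, hd⟩
      have hsub : {ω | ∀ T : ℕ, ∃ s : ℚ, (T : ℚ) ≤ s ∧ δ ≤ |Z s ω - Z T ω|} ⊆ ⋃ n, A n := by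
        intro ω hω
        obtain ⟨s, hs, hd⟩ := hω T
        refine mem_iUnion.2 ⟨Denumerable.eqv ℚ s + 1, s, ?_, hd⟩
        simp only [S, Finset.mem_filter, Finset.mem_image, Finset.mem_range]
        exact ⟨⟨Denumerable.eqv ℚ s, by omega, by simp [e]⟩, hs⟩
      refine (measure_mono hsub).trans ?_
      rw [hAmono.measure_iUnion]
      refine iSup_le fun n => ?_
      obtain ⟨q, hq⟩ := (S n).bddAbove
      obtain ⟨U, hU⟩ := exists_nat_ge (max q T)
      have hTU : (T : ℚ) ≤ U := (le_max_right _ _).trans hU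
      have hm := (h.maximal (δ := δ) (T := T) (S n) U hTU
        (fun s hs => (Finset.mem_filter.1 hs).2)
        fun s hs => (hq hs).trans ((le_max_left _ _).trans hU)).2
      have hint : Integrable (fun ω => |Z U ω - Z T ω|) P :=
        ((h.integrable U).sub (h.integrable T)).abs
      have h1 : δ * P.real (A n) ≤ η := hm.trans ((setIntegral_le_integral hint
        (ae_of_all _ fun ω => abs_nonneg _)).trans (hT U (by exact_mod_cast hTU)))
      have h2 : P.real (A n) ≤ η / δ := by
        rw [le_div_iff₀ hδ, mul_comm]
        exact h1
      rw [← ofReal_measureReal]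
      exact ENNReal.ofReal_le_ofReal h2
    rw [ae_iff]
    have hz : Tendsto (fun η : ℝ => ENNReal.ofReal (η / δ)) (𝓝[>] 0) (𝓝 0) := by
      have : Tendsto (fun η : ℝ => ENNReal.ofReal (η / δ)) (𝓝 0) (𝓝 (ENNReal.ofReal (0 / δ))) :=
        (ENNReal.continuous_ofReal.tendsto _).comp (tendsto_id.div_const δ)
      rw [zero_div, ENNReal.ofReal_zero] at this
      exact this.mono_left nhdsWithin_le_nhds
    refine le_antisymm (ge_of_tendsto hz ?_) zero_le
    filter_upwards [self_mem_nhdsWithin] with η hη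
    refine le_trans (measure_mono fun ω hω => ?_) (hbound η hη)
    simp only [mem_ofPred_eq] at hω ⊢
    push Not at hω
    exact hω
  have hall : ∀ᵐ ω ∂P, ∀ k : ℕ, ∃ T : ℕ, ∀ s : ℚ, (T : ℚ) ≤ s →
      |Z s ω - Z T ω| < 1 / ((k : ℝ) + 1) :=
    ae_all_iff.2 fun k => hbad _ (by positivity)
  filter_upwards [hall] with ω hω
  refine cauchy_map_iff_exists_tendsto.1 (Metric.cauchy_iff.2 ⟨inferInstance, fun η hη => ?_⟩)
  obtain ⟨k, hk⟩ := exists_nat_one_div_lt (half_pos hη)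
  obtain ⟨T, hT⟩ := hω k
  refine ⟨(fun t => Z t ω) '' Ici (T : ℚ), image_mem_map (Ici_mem_atTop _), ?_⟩
  rintro _ ⟨s, hs, rfl⟩ _ ⟨t, ht, rfl⟩
  have h1 := hT s hs
  have h2 := hT t ht
  rw [Real.dist_eq]
  calc |Z s ω - Z t ω| ≤ |Z s ω - Z T ω| + |Z T ω - Z t ω| := abs_sub_le _ _ _
    _ < η := by
      rw [abs_sub_comm (Z T ω)]
      linarith

end Martingale

/-! ### Weak convergence of measures on the unit interval -/

open BoundedContinuousFunction CompactlySupported in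
/-- The extension of a continuous function on `[0, 1]` which is constant on either side. -/
noncomputable def extendUnit (g : C(Icc (0 : ℝ) 1, ℝ≥0)) : ℝ →ᵇ ℝ≥0 :=
  (BoundedContinuousFunction.mkOfCompact g).compContinuous
    ⟨projIcc 0 1 zero_le_one, continuous_projIcc⟩

open BoundedContinuousFunction in
lemma dist_extendUnit_le (g h : C(Icc (0 : ℝ) 1, ℝ≥0)) :
    dist (extendUnit g) (extendUnit h) ≤ dist g h := by
  have := (lipschitz_compContinuous (β := ℝ≥0)
    (⟨projIcc 0 1 zero_le_one, continuous_projIcc⟩ : C(ℝ, Icc (0 : ℝ) 1))).dist_le_mul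
      (mkOfCompact g) (mkOfCompact h)
  rwa [NNReal.coe_one, one_mul, dist_mkOfCompact] at this

lemma extendUnit_apply {g : C(Icc (0 : ℝ) 1, ℝ≥0)} (x : ℝ) :
    extendUnit g x = g (projIcc 0 1 zero_le_one x) := rfl

section Weak

variable {ι : Type*} {l : Filter ι} [l.NeBot] {ν : ι → FiniteMeasure ℝ}

/-- If the integrals of a dense set of functions converge then so do all integrals. -/
lemma exists_tendsto_testAgainstNN_extendUnit {d : ℕ → C(Icc (0 : ℝ) 1, ℝ≥0)}
    (hd : DenseRange d)
    (hconv : ∀ k, ∃ c, Tendsto (fun i => (ν i).testAgainstNN (extendUnit (d k))) l (𝓝 c))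
    (hmass : ∃ c, Tendsto (fun i => (ν i).mass) l (𝓝 c)) (g : C(Icc (0 : ℝ) 1, ℝ≥0)) :
    ∃ c, Tendsto (fun i => (ν i).testAgainstNN (extendUnit g)) l (𝓝 c) := by
  obtain ⟨c, hc⟩ := hmass
  have hM : ∀ᶠ i in l, (ν i).mass < c + 1 :=
    hc.eventually (Iio_mem_nhds (lt_add_of_pos_right c one_pos))
  refine cauchy_map_iff_exists_tendsto.1 (Metric.cauchy_iff.2 ⟨inferInstance, fun η hη => ?_⟩)
  obtain ⟨k, hk⟩ := hd.exists_dist_lt g (ε := η / (3 * ((c : ℝ) + 1))) (by positivity)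
  have hclose : ∀ᶠ i in l, dist ((ν i).testAgainstNN (extendUnit g))
      ((ν i).testAgainstNN (extendUnit (d k))) < η / 3 := by
    filter_upwards [hM] with i hi
    have hi' : ((ν i).mass : ℝ) ≤ c + 1 := by exact_mod_cast hi.le
    calc _ ≤ ((ν i).mass : ℝ) * dist (extendUnit g) (extendUnit (d k)) :=
          (FiniteMeasure.testAgainstNN_lipschitz (ν i)).dist_le_mul _ _
      _ ≤ (c + 1) * dist g (d k) :=
          mul_le_mul hi' (dist_extendUnit_le _ _) dist_nonneg (by positivity)
      _ < (c + 1) * (η / (3 * ((c : ℝ) + 1))) := by gcongr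
      _ = η / 3 := by
          have : (c : ℝ) + 1 ≠ 0 := by positivity
          field_simp
  obtain ⟨b, hb⟩ := hconv k
  have hb' : ∀ᶠ i in l, dist ((ν i).testAgainstNN (extendUnit (d k))) b < η / 6 :=
    hb.eventually (Metric.ball_mem_nhds b (by positivity))
  refine ⟨(fun i => (ν i).testAgainstNN (extendUnit g)) '' {i |
    dist ((ν i).testAgainstNN (extendUnit g)) ((ν i).testAgainstNN (extendUnit (d k))) < η / 3 ∧
    dist ((ν i).testAgainstNN (extendUnit (d k))) b < η / 6},
    image_mem_map (hclose.and hb'), ?_⟩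
  have key : ∀ i, dist ((ν i).testAgainstNN (extendUnit g))
      ((ν i).testAgainstNN (extendUnit (d k))) < η / 3 →
      dist ((ν i).testAgainstNN (extendUnit (d k))) b < η / 6 →
      dist ((ν i).testAgainstNN (extendUnit g)) b < η / 2 := fun i h1 h2 =>
    (dist_triangle _ ((ν i).testAgainstNN (extendUnit (d k))) _).trans_lt (by linarith)
  rintro _ ⟨i, ⟨hi1, hi2⟩, rfl⟩ _ ⟨j, ⟨hj1, hj2⟩, rfl⟩
  calc _ ≤ dist ((ν i).testAgainstNN (extendUnit g)) b +
        dist ((ν j).testAgainstNN (extendUnit g)) b := dist_triangle_right _ _ _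
    _ < η := by linarith [key i hi1 hi2, key j hj1 hj2]

open CompactlySupported BoundedContinuousFunction in
/-- A family of measures on `[0, 1]` all of whose integrals of continuous functions converge has
a weak limit, given by the Riesz representation theorem. -/
lemma exists_weak_limit (hsupp : ∀ i, (ν i : Measure ℝ) (Icc 0 1)ᶜ = 0)
    (hconv : ∀ g : C(Icc (0 : ℝ) 1, ℝ≥0),
      ∃ c, Tendsto (fun i => (ν i).testAgainstNN (extendUnit g)) l (𝓝 c)) :
    ∃ μ : FiniteMeasure ℝ, (μ : Measure ℝ) (Icc 0 1)ᶜ = 0 ∧ Tendsto ν l (𝓝 μ) := by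
  choose L hL using hconv
  let A : C_c(Icc (0 : ℝ) 1, ℝ≥0) →ₗ[ℝ≥0] ℝ≥0 :=
    { toFun := fun g => L g.toContinuousMap
      map_add' := fun g h => by
        refine tendsto_nhds_unique (hL _) (((hL g.toContinuousMap).add
          (hL h.toContinuousMap)).congr fun i => ?_)
        rw [← FiniteMeasure.testAgainstNN_add]
        rfl
      map_smul' := fun c g => by
        refine tendsto_nhds_unique (hL _) (((hL g.toContinuousMap).const_mul c).congr fun i => ?_)
        rw [← smul_eq_mul, ← FiniteMeasure.testAgainstNN_smul]
        rfl }
  let μ₀ : Measure (Icc (0 : ℝ) 1) := NNRealRMK.rieszMeasure A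
  have hfin : IsFiniteMeasure (μ₀.map Subtype.val) := inferInstance
  refine ⟨⟨μ₀.map Subtype.val, hfin⟩, ?_, ?_⟩
  · rw [FiniteMeasure.toMeasure_mk, Measure.map_apply measurable_subtype_coe
      measurableSet_Icc.compl]
    have : (Subtype.val ⁻¹' (Icc (0 : ℝ) 1)ᶜ : Set (Icc (0 : ℝ) 1)) = ∅ := by
      ext x
      simp
    rw [this, measure_empty]
  · refine FiniteMeasure.tendsto_iff_forall_lintegral_tendsto.2 fun f => ?_
    let g : C(Icc (0 : ℝ) 1, ℝ≥0) := ⟨fun x => f x, by fun_prop⟩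
    have h1 : ∀ i, ∫⁻ x, f x ∂(ν i : Measure ℝ) = (ν i).testAgainstNN (extendUnit g) := by
      intro i
      rw [FiniteMeasure.testAgainstNN_coe_eq]
      refine lintegral_congr_ae ?_
      have : ∀ᵐ x ∂(ν i : Measure ℝ), x ∈ Icc (0 : ℝ) 1 := by
        rw [ae_iff]
        exact hsupp i
      filter_upwards [this] with x hx
      rw [extendUnit_apply, projIcc_of_mem zero_le_one hx]
      rfl
    have h2 : ∫⁻ x, f x ∂(μ₀.map Subtype.val) = L g := by
      rw [lintegral_map (by fun_prop) measurable_subtype_coe]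
      exact NNRealRMK.lintegral_rieszMeasure A
        ⟨g, HasCompactSupport.of_compactSpace g⟩
    simp only [h1, FiniteMeasure.toMeasure_mk, h2]
    exact ENNReal.tendsto_coe.2 (hL g)

end Weak

/-- A function on the positive half-line which is right-continuous and converges along the
rationals converges along the reals. -/
lemma tendsto_atTop_of_rat {X : Type*} [PseudoMetricSpace X] {φ : ℝ → X}
    (hr : ∀ t > 0, Tendsto φ (𝓝[≥] t) (𝓝 (φ t))) {c : X}
    (hq : Tendsto (fun q : ℚ => φ (max (q : ℝ) 1)) atTop (𝓝 c)) : Tendsto φ atTop (𝓝 c) := by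
  rw [Metric.tendsto_atTop]
  intro η hη
  obtain ⟨q, hq⟩ := eventually_atTop.1 (hq.eventually (Metric.ball_mem_nhds c (half_pos hη)))
  refine ⟨max (q : ℝ) 1, fun t ht => ?_⟩
  have ht1 : 1 ≤ t := (le_max_right _ _).trans ht
  have htq : (q : ℝ) ≤ t := (le_max_left _ _).trans ht
  have hnear := (hr t (by linarith)).eventually (Metric.ball_mem_nhds (φ t) (half_pos hη))
  obtain ⟨u, hu, hsub⟩ := (mem_nhdsGE_iff_exists_Ico_subset' (lt_add_one t)).1 hnear
  obtain ⟨r, hr1, hr2⟩ := exists_rat_btwn (mem_Ioi.1 hu)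
  have h1 : dist (φ r) (φ t) < η / 2 := hsub ⟨hr1.le, hr2⟩
  have h2 : dist (φ (max (r : ℝ) 1)) c < η / 2 := hq r (by exact_mod_cast htq.trans hr1.le)
  rw [max_eq_left (ht1.trans hr1.le)] at h2
  calc dist (φ t) c ≤ dist (φ r) (φ t) + dist (φ r) c := dist_triangle_left _ _ _
    _ < η := by linarith

section Model

variable {Ω : Type*} [MeasurableSpace Ω] {P : Measure Ω} [IsProbabilityMeasure P] {ψ : ℂ → ℂ}
  {Λ : Set (ℝ × ℝ) → Ω → ℝ} {Ψ : ℝ → ℝ} {ζ : ℝ} {D : ℝ → ℝ → Ω → ℝ}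
  {N : ℝ → Ω → FiniteMeasure ℝ}

/-! ### The limit measure -/

/-- For a fixed weight the integrals converge almost surely as the scale tends to `0` along the
inverses of the rationals. -/
lemma IsCascadeModel.ae_exists_tendsto_weightedLim (hM : IsCascadeModel P ψ Λ Ψ ζ)
    (hD : IsCadlagDensity P Λ D) {p : ℝ} {C : ℝ≥0∞} (hB : HasMomentBound P Λ p C)
    {w : ℝ → ℝ≥0∞} {b : ℝ≥0∞} (hw : IsWeight w b) :
    ∀ᵐ ω ∂P, ∃ c : ℝ, Tendsto (fun t : ℚ => (weightedLim Λ w (1 / max (t : ℝ) 1) ω).toReal)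
      atTop (𝓝 c) := by
  have hΛ := hM.scattered
  have hpos : ∀ t : ℚ, (0 : ℝ) < 1 / max (t : ℝ) 1 := fun t =>
    one_div_pos.2 (lt_of_lt_of_le one_pos (le_max_right _ _))
  have hanti : ∀ {s t : ℚ}, s ≤ t → 1 / max (t : ℝ) 1 ≤ 1 / max (s : ℝ) 1 := fun {s t} hst =>
    one_div_le_one_div_of_le (lt_of_lt_of_le one_pos (le_max_right _ _))
      (max_le_max (by exact_mod_cast hst) le_rfl)
  have hmeas : ∀ t : ℚ, Measurable (weightedLim Λ w (1 / max (t : ℝ) 1)) := fun t =>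
    (measurable_weightedLim_regionSigma w (hpos t)).mono (hΛ.regionSigma_le _) le_rfl
  have hlt : ∀ t : ℚ, ∀ᵐ ω ∂P, weightedLim Λ w (1 / max (t : ℝ) 1) ω < ⊤ := by
    intro t
    refine ae_lt_top (hmeas t) ?_
    rw [hM.lintegral_weightedLim hD hB hw (hpos t)]
    refine ne_top_of_le_ne_top ?_ (lintegral_mono fun x => hw.le x)
    simp [hw.ne_top]
  refine IsBoundedMartingale.ae_exists_tendsto (p := p) (C := b ^ p * C)
    (F := fun t => regionSigma Λ {z | 1 / max (t : ℝ) 1 ≤ z.2})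
    { le := fun t => hΛ.regionSigma_le _
      mono := fun s t hst => regionSigma_mono fun z hz => (hanti hst).trans hz
      measurable := fun t => (measurable_weightedLim_regionSigma w (hpos t)).ennreal_toReal
      nonneg := fun t ω => ENNReal.toReal_nonneg
      one_lt := hB.one_lt
      ne_top := hB.const_ne_top hw
      moment := fun t => ?_
      setIntegral_eq := fun s t hst A hA => ?_ }
  · refine le_trans (lintegral_mono fun ω => ?_)
      (hM.lintegral_weightedLim_rpow_le hD hB hw (hpos t))
    exact ENNReal.rpow_le_rpow ENNReal.ofReal_toReal_le (by linarith [hB.one_lt])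
  · rw [integral_toReal (hmeas t).aemeasurable (ae_restrict_of_ae (hlt t)),
      integral_toReal (hmeas s).aemeasurable (ae_restrict_of_ae (hlt s)),
      hM.setLIntegral_weightedLim_eq hD hB hw (hpos t) (hanti hst) hA]

/-- The measures `N t` converge weakly as `t → ∞`, and `limitMeasure` is the limit. -/
lemma IsCascadeModel.ae_tendsto_limitMeasure (hM : IsCascadeModel P ψ Λ Ψ ζ)
    (hD : IsCadlagDensity P Λ D) (hN : IsRightContinuousVersion P D N) {p : ℝ} {C : ℝ≥0∞}
    (hB : HasMomentBound P Λ p C) :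
    ∀ᵐ ω ∂P, ∃ μ : FiniteMeasure ℝ, limitMeasure N ω = μ ∧ (μ : Measure ℝ) (Icc 0 1)ᶜ = 0 ∧
      Tendsto (fun t => N t ω) atTop (𝓝 μ) := by
  have hpos : ∀ t : ℚ, (0 : ℝ) < max (t : ℝ) 1 := fun t =>
    lt_of_lt_of_le one_pos (le_max_right _ _)
  let d : ℕ → C(Icc (0 : ℝ) 1, ℝ≥0) := TopologicalSpace.denseSeq _
  have hNt : ∀ᵐ ω ∂P, ∀ t : ℚ, (N (max t 1) ω : Measure ℝ) =
      cascadeMeasure D (1 / max (t : ℝ) 1) ω :=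
    ae_all_iff.2 fun t => hN.modification _ (hpos t)
  have htest : ∀ f : BoundedContinuousFunction ℝ ℝ≥0, ∀ᵐ ω ∂P, ∃ c,
      Tendsto (fun t : ℚ => (N (max t 1) ω).testAgainstNN f) atTop (𝓝 c) := by
    intro f
    have hw : IsWeight (fun x => (f x : ℝ≥0∞)) (nndist f 0 : ℝ≥0) :=
      IsWeight.of_continuous f.continuous fun x => by
        have := f.nndist_coe_le_nndist (g := 0) x
        simpa [NNReal.nndist_zero_eq_val'] using this
    have heq : ∀ᵐ ω ∂P, ∀ t : ℚ, weightedLim Λ (fun x => (f x : ℝ≥0∞)) (1 / max (t : ℝ) 1) ω =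
        ∫⁻ x, f x ∂(cascadeMeasure D (1 / max (t : ℝ) 1) ω) :=
      ae_all_iff.2 fun t => hD.weightedLim_eq_ae hw (one_div_pos.2 (hpos t))
    filter_upwards [hM.ae_exists_tendsto_weightedLim hD hB hw, heq, hNt] with ω ⟨c, hc⟩ h1 h2
    have hval : ∀ t : ℚ, (weightedLim Λ (fun x => (f x : ℝ≥0∞)) (1 / max (t : ℝ) 1) ω).toReal =
        (N (max t 1) ω).testAgainstNN f := by
      intro t
      rw [h1 t, ← h2 t, ← FiniteMeasure.testAgainstNN_coe_eq]
      rfl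
    simp only [hval] at hc
    have hc0 : 0 ≤ c := ge_of_tendsto' hc fun t => NNReal.coe_nonneg _
    exact ⟨⟨c, hc0⟩, NNReal.tendsto_coe.1 hc⟩
  filter_upwards [hNt, ae_all_iff.2 fun k => htest (extendUnit (d k)),
    htest (BoundedContinuousFunction.const ℝ 1), hN.right_continuous] with ω h1 h2 h3 h4
  simp only [FiniteMeasure.testAgainstNN_const, one_mul] at h3
  have hsupp : ∀ t : ℚ, (N (max t 1) ω : Measure ℝ) (Icc 0 1)ᶜ = 0 := by
    intro t
    rw [h1 t, cascadeMeasure]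
    refine withDensity_absolutelyContinuous _ _ ?_
    rw [Measure.restrict_apply measurableSet_Icc.compl, compl_inter_self, measure_empty]
  obtain ⟨μ, hμ, hlim⟩ := exists_weak_limit hsupp
    (exists_tendsto_testAgainstNN_extendUnit (TopologicalSpace.denseRange_denseSeq _) h2 h3)
  have hreal : Tendsto (fun t => N t ω) atTop (𝓝 μ) := by
    refine FiniteMeasure.tendsto_iff_forall_testAgainstNN_tendsto.2 fun f => ?_
    refine tendsto_atTop_of_rat (fun t ht => ?_)
      (FiniteMeasure.tendsto_iff_forall_testAgainstNN_tendsto.1 hlim f)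
    exact FiniteMeasure.tendsto_iff_forall_testAgainstNN_tendsto.1 (h4 t ht) f
  refine ⟨μ, ?_, hμ, hreal⟩
  rw [limitMeasure, hreal.limUnder_eq]

end Model

/-! ### The masses of the two halves -/

lemma eventually_measureReal_lt {μ : FiniteMeasure ℝ} {ν : ℕ → FiniteMeasure ℝ}
    (h : Tendsto ν atTop (𝓝 μ)) {F : Set ℝ} (hF : IsClosed F) {δ : ℝ} (hδ : 0 < δ) :
    ∀ᶠ k in atTop, (ν k : Measure ℝ).real F < (μ : Measure ℝ).real F + δ := by
  have hlim := FiniteMeasure.limsup_measure_closed_le_of_tendsto h hF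
  have hlt : (μ : Measure ℝ) F < (μ : Measure ℝ) F + ENNReal.ofReal δ :=
    ENNReal.lt_add_right (measure_ne_top _ _) (by simpa using hδ)
  filter_upwards [eventually_lt_of_limsup_lt (hlim.trans_lt hlt)] with k hk
  have := (ENNReal.toReal_lt_toReal (measure_ne_top _ _)
    (ENNReal.add_ne_top.2 ⟨measure_ne_top _ _, ENNReal.ofReal_ne_top⟩)).2 hk
  rwa [ENNReal.toReal_add (measure_ne_top _ _) ENNReal.ofReal_ne_top,
    ENNReal.toReal_ofReal hδ.le] at this

/-- Weak convergence implies convergence of the masses on either side of a point which is not an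
atom of the limit. -/
lemma tendsto_measure_halfLines {μ : FiniteMeasure ℝ} {ν : ℕ → FiniteMeasure ℝ}
    (h : Tendsto ν atTop (𝓝 μ)) {c : ℝ} (hc : (μ : Measure ℝ) {c} = 0) :
    Tendsto (fun k => (ν k : Measure ℝ) (Iic c)) atTop (𝓝 ((μ : Measure ℝ) (Iic c))) ∧
      Tendsto (fun k => (ν k : Measure ℝ) (Ioi c)) atTop (𝓝 ((μ : Measure ℝ) (Ioi c))) := by
  have hsplit : ∀ m : FiniteMeasure ℝ,
      (m : Measure ℝ).real (Iic c) + (m : Measure ℝ).real (Ioi c) = m.mass := fun m => by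
    rw [← compl_Iic, measureReal_add_measureReal_compl measurableSet_Iic]
    rfl
  have hmass : Tendsto (fun k => ((ν k).mass : ℝ)) atTop (𝓝 (μ.mass : ℝ)) :=
    NNReal.tendsto_coe.2 ((FiniteMeasure.continuous_mass.tendsto _).comp h)
  have hIci : (μ : Measure ℝ).real (Ici c) = (μ : Measure ℝ).real (Ioi c) := by
    rw [measureReal_def, measureReal_def, ← Icc_union_Ioi_eq_Ici le_rfl, Icc_self]
    congr 1
    refine le_antisymm ((measure_union_le _ _).trans (by rw [hc, zero_add]))
      (measure_mono subset_union_right)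
  have hupper : ∀ δ > 0, ∀ᶠ k in atTop,
      (ν k : Measure ℝ).real (Iic c) < (μ : Measure ℝ).real (Iic c) + δ ∧
      (ν k : Measure ℝ).real (Ioi c) < (μ : Measure ℝ).real (Ioi c) + δ ∧
      dist ((ν k).mass : ℝ) (μ.mass : ℝ) < δ := by
    intro δ hδ
    filter_upwards [eventually_measureReal_lt h (isClosed_Iic (a := c)) hδ,
      eventually_measureReal_lt h (isClosed_Ici (a := c)) hδ,
      hmass.eventually (Metric.ball_mem_nhds _ hδ)] with k h1 h2 h3
    refine ⟨h1, ?_, h3⟩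
    rw [hIci] at h2
    exact (measureReal_mono Ioi_subset_Ici_self).trans_lt h2
  rw [← ENNReal.tendsto_toReal_iff (fun _ => measure_ne_top _ _) (measure_ne_top _ _),
    ← ENNReal.tendsto_toReal_iff (fun _ => measure_ne_top _ _) (measure_ne_top _ _)]
  constructor <;>
  · rw [Metric.tendsto_atTop']
    intro η hη
    obtain ⟨k₀, hk₀⟩ := eventually_atTop.1 (hupper (η / 2) (half_pos hη))
    refine ⟨k₀, fun k hk => ?_⟩
    obtain ⟨h1, h2, h3⟩ := hk₀ k hk.le
    have e1 := hsplit (ν k)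
    have e2 := hsplit μ
    rw [Real.dist_eq, abs_lt] at h3
    simp only [measureReal_def] at h1 h2 e1 e2
    rw [Real.dist_eq, abs_lt]
    constructor <;> linarith [h3.1, h3.2]

section Model

variable {Ω : Type*} [MeasurableSpace Ω] {P : Measure Ω} [IsProbabilityMeasure P] {ψ : ℂ → ℂ}
  {Λ : Set (ℝ × ℝ) → Ω → ℝ} {Ψ : ℝ → ℝ} {ζ : ℝ} {D : ℝ → ℝ → Ω → ℝ}
  {N : ℝ → Ω → FiniteMeasure ℝ}

lemma isWeight_one : IsWeight (fun _ => 1) 1 where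
  ne_top := ENNReal.one_ne_top
  le _ := le_rfl
  right_cont := ae_of_all _ fun _ => tendsto_const_nhds

/-- The weight which selects the left half `[0, 1/2]`. -/
noncomputable def leftWeight : ℝ → ℝ≥0∞ := (Iic (1 / 2)).indicator fun _ => 1

/-- The weight which selects the right half `(1/2, 1]`. -/
noncomputable def rightWeight : ℝ → ℝ≥0∞ := (Ioi (1 / 2)).indicator fun _ => 1

lemma isWeight_leftWeight : IsWeight leftWeight 1 := IsWeight.indicator (by simp)

lemma isWeight_rightWeight : IsWeight rightWeight 1 := IsWeight.indicator (by simp)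

lemma weightedSum_one (ε : ℝ) (n : ℕ) (ω : Ω) :
    weightedSum Λ (fun _ => 1) ε n ω = block Λ ε n 0 (2 ^ n) ω := by
  simp [weightedSum, block]

lemma gridPoint_le_half_iff {n i : ℕ} : gridPoint (n + 1) i ≤ 1 / 2 ↔ i < 2 ^ n := by
  rw [gridPoint, div_le_div_iff₀ (by positivity) two_pos, pow_succ, one_mul,
    mul_le_mul_iff_left₀ two_pos, ← Nat.succ_le_iff]
  exact_mod_cast Iff.rfl

lemma weightedSum_halves (ε : ℝ) (n : ℕ) (ω : Ω) :
    weightedSum Λ leftWeight ε (n + 1) ω = block Λ ε (n + 1) 0 (2 ^ n) ω ∧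
      weightedSum Λ rightWeight ε (n + 1) ω = block Λ ε (n + 1) (2 ^ n) (2 ^ n) ω := by
  have h0 : ∀ i ∈ Finset.range (2 ^ n), gridPoint (n + 1) i ≤ 1 / 2 := fun i hi =>
    gridPoint_le_half_iff.2 (Finset.mem_range.1 hi)
  have h1 : ∀ i, 1 / 2 < gridPoint (n + 1) (2 ^ n + i) := fun i =>
    not_le.1 fun h => absurd (gridPoint_le_half_iff.1 h) (by simp)
  have h2 : 2 ^ (n + 1) = 2 ^ n + 2 ^ n := by ring
  constructor
  · rw [weightedSum, block, h2, Finset.sum_range_add, Finset.sum_eq_zero (s := Finset.range (2 ^ n))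
      (f := fun i => (2 ^ (n + 1))⁻¹ * (leftWeight (gridPoint (n + 1) (2 ^ n + i)) *
        density Λ ε (gridPoint (n + 1) (2 ^ n + i)) ω)), add_zero]
    · refine Finset.sum_congr rfl fun i hi => ?_
      rw [leftWeight, indicator_of_mem (mem_Iic.2 (h0 i hi)), one_mul, zero_add]
    · intro i _
      rw [leftWeight, indicator_of_notMem (fun h => not_lt.2 (mem_Iic.1 h) (h1 i)), zero_mul,
        mul_zero]
  · rw [weightedSum, block, h2, Finset.sum_range_add, Finset.sum_eq_zero (s := Finset.range (2 ^ n))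
      (f := fun i => (2 ^ (n + 1))⁻¹ * (rightWeight (gridPoint (n + 1) i) *
        density Λ ε (gridPoint (n + 1) i) ω)), zero_add]
    · refine Finset.sum_congr rfl fun i hi => ?_
      rw [rightWeight, indicator_of_mem (mem_Ioi.2 (h1 i)), one_mul]
    · intro i hi
      rw [rightWeight, indicator_of_notMem (fun h => not_lt.2 (h0 i hi) (mem_Ioi.1 h)), zero_mul,
        mul_zero]

/-- The limit measure has no atom at `1/2`: the expected integral of a function is its Lebesgue
integral. -/
lemma IsCascadeModel.ae_limitMeasure_half (hM : IsCascadeModel P ψ Λ Ψ ζ)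
    (hD : IsCadlagDensity P Λ D) (hN : IsRightContinuousVersion P D N) {p : ℝ} {C : ℝ≥0∞}
    (hB : HasMomentBound P Λ p C) : ∀ᵐ ω ∂P, limitMeasure N ω {1 / 2} = 0 := by
  let δ : ℕ → ℝ := fun m => 1 / (m + 1)
  have hδ : ∀ m, 0 < δ m := fun m => by positivity
  let f : ℕ → BoundedContinuousFunction ℝ ℝ≥0 := fun m => thickenedIndicator (hδ m) {1 / 2}
  have hw : ∀ m, IsWeight (fun x => (f m x : ℝ≥0∞)) (1 : ℝ≥0) := fun m =>
    IsWeight.of_continuous (f m).continuous fun x => thickenedIndicator_le_one (hδ m) _ x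
  let ε : ℕ → ℝ := fun k => 1 / ((k : ℝ) + 1)
  have hε : ∀ k, 0 < ε k := fun k => by positivity
  let G : ℕ → Ω → ℝ≥0∞ := fun m ω =>
    liminf (fun k => weightedLim Λ (fun x => (f m x : ℝ≥0∞)) (ε k) ω) atTop
  have hmeas : ∀ m k, Measurable (weightedLim Λ (fun x => (f m x : ℝ≥0∞)) (ε k)) := fun m k =>
    (measurable_weightedLim_regionSigma _ (hε k)).mono (hM.scattered.regionSigma_le _) le_rfl
  have hGm : ∀ m, Measurable (G m) := fun m => Measurable.liminf (hmeas m)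
  have hG : ∀ m, ∫⁻ ω, G m ω ∂P ≤ ENNReal.ofReal (2 * δ m) := by
    intro m
    refine (lintegral_liminf_le (hmeas m)).trans (liminf_le_of_frequently_le'
      (Frequently.of_forall fun k => ?_))
    rw [hM.lintegral_weightedLim hD hB (hw m) (hε k)]
    calc ∫⁻ x in Icc 0 1, (f m x : ℝ≥0∞) ≤ ∫⁻ x, (f m x : ℝ≥0∞) := setLIntegral_le_lintegral _ _
      _ ≤ ∫⁻ x, (Metric.ball (1 / 2 : ℝ) (δ m)).indicator 1 x := by
        refine lintegral_mono fun x => ?_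
        by_cases hx : x ∈ Metric.ball (1 / 2 : ℝ) (δ m)
        · rw [indicator_of_mem hx]
          exact ENNReal.coe_le_coe.2 (thickenedIndicator_le_one (hδ m) _ x)
        · have : f m x = 0 := thickenedIndicator_zero (hδ m) _ (by rwa [Metric.thickening_singleton])
          simp [this]
      _ = ENNReal.ofReal (2 * δ m) := by
        rw [lintegral_indicator_one Metric.isOpen_ball.measurableSet, Real.volume_ball]
  have hzero : ∀ᵐ ω ∂P, (⨅ m, G m ω) = 0 := by
    refine (lintegral_eq_zero_iff (Measurable.iInf hGm)).1 (le_antisymm ?_ zero_le)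
    have hlim : Tendsto (fun m => ENNReal.ofReal (2 * δ m)) atTop (𝓝 0) := by
      have := (ENNReal.continuous_ofReal.tendsto _).comp
        ((tendsto_one_div_add_atTop_nhds_zero_nat (𝕜 := ℝ)).const_mul 2)
      simpa [Function.comp_def, δ] using this
    exact ge_of_tendsto' hlim fun m => (lintegral_mono fun ω => iInf_le _ m).trans (hG m)
  have heq : ∀ᵐ ω ∂P, ∀ m k, weightedLim Λ (fun x => (f m x : ℝ≥0∞)) (ε k) ω =
      ∫⁻ x, f m x ∂(cascadeMeasure D (ε k) ω) :=
    ae_all_iff.2 fun m => ae_all_iff.2 fun k => hD.weightedLim_eq_ae (hw m) (hε k)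
  have hNk : ∀ᵐ ω ∂P, ∀ k : ℕ, (N ((k : ℝ) + 1) ω : Measure ℝ) = cascadeMeasure D (ε k) ω :=
    ae_all_iff.2 fun k => hN.modification _ (by positivity)
  filter_upwards [hzero, heq, hNk, hM.ae_tendsto_limitMeasure hD hN hB] with ω h0 h1 h2
    ⟨μ, hμ, _, hlim⟩
  rw [hμ]
  refine le_antisymm (h0 ▸ le_iInf fun m => ?_) zero_le
  have hseq := hlim.comp (tendsto_natCast_atTop_atTop (R := ℝ) |>.atTop_add
    (tendsto_const_nhds (x := (1 : ℝ))))
  have hint := FiniteMeasure.tendsto_iff_forall_lintegral_tendsto.1 hseq (f m)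
  have hval : G m ω = ∫⁻ x, f m x ∂(μ : Measure ℝ) := by
    refine Tendsto.liminf_eq (hint.congr fun k => ?_)
    rw [h1, ← h2]
    rfl
  rw [hval, ← lintegral_indicator_one (measurableSet_singleton (1 / 2 : ℝ))]
  refine lintegral_mono fun x => ?_
  by_cases hx : x ∈ ({1 / 2} : Set ℝ)
  · rw [indicator_of_mem hx, thickenedIndicator_one (hδ m) _ hx]
    simp
  · rw [indicator_of_notMem hx]
    exact zero_le

/-- The masses of `[0, 1/2]` and `[1/2, 1]` are almost sure limits, along any sequence of scales
tending to `0`, and add up to the total mass. -/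
lemma IsCascadeModel.ae_tendsto_halves (hM : IsCascadeModel P ψ Λ Ψ ζ)
    (hD : IsCadlagDensity P Λ D) (hN : IsRightContinuousVersion P D N) {p : ℝ} {C : ℝ≥0∞}
    (hB : HasMomentBound P Λ p C) {t : ℕ → ℝ} (ht0 : ∀ k, 0 < t k)
    (ht : Tendsto t atTop atTop) : ∀ᵐ ω ∂P,
      Tendsto (fun k => weightedLim Λ leftWeight (1 / t k) ω) atTop
        (𝓝 (limitMeasure N ω (Icc 0 (1 / 2)))) ∧
      Tendsto (fun k => weightedLim Λ rightWeight (1 / t k) ω) atTop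
        (𝓝 (limitMeasure N ω (Icc (1 / 2) 1))) ∧
      Tendsto (fun k => weightedLim Λ (fun _ => 1) (1 / t k) ω) atTop
        (𝓝 (limitMeasure N ω (Icc 0 1))) ∧
      limitMeasure N ω (Icc 0 1) =
        limitMeasure N ω (Icc 0 (1 / 2)) + limitMeasure N ω (Icc (1 / 2) 1) ∧
      limitMeasure N ω (Icc 0 1) < ⊤ := by
  have hε : ∀ k, 0 < 1 / t k := fun k => one_div_pos.2 (ht0 k)
  have heq : ∀ᵐ ω ∂P, ∀ k,
      weightedLim Λ leftWeight (1 / t k) ω = cascadeMeasure D (1 / t k) ω (Iic (1 / 2)) ∧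
      weightedLim Λ rightWeight (1 / t k) ω = cascadeMeasure D (1 / t k) ω (Ioi (1 / 2)) ∧
      weightedLim Λ (fun _ => 1) (1 / t k) ω = cascadeMeasure D (1 / t k) ω univ := by
    refine ae_all_iff.2 fun k => ?_
    filter_upwards [hD.weightedLim_eq_ae isWeight_leftWeight (hε k),
      hD.weightedLim_eq_ae isWeight_rightWeight (hε k),
      hD.weightedLim_eq_ae isWeight_one (hε k)] with ω h1 h2 h3
    rw [h1, h2, h3]
    exact ⟨lintegral_indicator_one measurableSet_Iic, lintegral_indicator_one measurableSet_Ioi,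
      lintegral_one⟩
  have hNk : ∀ᵐ ω ∂P, ∀ k, (N (t k) ω : Measure ℝ) = cascadeMeasure D (1 / t k) ω :=
    ae_all_iff.2 fun k => hN.modification _ (ht0 k)
  filter_upwards [heq, hNk, hM.ae_tendsto_limitMeasure hD hN hB,
    hM.ae_limitMeasure_half hD hN hB] with ω h1 h2 ⟨μ, hμ, hsupp, hlim⟩ hatom
  rw [hμ] at hatom ⊢
  have hseq : Tendsto (fun k => N (t k) ω) atTop (𝓝 μ) := hlim.comp ht
  obtain ⟨hl, hr⟩ := tendsto_measure_halfLines hseq hatom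
  have hae : ∀ᵐ x ∂(μ : Measure ℝ), x ∈ Icc (0 : ℝ) 1 := by
    rw [ae_iff]
    exact hsupp
  have hae2 : ∀ᵐ x ∂(μ : Measure ℝ), x ≠ 1 / 2 := by
    rw [ae_iff]
    simpa using hatom
  have e0 : (μ : Measure ℝ) (Icc 0 (1 / 2)) = (μ : Measure ℝ) (Iic (1 / 2)) := by
    refine measure_congr ?_
    filter_upwards [hae] with x hx
    exact propext ⟨fun h => h.2, fun h => ⟨hx.1, h⟩⟩
  have e1 : (μ : Measure ℝ) (Icc (1 / 2) 1) = (μ : Measure ℝ) (Ioi (1 / 2)) := by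
    refine measure_congr ?_
    filter_upwards [hae, hae2] with x hx hx2
    exact propext ⟨fun h => lt_of_le_of_ne h.1 hx2.symm, fun h => ⟨le_of_lt h, hx.2⟩⟩
  have e2 : (μ : Measure ℝ) (Icc 0 1) = (μ : Measure ℝ) univ := by
    refine measure_congr ?_
    filter_upwards [hae] with x hx
    exact propext ⟨fun _ => trivial, fun _ => hx⟩
  have hmass : Tendsto (fun k => (N (t k) ω : Measure ℝ) univ) atTop
      (𝓝 ((μ : Measure ℝ) univ)) := by
    have := ENNReal.tendsto_coe.2 ((FiniteMeasure.continuous_mass.tendsto _).comp hseq)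
    simpa only [FiniteMeasure.ennreal_mass, Function.comp_def] using this
  rw [e0, e1, e2]
  refine ⟨hl.congr fun k => ?_, hr.congr fun k => ?_, hmass.congr fun k => ?_, ?_, measure_lt_top _ _⟩
  · rw [(h1 k).1, h2]
  · rw [(h1 k).2.1, h2]
  · rw [(h1 k).2.2, h2]
  · rw [← measure_add_measure_compl (measurableSet_Iic (a := (1 / 2 : ℝ))), compl_Iic]

end Model

/-! ### The mixed moment of the two halves -/

lemma lintegral_le_of_ae_tendsto {α : Type*} [MeasurableSpace α] {μ : Measure α}
    {f : ℕ → α → ℝ≥0∞} {g : α → ℝ≥0∞} {C : ℝ≥0∞} (hf : ∀ n, AEMeasurable (f n) μ)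
    (hlim : ∀ᵐ a ∂μ, Tendsto (fun n => f n a) atTop (𝓝 (g a)))
    (hbd : ∀ᶠ n in atTop, ∫⁻ a, f n a ∂μ ≤ C) : ∫⁻ a, g a ∂μ ≤ C :=
  calc ∫⁻ a, g a ∂μ = ∫⁻ a, liminf (fun n => f n a) atTop ∂μ :=
        lintegral_congr_ae (hlim.mono fun _ h => h.liminf_eq.symm)
    _ ≤ liminf (fun n => ∫⁻ a, f n a ∂μ) atTop := lintegral_liminf_le' hf
    _ ≤ C := liminf_le_of_frequently_le' hbd.frequently

lemma tendsto_crossFun {κ : ℝ} {f g : ℕ → ℝ≥0∞} {x y : ℝ≥0∞} (hκ : 0 ≤ κ) (hx : x ≠ ⊤)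
    (hy : y ≠ ⊤) (hf : Tendsto f atTop (𝓝 x)) (hg : Tendsto g atTop (𝓝 y)) :
    Tendsto (fun n => crossFun κ (f n) (g n)) atTop (𝓝 (crossFun κ x y)) :=
  (ENNReal.Tendsto.mul hf (Or.inr (ENNReal.rpow_ne_top_of_nonneg hκ hy))
      (((ENNReal.continuous_rpow_const (y := κ)).tendsto _).comp hg) (Or.inr hx)).add
    (ENNReal.Tendsto.mul hg (Or.inr (ENNReal.rpow_ne_top_of_nonneg hκ hx))
      (((ENNReal.continuous_rpow_const (y := κ)).tendsto _).comp hf) (Or.inr hy))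

section Model

variable {Ω : Type*} [MeasurableSpace Ω] {P : Measure Ω} [IsProbabilityMeasure P] {ψ : ℂ → ℂ}
  {Λ : Set (ℝ × ℝ) → Ω → ℝ} {Ψ : ℝ → ℝ} {ζ : ℝ} {D : ℝ → ℝ → Ω → ℝ}
  {N : ℝ → Ω → FiniteMeasure ℝ} {p : ℝ} {C : ℝ≥0∞}

lemma IsScatteredMeasure.measurable_weightedLim (hΛ : IsScatteredMeasure P ψ Λ) (w : ℝ → ℝ≥0∞)
    {ε : ℝ} (hε : 0 < ε) : Measurable (weightedLim Λ w ε) :=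
  (measurable_weightedLim_regionSigma w hε).mono (hΛ.regionSigma_le _) le_rfl

lemma IsCascadeModel.ae_weightedLim_lt_top (hM : IsCascadeModel P ψ Λ Ψ ζ)
    (hD : IsCadlagDensity P Λ D) (hB : HasMomentBound P Λ p C) {w : ℝ → ℝ≥0∞} {b : ℝ≥0∞}
    (hw : IsWeight w b) {ε : ℝ} (hε : 0 < ε) : ∀ᵐ ω ∂P, weightedLim Λ w ε ω < ⊤ := by
  refine ae_lt_top (hM.scattered.measurable_weightedLim w hε) ?_
  rw [hM.lintegral_weightedLim hD hB hw hε]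
  refine ne_top_of_le_ne_top (b := ∫⁻ _ in Icc (0 : ℝ) 1, b) ?_ (lintegral_mono fun x => hw.le x)
  simpa using hw.ne_top

lemma IsCascadeModel.lintegral_crossFun_weightedLim_le (hM : IsCascadeModel P ψ Λ Ψ ζ)
    (hD : IsCadlagDensity P Λ D) (hB : HasMomentBound P Λ p C) {K : ℝ≥0∞}
    (hK : ∀ (n : ℕ) (ε : ℝ), 0 < ε → 1 ≤ 2 ^ (n + 1) * ε →
      ∫⁻ ω, crossFun (ζ - 1) (block Λ ε (n + 1) 0 (2 ^ n) ω)
        (block Λ ε (n + 1) (2 ^ n) (2 ^ n) ω) ∂P ≤ K) {ε : ℝ} (hε : 0 < ε) :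
    ∫⁻ ω, crossFun (ζ - 1) (weightedLim Λ leftWeight ε ω) (weightedLim Λ rightWeight ε ω) ∂P
      ≤ K := by
  have hΛ := hM.scattered
  have hκ : 0 ≤ ζ - 1 := by linarith [hM.one_lt]
  refine lintegral_le_of_ae_tendsto (f := fun n ω => crossFun (ζ - 1)
    (weightedSum Λ leftWeight ε (n + 1) ω) (weightedSum Λ rightWeight ε (n + 1) ω))
    (fun n => ((measurable_crossFun (ζ - 1)).comp
      ((hΛ.measurable_weightedSum leftWeight hε (n + 1)).prodMk
        (hΛ.measurable_weightedSum rightWeight hε (n + 1)))).aemeasurable) ?_ ?_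
  · filter_upwards [hD.ae_tendsto_weightedLim isWeight_leftWeight hε,
      hD.ae_tendsto_weightedLim isWeight_rightWeight hε,
      hM.ae_weightedLim_lt_top hD hB isWeight_leftWeight hε,
      hM.ae_weightedLim_lt_top hD hB isWeight_rightWeight hε] with ω h1 h2 h3 h4
    exact tendsto_crossFun hκ h3.ne h4.ne (h1.comp (tendsto_add_atTop_nat 1))
      (h2.comp (tendsto_add_atTop_nat 1))
  · filter_upwards [(tendsto_add_atTop_nat 1).eventually (eventually_one_le_two_pow_mul hε)]
      with n hn
    simp_rw [(weightedSum_halves (Λ := Λ) ε n _).1, (weightedSum_halves (Λ := Λ) ε n _).2]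
    exact hK n ε hε hn

lemma tendsto_natCast_add_one_atTop : Tendsto (fun k : ℕ => (k : ℝ) + 1) atTop atTop :=
  tendsto_natCast_atTop_atTop.atTop_add tendsto_const_nhds

lemma IsCascadeModel.aemeasurable_limitMeasure (hM : IsCascadeModel P ψ Λ Ψ ζ)
    (hD : IsCadlagDensity P Λ D) (hN : IsRightContinuousVersion P D N)
    (hB : HasMomentBound P Λ p C) :
    AEMeasurable (fun ω => limitMeasure N ω (Icc 0 (1 / 2))) P ∧
      AEMeasurable (fun ω => limitMeasure N ω (Icc (1 / 2) 1)) P ∧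
      AEMeasurable (fun ω => limitMeasure N ω (Icc 0 1)) P := by
  have h := hM.ae_tendsto_halves hD hN hB (t := fun k => (k : ℝ) + 1) (fun k => by positivity)
    tendsto_natCast_add_one_atTop
  have hm : ∀ w (k : ℕ), AEMeasurable (weightedLim Λ w (1 / ((k : ℝ) + 1))) P := fun w k =>
    (hM.scattered.measurable_weightedLim w (by positivity)).aemeasurable
  exact ⟨aemeasurable_of_tendsto_metrizable_ae atTop (hm leftWeight) (h.mono fun _ h => h.1),
    aemeasurable_of_tendsto_metrizable_ae atTop (hm rightWeight) (h.mono fun _ h => h.2.1),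
    aemeasurable_of_tendsto_metrizable_ae atTop (hm fun _ => 1) (h.mono fun _ h => h.2.2.1)⟩

lemma IsCascadeModel.lintegral_mul_rpow_lt_top (hM : IsCascadeModel P ψ Λ Ψ ζ)
    (hD : IsCadlagDensity P Λ D) (hN : IsRightContinuousVersion P D N)
    (hB : HasMomentBound P Λ p C) (hφ : ∀ q ∈ Ioo 1 ζ, structureFun Ψ q < 0)
    (hφζ : structureFun Ψ ζ = 0) :
    ∫⁻ ω, limitMeasure N ω (Icc 0 (1 / 2)) * limitMeasure N ω (Icc (1 / 2) 1) ^ (ζ - 1) ∂P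
      < ⊤ := by
  obtain ⟨K, hKt, hK⟩ := hM.exists_lintegral_crossFun_le hφ hφζ
  have hκ : 0 ≤ ζ - 1 := by linarith [hM.one_lt]
  have hε : ∀ k : ℕ, 0 < 1 / ((k : ℝ) + 1) := fun k => by positivity
  have h : ∫⁻ ω, crossFun (ζ - 1) (limitMeasure N ω (Icc 0 (1 / 2)))
      (limitMeasure N ω (Icc (1 / 2) 1)) ∂P ≤ K := by
    refine lintegral_le_of_ae_tendsto (f := fun k ω => crossFun (ζ - 1)
      (weightedLim Λ leftWeight (1 / ((k : ℝ) + 1)) ω)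
      (weightedLim Λ rightWeight (1 / ((k : ℝ) + 1)) ω))
      (fun k => ((measurable_crossFun (ζ - 1)).comp
        ((hM.scattered.measurable_weightedLim leftWeight (hε k)).prodMk
          (hM.scattered.measurable_weightedLim rightWeight (hε k)))).aemeasurable) ?_
      (Eventually.of_forall fun k => hM.lintegral_crossFun_weightedLim_le hD hB hK (hε k))
    filter_upwards [hM.ae_tendsto_halves hD hN hB (t := fun k => (k : ℝ) + 1)
      (fun k => by positivity) tendsto_natCast_add_one_atTop] with ω ⟨h1, h2, _, h3, h4⟩
    rw [h3, ENNReal.add_lt_top] at h4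
    exact tendsto_crossFun hκ h4.1.ne h4.2.ne h1 h2
  exact ((lintegral_mono fun ω => le_self_add).trans h).trans_lt hKt.lt_top

/-! ### Scaling of the moments of the limit -/

lemma IsCascadeModel.lintegral_min_block (hM : IsCascadeModel P ψ Λ Ψ ζ) {ε : ℝ}
    (hε0 : 0 < ε) (hε : ε ≤ 1 / 2) {n a : ℕ} (ha : a ≤ 2 ^ n) {q : ℝ} (hq : q ∈ Icc 0 ζ)
    (K : ℝ≥0∞) :
    ∫⁻ ω, min (block Λ ε (n + 1) a (2 ^ n) ω ^ q)
        ((2⁻¹ * factor Λ (halfGap (a / 2 ^ (n + 1))) ω) ^ q * K) ∂P =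
      (∫⁻ ω, (2⁻¹ * factor Λ (halfGap (a / 2 ^ (n + 1))) ω) ^ q ∂P) *
        ∫⁻ ω, min (block Λ (2 * ε) n 0 (2 ^ n) ω ^ q) K ∂P := by
  have h := hM.scattered.lintegral_block_scaling hε0 hε ha (b₁ := 0) (m₁ := 2 ^ n) (b₂ := 0)
    (m₂ := 0) (by omega) (by omega) (g := fun w => (2⁻¹ * w) ^ q) (by fun_prop)
    (F := fun x _ => min (x ^ q) K) ((measurable_fst.pow_const q).min measurable_const)
  rw [← h]
  refine lintegral_congr fun ω => ?_
  set W := factor Λ (halfGap (a / 2 ^ (n + 1))) ω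
  have hW0 : W ≠ 0 := factor_ne_zero _ _
  have hWt : W ≠ ⊤ := factor_ne_top _ _
  have hcancel : 2⁻¹ * W * (2 * W⁻¹) = 1 := by
    rw [mul_mul_mul_comm, ENNReal.inv_mul_cancel (by simp) (by simp),
      ENNReal.mul_inv_cancel hW0 hWt, one_mul]
  rw [add_zero, mul_min, ← ENNReal.mul_rpow_of_nonneg _ _ hq.1, ← mul_assoc (2⁻¹ * W), hcancel,
    one_mul]

lemma IsCascadeModel.lintegral_half_mul_halfGap_rpow (hM : IsCascadeModel P ψ Λ Ψ ζ) {c : ℝ}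
    (hc : c ∈ Icc (0 : ℝ) (1 / 2)) {q : ℝ} (hq : q ∈ Icc 0 ζ) :
    ∫⁻ ω, (2⁻¹ * factor Λ (halfGap c) ω) ^ q ∂P = 2 ^ (structureFun Ψ q - 1) := by
  simp_rw [ENNReal.mul_rpow_of_nonneg _ _ hq.1]
  rw [lintegral_const_mul' _ _ (ENNReal.rpow_ne_top_of_nonneg hq.1 (by simp)),
    hM.lintegral_halfGap_rpow hc hq, ENNReal.inv_rpow, ← ENNReal.rpow_neg,
    ← ENNReal.rpow_add _ _ (by simp) (by simp)]
  congr 1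
  unfold structureFun
  ring

/-- The weight `w` selects the interval `[c, c + 1/2]`, which consists of half of the cells of each
grid. -/
structure IsHalfWeight (Λ : Set (ℝ × ℝ) → Ω → ℝ) (w : ℝ → ℝ≥0∞) (c : ℝ) : Prop where
  isWeight : IsWeight w 1
  mem : c ∈ Icc (0 : ℝ) (1 / 2)
  exists_block : ∀ n : ℕ, ∃ a : ℕ, a ≤ 2 ^ n ∧ (a : ℝ) / 2 ^ (n + 1) = c ∧
    ∀ (ε : ℝ) (ω : Ω), weightedSum Λ w ε (n + 1) ω = block Λ ε (n + 1) a (2 ^ n) ω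

lemma isHalfWeight_leftWeight : IsHalfWeight Λ leftWeight 0 where
  isWeight := isWeight_leftWeight
  mem := by norm_num
  exists_block n := ⟨0, Nat.zero_le _, by simp, fun ε ω => (weightedSum_halves ε n ω).1⟩

lemma isHalfWeight_rightWeight : IsHalfWeight Λ rightWeight (1 / 2) where
  isWeight := isWeight_rightWeight
  mem := by norm_num
  exists_block n := ⟨2 ^ n, le_rfl, by push_cast; rw [pow_succ]; field_simp,
    fun ε ω => (weightedSum_halves ε n ω).2⟩

lemma tendsto_min_rpow {f : ℕ → ℝ≥0∞} {x : ℝ≥0∞} (hf : Tendsto f atTop (𝓝 x)) (q : ℝ)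
    (K : ℝ≥0∞) : Tendsto (fun n => min (f n ^ q) K) atTop (𝓝 (min (x ^ q) K)) :=
  (((ENNReal.continuous_rpow_const (y := q)).tendsto _).comp hf).min tendsto_const_nhds

/-- Exact scaling: the mass at scale `ε` of one half of `[0, 1]` is distributed as `W / 2` times the
total mass at scale `2 ε`, with an independent `W`; here in the form of truncated moments. The
truncation is the one that dominated convergence allows to keep in all the limits. -/
lemma IsCascadeModel.lintegral_min_weightedLim (hM : IsCascadeModel P ψ Λ Ψ ζ)
    (hD : IsCadlagDensity P Λ D) {w : ℝ → ℝ≥0∞} {c : ℝ} (hw : IsHalfWeight Λ w c) {ε : ℝ}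
    (hε0 : 0 < ε) (hε : ε ≤ 1 / 2) {q : ℝ} (hq : q ∈ Icc 0 ζ) {K : ℝ≥0∞} (hK : K ≠ ⊤) :
    ∫⁻ ω, min (weightedLim Λ w ε ω ^ q) ((2⁻¹ * factor Λ (halfGap c) ω) ^ q * K) ∂P =
      2 ^ (structureFun Ψ q - 1) *
        ∫⁻ ω, min (weightedLim Λ (fun _ => 1) (2 * ε) ω ^ q) K ∂P := by
  have hΛ := hM.scattered
  have h2ε : 0 < 2 * ε := by positivity
  have hg : Measurable fun ω => (2⁻¹ * factor Λ (halfGap c) ω) ^ q * K :=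
    (((hΛ.measurable_factor (halfGap_mem_finiteAreaSets hw.mem)).const_mul _).pow_const _).mul_const _
  have hgi : ∫⁻ ω, (2⁻¹ * factor Λ (halfGap c) ω) ^ q * K ∂P ≠ ⊤ := by
    rw [lintegral_mul_const' _ _ hK, hM.lintegral_half_mul_halfGap_rpow hw.mem hq]
    exact ENNReal.mul_ne_top (ENNReal.rpow_ne_top_of_ne_zero (by simp) (by simp)) hK
  have hstep : ∀ n : ℕ,
      ∫⁻ ω, min (weightedSum Λ w ε (n + 1) ω ^ q) ((2⁻¹ * factor Λ (halfGap c) ω) ^ q * K) ∂P =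
      2 ^ (structureFun Ψ q - 1) *
        ∫⁻ ω, min (weightedSum Λ (fun _ => 1) (2 * ε) n ω ^ q) K ∂P := by
    intro n
    obtain ⟨a, ha, hac, hsum⟩ := hw.exists_block n
    have h := hM.lintegral_min_block hε0 hε ha hq K
    rw [hac, hM.lintegral_half_mul_halfGap_rpow hw.mem hq] at h
    simp_rw [hsum, weightedSum_one]
    exact h
  have hl : Tendsto (fun n : ℕ => ∫⁻ ω, min (weightedSum Λ w ε (n + 1) ω ^ q)
      ((2⁻¹ * factor Λ (halfGap c) ω) ^ q * K) ∂P) atTop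
      (𝓝 (∫⁻ ω, min (weightedLim Λ w ε ω ^ q) ((2⁻¹ * factor Λ (halfGap c) ω) ^ q * K) ∂P)) := by
    refine tendsto_lintegral_of_dominated_convergence _
      (fun n => ((hΛ.measurable_weightedSum w hε0 _).pow_const q).min hg)
      (fun n => ae_of_all _ fun ω => min_le_right _ _) hgi ?_
    filter_upwards [hD.ae_tendsto_weightedLim hw.isWeight hε0] with ω h
    exact tendsto_min_rpow (h.comp (tendsto_add_atTop_nat 1)) q _
  have hr : Tendsto (fun n : ℕ => ∫⁻ ω, min (weightedSum Λ (fun _ => 1) (2 * ε) n ω ^ q) K ∂P)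
      atTop (𝓝 (∫⁻ ω, min (weightedLim Λ (fun _ => 1) (2 * ε) ω ^ q) K ∂P)) := by
    refine tendsto_lintegral_of_dominated_convergence (fun _ => K)
      (fun n => ((hΛ.measurable_weightedSum _ h2ε _).pow_const q).min measurable_const)
      (fun n => ae_of_all _ fun ω => min_le_right _ _) (by simpa using hK) ?_
    filter_upwards [hD.ae_tendsto_weightedLim isWeight_one h2ε] with ω h
    exact tendsto_min_rpow h q _
  simp_rw [hstep] at hl
  exact tendsto_nhds_unique hl (ENNReal.Tendsto.const_mul hr
    (Or.inr (ENNReal.rpow_ne_top_of_ne_zero (by simp) (by simp))))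

lemma tendsto_lintegral_min_rpow_natCast {α : Type*} [MeasurableSpace α] {μ : Measure α}
    {X Y : α → ℝ≥0∞} (hX : AEMeasurable X μ) (hY : AEMeasurable Y μ) (hY0 : ∀ a, Y a ≠ 0) (q : ℝ) :
    Tendsto (fun K : ℕ => ∫⁻ a, min (X a ^ q) (Y a * K) ∂μ) atTop (𝓝 (∫⁻ a, X a ^ q ∂μ)) := by
  refine lintegral_tendsto_of_tendsto_of_monotone
    (fun K => (hX.pow_const q).min (hY.mul_const _))
    (ae_of_all _ fun a K L h => min_le_min_left _ (by gcongr)) (ae_of_all _ fun a => ?_)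
  have h : Tendsto (fun K : ℕ => Y a * (K : ℝ≥0∞)) atTop (𝓝 ⊤) := by
    have := ENNReal.Tendsto.const_mul (a := Y a) ENNReal.tendsto_nat_nhds_top
      (Or.inl ENNReal.top_ne_zero)
    rwa [ENNReal.mul_top (hY0 a)] at this
  simpa using (tendsto_const_nhds (x := X a ^ q)).min h

/-- The moments of the mass of either half of `[0, 1]`, in terms of those of the total mass. -/
lemma IsCascadeModel.lintegral_rpow_of_tendsto (hM : IsCascadeModel P ψ Λ Ψ ζ)
    (hD : IsCadlagDensity P Λ D) {w : ℝ → ℝ≥0∞} {c : ℝ} (hw : IsHalfWeight Λ w c)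
    {X Z : Ω → ℝ≥0∞}
    (hX : ∀ᵐ ω ∂P, Tendsto (fun k : ℕ => weightedLim Λ w (1 / (2 * ((k : ℝ) + 1))) ω) atTop
      (𝓝 (X ω)))
    (hZ : ∀ᵐ ω ∂P, Tendsto (fun k : ℕ => weightedLim Λ (fun _ => 1) (1 / ((k : ℝ) + 1)) ω) atTop
      (𝓝 (Z ω))) {q : ℝ} (hq : q ∈ Icc 0 ζ) :
    ∫⁻ ω, X ω ^ q ∂P = 2 ^ (structureFun Ψ q - 1) * ∫⁻ ω, Z ω ^ q ∂P := by
  have hΛ := hM.scattered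
  have hε : ∀ k : ℕ, 0 < 1 / (2 * ((k : ℝ) + 1)) := fun k => by positivity
  have hε' : ∀ k : ℕ, 0 < 1 / ((k : ℝ) + 1) := fun k => by positivity
  have hXm : AEMeasurable X P := aemeasurable_of_tendsto_metrizable_ae atTop
    (fun k => (hΛ.measurable_weightedLim w (hε k)).aemeasurable) hX
  have hZm : AEMeasurable Z P := aemeasurable_of_tendsto_metrizable_ae atTop
    (fun k => (hΛ.measurable_weightedLim (fun _ => 1) (hε' k)).aemeasurable) hZ
  have hconst : (2 : ℝ≥0∞) ^ (structureFun Ψ q - 1) ≠ ⊤ :=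
    ENNReal.rpow_ne_top_of_ne_zero (by simp) (by simp)
  set Y : Ω → ℝ≥0∞ := fun ω => (2⁻¹ * factor Λ (halfGap c) ω) ^ q with hY
  have hYm : Measurable Y :=
    ((hΛ.measurable_factor (halfGap_mem_finiteAreaSets hw.mem)).const_mul _).pow_const _
  have hY0 : ∀ ω, Y ω ≠ 0 := fun ω => by
    refine (ENNReal.rpow_pos (pos_iff_ne_zero.2 (mul_ne_zero (by simp) (factor_ne_zero _ _)))
      (ENNReal.mul_ne_top (by simp) (factor_ne_top _ _))).ne'
  have hstep : ∀ K : ℕ, ∫⁻ ω, min (X ω ^ q) (Y ω * K) ∂P =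
      2 ^ (structureFun Ψ q - 1) * ∫⁻ ω, min (Z ω ^ q) (1 * K) ∂P := by
    intro K
    have hK : (K : ℝ≥0∞) ≠ ⊤ := ENNReal.natCast_ne_top K
    have hl : Tendsto (fun k : ℕ => ∫⁻ ω, min (weightedLim Λ w (1 / (2 * ((k : ℝ) + 1))) ω ^ q)
        (Y ω * K) ∂P) atTop (𝓝 (∫⁻ ω, min (X ω ^ q) (Y ω * K) ∂P)) := by
      refine tendsto_lintegral_of_dominated_convergence _
        (fun k => ((hΛ.measurable_weightedLim w (hε k)).pow_const q).min (hYm.mul_const _))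
        (fun n => ae_of_all _ fun ω => min_le_right _ _) ?_
        (hX.mono fun ω h => tendsto_min_rpow h q _)
      rw [lintegral_mul_const' _ _ hK, hM.lintegral_half_mul_halfGap_rpow hw.mem hq]
      exact ENNReal.mul_ne_top hconst hK
    have hr : Tendsto (fun k : ℕ => ∫⁻ ω,
        min (weightedLim Λ (fun _ => 1) (1 / ((k : ℝ) + 1)) ω ^ q) K ∂P) atTop
        (𝓝 (∫⁻ ω, min (Z ω ^ q) K ∂P)) :=
      tendsto_lintegral_of_dominated_convergence (fun _ => (K : ℝ≥0∞))
        (fun k => ((hΛ.measurable_weightedLim _ (hε' k)).pow_const q).min measurable_const)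
        (fun n => ae_of_all _ fun ω => min_le_right _ _) (by simp)
        (hZ.mono fun ω h => tendsto_min_rpow h q _)
    have heq : ∀ k : ℕ, ∫⁻ ω, min (weightedLim Λ w (1 / (2 * ((k : ℝ) + 1))) ω ^ q)
        (Y ω * K) ∂P = 2 ^ (structureFun Ψ q - 1) *
          ∫⁻ ω, min (weightedLim Λ (fun _ => 1) (1 / ((k : ℝ) + 1)) ω ^ q) K ∂P := by
      intro k
      have h := hM.lintegral_min_weightedLim hD hw (hε k) (by
        rw [one_div_le_one_div (by positivity) two_pos]
        have : (0 : ℝ) ≤ k := Nat.cast_nonneg k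
        linarith) hq hK
      have h2 : 2 * (1 / (2 * ((k : ℝ) + 1))) = 1 / ((k : ℝ) + 1) := by field_simp
      rwa [h2] at h
    simp_rw [heq] at hl
    simp_rw [one_mul]
    exact tendsto_nhds_unique hl (ENNReal.Tendsto.const_mul hr (Or.inr hconst))
  have hl := tendsto_lintegral_min_rpow_natCast hXm hYm.aemeasurable hY0 q
  simp_rw [hstep] at hl
  exact tendsto_nhds_unique hl (ENNReal.Tendsto.const_mul
    (tendsto_lintegral_min_rpow_natCast hZm aemeasurable_const (fun _ => one_ne_zero) q)
    (Or.inr hconst))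

end Model

/-! ### The infinite moment -/

lemma rpow_add_rpow_lt {ζ : ℝ} (hζ : 1 < ζ) {x y : ℝ≥0∞} (hx0 : x ≠ 0) (hy0 : y ≠ 0)
    (hx : x ≠ ⊤) (hy : y ≠ ⊤) : x ^ ζ + y ^ ζ < (x + y) ^ ζ := by
  have hκ : 0 < ζ - 1 := sub_pos.2 hζ
  have e : ∀ z : ℝ≥0∞, z ^ ζ = z * z ^ (ζ - 1) := fun z => by
    rw [mul_rpow_self hκ.le, sub_add_cancel]
  rw [e, e y, e (x + y), add_mul]
  refine ENNReal.add_lt_add ?_ ?_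
  · exact ENNReal.mul_lt_mul_right hx0 hx
      (ENNReal.rpow_lt_rpow (ENNReal.lt_add_right hx hy0) hκ)
  · refine ENNReal.mul_lt_mul_right hy0 hy (ENNReal.rpow_lt_rpow ?_ hκ)
    rw [add_comm]
    exact ENNReal.lt_add_right hy hx0

section Model

variable {Ω : Type*} [MeasurableSpace Ω] {P : Measure Ω} [IsProbabilityMeasure P] {ψ : ℂ → ℂ}
  {Λ : Set (ℝ × ℝ) → Ω → ℝ} {Ψ : ℝ → ℝ} {ζ : ℝ} {D : ℝ → ℝ → Ω → ℝ}
  {N : ℝ → Ω → FiniteMeasure ℝ} {p : ℝ} {C : ℝ≥0∞}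

/-- Exact scaling of the moments of the limit measure. -/
lemma IsCascadeModel.lintegral_limitMeasure_rpow (hM : IsCascadeModel P ψ Λ Ψ ζ)
    (hD : IsCadlagDensity P Λ D) (hN : IsRightContinuousVersion P D N)
    (hB : HasMomentBound P Λ p C) {q : ℝ} (hq : q ∈ Icc 0 ζ) :
    ∫⁻ ω, limitMeasure N ω (Icc 0 (1 / 2)) ^ q ∂P =
        2 ^ (structureFun Ψ q - 1) * ∫⁻ ω, limitMeasure N ω (Icc 0 1) ^ q ∂P ∧
      ∫⁻ ω, limitMeasure N ω (Icc (1 / 2) 1) ^ q ∂P =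
        2 ^ (structureFun Ψ q - 1) * ∫⁻ ω, limitMeasure N ω (Icc 0 1) ^ q ∂P := by
  have h1 := hM.ae_tendsto_halves hD hN hB (t := fun k => (k : ℝ) + 1) (fun k => by positivity)
    tendsto_natCast_add_one_atTop
  have h2 := hM.ae_tendsto_halves hD hN hB (t := fun k => 2 * ((k : ℝ) + 1))
    (fun k => by positivity) (tendsto_natCast_add_one_atTop.const_mul_atTop two_pos)
  have hZ := h1.mono fun _ h => h.2.2.1
  exact ⟨hM.lintegral_rpow_of_tendsto hD isHalfWeight_leftWeight (h2.mono fun _ h => h.1) hZ hq,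
    hM.lintegral_rpow_of_tendsto hD isHalfWeight_rightWeight (h2.mono fun _ h => h.2.1) hZ hq⟩

lemma IsCascadeModel.lintegral_limitMeasure (hM : IsCascadeModel P ψ Λ Ψ ζ)
    (hD : IsCadlagDensity P Λ D) (hN : IsRightContinuousVersion P D N)
    (hB : HasMomentBound P Λ p C) :
    ∫⁻ ω, limitMeasure N ω (Icc 0 1) ∂P = 1 ∧ ∫⁻ ω, limitMeasure N ω (Icc 0 1) ^ p ∂P < ⊤ := by
  have hε : ∀ k : ℕ, 0 < 1 / ((k : ℝ) + 1) := fun k => by positivity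
  have hlim := (hM.ae_tendsto_halves hD hN hB (t := fun k => (k : ℝ) + 1)
    (fun k => by positivity) tendsto_natCast_add_one_atTop).mono fun _ h => h.2.2.1
  have hm : ∀ k : ℕ, Measurable (weightedLim Λ (fun _ => 1) (1 / ((k : ℝ) + 1))) := fun k =>
    hM.scattered.measurable_weightedLim _ (hε k)
  have hbd : ∀ k : ℕ, ∫⁻ ω, weightedLim Λ (fun _ => 1) (1 / ((k : ℝ) + 1)) ω ^ p ∂P ≤ C :=
    fun k => by simpa using hM.lintegral_weightedLim_rpow_le hD hB isWeight_one (hε k)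
  constructor
  · have h := tendsto_lintegral_of_moment_bound hB.one_lt hB.ne_top
      (fun k => (hm k).aemeasurable) hlim (Eventually.of_forall hbd)
    simp_rw [fun k => hM.lintegral_weightedLim hD hB isWeight_one (hε k)] at h
    refine tendsto_nhds_unique h ?_
    simp
  · exact (lintegral_le_of_ae_tendsto (fun k => ((hm k).pow_const p).aemeasurable)
      (hlim.mono fun ω h => ((ENNReal.continuous_rpow_const (y := p)).tendsto _).comp h)
      (Eventually.of_forall hbd)).trans_lt hB.ne_top.lt_top

/-- If the moment of order `ζ` were finite, it would equal the sum of those of the two halves, by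
exact scaling with `φ(ζ) = 0`. Strict superadditivity of `x ↦ x^ζ` then forces one of the halves to
vanish, so that the moment of order `p`, where `φ(p) < 0`, equals `2^{φ(p)}` times itself; it is
finite, hence `0`, which contradicts that the mean of the total mass is `1`. -/
lemma IsCascadeModel.lintegral_rpow_eq_top (hM : IsCascadeModel P ψ Λ Ψ ζ)
    (hD : IsCadlagDensity P Λ D) (hN : IsRightContinuousVersion P D N)
    (hB : HasMomentBound P Λ p C) (hpζ : p ≤ ζ) (hφp : structureFun Ψ p < 0)
    (hφζ : structureFun Ψ ζ = 0) : ∫⁻ ω, limitMeasure N ω (Icc 0 1) ^ ζ ∂P = ⊤ := by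
  by_contra hfin
  have hζ := hM.one_lt
  have hp0 : 0 < p := by linarith [hB.one_lt]
  have hpow : ∀ s : ℝ, (2 : ℝ≥0∞) ^ (s - 1) + 2 ^ (s - 1) = 2 ^ s := fun s => by
    rw [← two_mul, ENNReal.rpow_sub _ _ (by simp) (by simp), ENNReal.rpow_one,
      ENNReal.mul_div_cancel (by simp) (by simp)]
  obtain ⟨hm0, hm1, hm⟩ := hM.aemeasurable_limitMeasure hD hN hB
  have hsplit := hM.ae_tendsto_halves hD hN hB (t := fun k => (k : ℝ) + 1)
    (fun k => by positivity) tendsto_natCast_add_one_atTop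
  set X : Ω → ℝ≥0∞ := fun ω => limitMeasure N ω (Icc 0 (1 / 2)) with hX
  set Y : Ω → ℝ≥0∞ := fun ω => limitMeasure N ω (Icc (1 / 2) 1) with hY
  set Z : Ω → ℝ≥0∞ := fun ω => limitMeasure N ω (Icc 0 1) with hZ
  have hsum : ∀ q ∈ Icc 0 ζ, ∫⁻ ω, (X ω ^ q + Y ω ^ q) ∂P =
      2 ^ structureFun Ψ q * ∫⁻ ω, Z ω ^ q ∂P := by
    intro q hq
    obtain ⟨h0, h1⟩ := hM.lintegral_limitMeasure_rpow hD hN hB hq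
    rw [lintegral_add_left' (hm0.pow_const q), h0, h1, ← add_mul, hpow]
  have hle : ∀ᵐ ω ∂P, X ω ^ ζ + Y ω ^ ζ ≤ Z ω ^ ζ := by
    filter_upwards [hsplit] with ω h
    rw [show Z ω = X ω + Y ω from h.2.2.2.1]
    exact ENNReal.add_rpow_le_rpow_add _ _ hζ.le
  have heq : ∀ᵐ ω ∂P, X ω ^ ζ + Y ω ^ ζ = Z ω ^ ζ := by
    have h := hsum ζ ⟨by linarith, le_rfl⟩
    rw [hφζ, ENNReal.rpow_zero, one_mul] at h
    exact ae_eq_of_ae_le_of_lintegral_le hle (h ▸ hfin) (hm.pow_const ζ) h.ge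
  have hzero : ∀ᵐ ω ∂P, X ω ^ p + Y ω ^ p = Z ω ^ p := by
    filter_upwards [heq, hsplit] with ω h1 ⟨_, _, _, h2, h3⟩
    have hZω : Z ω = X ω + Y ω := h2
    have hfinite : X ω + Y ω < ⊤ := hZω ▸ h3
    rw [ENNReal.add_lt_top] at hfinite
    rw [hZω] at h1 ⊢
    by_cases hx : X ω = 0
    · simp [hx, hp0]
    by_cases hy : Y ω = 0
    · simp [hy, hp0]
    exact absurd h1 (rpow_add_rpow_lt hζ hx hy hfinite.1.ne hfinite.2.ne).ne
  obtain ⟨hmean, hpfin⟩ := hM.lintegral_limitMeasure hD hN hB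
  have hp := hsum p ⟨hp0.le, hpζ⟩
  rw [lintegral_congr_ae hzero] at hp
  have hlt : (2 : ℝ≥0∞) ^ structureFun Ψ p < 1 :=
    ENNReal.rpow_lt_one_of_one_lt_of_neg (by simp) hφp
  have hI0 : ∫⁻ ω, Z ω ^ p ∂P = 0 := by
    by_contra h0
    have := ENNReal.mul_lt_mul_left h0 hpfin.ne hlt
    rw [one_mul] at this
    exact this.ne hp.symm
  have hZ0 : ∀ᵐ ω ∂P, Z ω = 0 := by
    filter_upwards [(lintegral_eq_zero_iff' (hm.pow_const p)).1 hI0] with ω h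
    exact (ENNReal.rpow_eq_zero_iff_of_pos hp0).1 h
  have : ∫⁻ ω, Z ω ∂P = 0 := by
    rw [lintegral_congr_ae hZ0, lintegral_zero]
  exact one_ne_zero (hmean.symm.trans this)

end Model

/-! ### Lévy models -/

lemma IsScatteredMeasure.isCascadeModel {Ω : Type*} [MeasurableSpace Ω] {P : Measure Ω}
    [IsProbabilityMeasure P] {σ : ℝ} {ν : Measure ℝ} (hν : IsLevyMeasure ν)
    {Λ : Set (ℝ × ℝ) → Ω → ℝ} (hΛ : IsScatteredMeasure P (normExponent σ ν) Λ) {ζ : ℝ}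
    (h0 : 0 ∈ expDomain ν) (hζI : ζ ∈ expDomain ν) (hζ : 1 < ζ) :
    IsCascadeModel P (normExponent σ ν) Λ (logMoment σ ν) ζ where
  scattered := hΛ
  moment B hB q hq := by
    simp_rw [factor_rpow]
    exact lintegral_exp_eq_of_charFun hν h0 hζI (hΛ.measurable B hB) ENNReal.toReal_nonneg
      (hΛ.charFun_eq B hB) hq
  one_lt := hζ
  map_one := logMoment_one σ ν

end ExactCascade

theorem mainTheorem3 {Ω : Type*} [MeasurableSpace Ω] (P : Measure Ω) [IsProbabilityMeasure P]
    (σ : ℝ) (ν : Measure ℝ) (hν : ExactCascade.IsLevyMeasure ν) (hne : σ ≠ 0 ∨ ν ≠ 0)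
    (hI : Icc (0 : ℝ) 1 ⊆ ExactCascade.expDomain ν)
    (Λ : Set (ℝ × ℝ) → Ω → ℝ)
    (hΛ : ExactCascade.IsScatteredMeasure P (ExactCascade.normExponent σ ν) Λ)
    (D : ℝ → ℝ → Ω → ℝ) (hD : ExactCascade.IsCadlagDensity P Λ D)
    (N : ℝ → Ω → FiniteMeasure ℝ) (hN : ExactCascade.IsRightContinuousVersion P D N)
    (ζ : ℝ) (hζ1 : 1 < ζ) (hζI : ζ ∈ ExactCascade.expDomain ν)
    (hζ : ExactCascade.phi σ ν ζ = 0)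
    (hζ' : DifferentiableWithinAt ℝ (ExactCascade.phi σ ν) (ExactCascade.expDomain ν) ζ) :
    AEMeasurable (fun ω => ExactCascade.limitMeasure N ω (Icc 0 (1 / 2)) *
        ExactCascade.limitMeasure N ω (Icc (1 / 2) 1) ^ (ζ - 1)) P ∧
      ∫⁻ ω, ExactCascade.limitMeasure N ω (Icc 0 (1 / 2)) *
        ExactCascade.limitMeasure N ω (Icc (1 / 2) 1) ^ (ζ - 1) ∂P < ⊤ ∧
      ∫⁻ ω, ExactCascade.limitMeasure N ω (Icc 0 1) ^ ζ ∂P = ⊤ := by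
  have h0 : (0 : ℝ) ∈ ExactCascade.expDomain ν := hI (by norm_num)
  have hM := hΛ.isCascadeModel hν h0 hζI hζ1
  have hφ : ∀ q ∈ Ioo 1 ζ, ExactCascade.structureFun (ExactCascade.logMoment σ ν) q < 0 :=
    fun q hq => by
      have h := ExactCascade.phi_neg_of_mem_Ioo hν hne h0 hζI hζ hq
      rwa [ExactCascade.phi_eq_logMoment] at h
  have hφζ : ExactCascade.structureFun (ExactCascade.logMoment σ ν) ζ = 0 := by
    rwa [ExactCascade.phi_eq_logMoment] at hζ
  obtain ⟨p, hp1, hpζ⟩ := exists_between hζ1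
  obtain ⟨C, hC, hCb⟩ := hM.exists_lintegral_block_rpow_le hφ (by linarith) hpζ
  have hB : ExactCascade.HasMomentBound P Λ p C := ⟨hp1, hC, hCb⟩
  obtain ⟨hm0, hm1, -⟩ := hM.aemeasurable_limitMeasure hD hN hB
  exact ⟨hm0.mul (hm1.pow_const _), hM.lintegral_mul_rpow_lt_top hD hN hB hφ hφζ,
    hM.lintegral_rpow_eq_top hD hN hB hpζ.le (hφ p ⟨hp1, hpζ⟩) hφζ⟩
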